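/- Let $d\in\mathbb N$ and let $\omega:[0,\infty)\to[0,\infty)$ be a non-quasianalytic subadditive weight function, i.e. a continuous increasing function such that $\omega(s+t)\le\omega(s)+\omega(t)$ for $s,t\ge0$, $\int_1^\infty\omega(t)t^{-2}\,dt<\infty$, $\log t=o(\omega(t))$ as $t\to\infty$, and $t\mapsto\omega(e^t)$ is convex; put $\omega(z):=\omega(|z|)$ for $z\in\mathbb R^n$. Let $\mathcal S_\omega(\mathbb R^d)$ be the space of all Schwartz functions $u$ such that $\sup_x e^{\mu\omega(x)}|D^\alpha u(x)|<\infty$ and $\sup_\xi e^{\mu\omega(\xi)}|D^\alpha\widehat u(\xi)|<\infty$ for all $\mu>0$ and all multi-indices $\alpha$, where $\widehat u(\xi)=\int e^{-i\langle x,\xi\rangle}u(x)\,dx$, with the locally convex topology given by these seminorms. Let $\mathcal S'_\omega(\mathbb R^d)$ be its dual, let $\langle f,\varphi\rangle:=f(\overline\varphi)$ for $f\in\mathcal S'_\omega(\mathbb R^d)$, $\varphi\in\mathcal S_\omega(\mathbb R^d)$, and embed $\mathcal S_\omega(\mathbb R^d)$ in $\mathcal S'_\omega(\mathbb R^d)$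 by letting $g$ act as $u\mapsto\int g\,u$. Fix a window $\varphi\in\mathcal S_\omega(\mathbb R^d)\setminus\{0\}$; the short-time Fourier transform of $f\in\mathcal S'_\omega(\mathbb R^d)$ is $V_\varphi f(z)=\langle f,\Pi(z)\varphi\rangle$ for $z=(x,\xi)\in\mathbb R^{2d}$, where $\Pi(z)\varphi(y)=e^{i\langle y,\xi\rangle}\varphi(y-x)$. Let $\lambda\in\mathbb R\setminus\{0\}$ and $m_\lambda(z)=e^{\lambda\omega(z)}$. For $r,s\in[1,\infty]$ and a weight $m=m_{\lambda}$ or $m=1/m_\lambda=m_{-\lambda}$, let $\boldsymbol M^{r,s}_{m}(\mathbb R^d)$ be the space of all $f\in\mathcal S'_\omega(\mathbb R^d)$ with $$\|f\|_{\boldsymbol M^{r,s}_{m}}:=\Big(\int_{\mathbb R^d}\Big(\int_{\mathbb R^d}|V_\varphi f(x,\xi)|^r m(x,\xi)^r\,dx\Big)^{s/r}d\xi\Big)^{1/s}<\infty$$ (with essential suprema in place of the integrals if $r=\infty$ or $s=\infty$). Theorem. Let $1\le p,q<\infty$, and let $p',q'$ be the conjugate exponents of $p,q$. (i) $\mathcal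 S_\omega(\mathbb R^d)$ is a dense subspace of $\boldsymbol M^{p,q}_{m_\lambda}(\mathbb R^d)$. (ii) $(\boldsymbol M^{p,q}_{m_\lambda})^*=\boldsymbol M^{p',q'}_{1/m_\lambda}$ in the following sense. For all $f\in\boldsymbol M^{p,q}_{m_\lambda}$ and $h\in\boldsymbol M^{p',q'}_{1/m_\lambda}$ the function $V_\varphi f\,\overline{V_\varphi h}$ is integrable on $\mathbb R^{2d}$, and the map sending $h$ to the functional $$f\longmapsto\int_{\mathbb R^{2d}}V_\varphi f(z)\,\overline{V_\varphi h(z)}\,dz$$ is a bijective conjugate-linear homeomorphism (that is, an isomorphism with equivalent norms) of $\boldsymbol M^{p',q'}_{1/m_\lambda}$ onto the space of continuous linear functionals on $\boldsymbol M^{p,q}_{m_\lambda}$ with the operator norm. -/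

import Mathlib

open MeasureTheory Set Filter Asymptotics
open scoped ENNReal SchwartzMap Topology ComplexConjugate

noncomputable section

/-- The space `ℝᵈ` with its Euclidean norm. -/
abbrev RSpace (d : ℕ) : Type := EuclideanSpace ℝ (Fin d)

/-- A non-quasianalytic subadditive weight function `ω : [0,∞) → [0,∞)`.  It is represented by a
function on `ℝ`, of which only the values on `[0,∞)` are ever constrained or used. -/
structure WeightFunction where
  /-- the underlying function -/
  toFun : ℝ → ℝ
  continuousOn : ContinuousOn toFun (Ici 0)
  nonneg : ∀ t, 0 ≤ t → 0 ≤ toFun t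
  increasing : MonotoneOn toFun (Ici 0)
  subadditive : ∀ s t, 0 ≤ s → 0 ≤ t → toFun (s + t) ≤ toFun s + toFun t
  nonquasianalytic : IntegrableOn (fun t => toFun t / t ^ 2) (Ici 1)
  log_isLittleO : Real.log =o[atTop] toFun
  convex_exp : ConvexOn ℝ univ (fun t : ℝ => toFun (Real.exp t))

/-- `ω(x) := ω(|x|)` for `x ∈ ℝᵈ`. -/
def WeightFunction.at (ω : WeightFunction) {d : ℕ} (x : RSpace d) : ℝ := ω.toFun ‖x‖

variable {d : ℕ}

/-- The Fourier transform `û(ξ) = ∫ e^{-i⟨x,ξ⟩} u(x) dx`. -/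
def hatTransform (u : RSpace d → ℂ) (ξ : RSpace d) : ℂ :=
  ∫ x : RSpace d, Complex.exp (-(Complex.I * (inner ℝ x ξ : ℝ))) * u x

/-- The condition: for all `λ > 0` and all orders `k`, the function `e^{λω(x)} |Dᵏu(x)|` is bounded.
Here `|Dᵏu(x)|` is the operator norm of the `k`-th derivative; bounding it for every `k` is the
same as bounding all partial derivatives `D^α u`. -/
def WeightedBounded (ω : WeightFunction) (u : RSpace d → ℂ) : Prop :=
  ∀ lam : ℝ, 0 < lam → ∀ k : ℕ, ∃ C : ℝ, ∀ x : RSpace d,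
    Real.exp (lam * ω.at x) * ‖iteratedFDeriv ℝ k u x‖ ≤ C

theorem WeightFunction.at_nonneg (ω : WeightFunction) (x : RSpace d) : 0 ≤ ω.at x :=
  ω.nonneg _ (norm_nonneg x)

theorem WeightFunction.at_add_le (ω : WeightFunction) (x y : RSpace d) :
    ω.at (x + y) ≤ ω.at x + ω.at y :=
  (ω.increasing (norm_nonneg (x + y)) (add_nonneg (norm_nonneg x) (norm_nonneg y))
    (norm_add_le x y)).trans (ω.subadditive _ _ (norm_nonneg _) (norm_nonneg _))

theorem WeightFunction.at_neg (ω : WeightFunction) (x : RSpace d) : ω.at (-x) = ω.at x := by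
  simp [WeightFunction.at]

theorem WeightedBounded.add {ω : WeightFunction} {u v : RSpace d → ℂ}
    (hu' : ContDiff ℝ (⊤ : ℕ∞) u) (hv' : ContDiff ℝ (⊤ : ℕ∞) v)
    (hu : WeightedBounded ω u) (hv : WeightedBounded ω v) : WeightedBounded ω (u + v) := by
  intro lam hlam k
  obtain ⟨C, hC⟩ := hu lam hlam k
  obtain ⟨D, hD⟩ := hv lam hlam k
  refine ⟨C + D, fun x => ?_⟩
  rw [iteratedFDeriv_add_apply ((hu'.of_le (by exact_mod_cast le_top)).contDiffAt)
    ((hv'.of_le (by exact_mod_cast le_top)).contDiffAt)]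
  calc _ ≤ Real.exp (lam * ω.at x) *
        (‖iteratedFDeriv ℝ k u x‖ + ‖iteratedFDeriv ℝ k v x‖) := by
        gcongr; exact norm_add_le _ _
    _ ≤ C + D := by rw [mul_add]; exact add_le_add (hC x) (hD x)

theorem WeightedBounded.smul {ω : WeightFunction} {u : RSpace d → ℂ}
    (hu' : ContDiff ℝ (⊤ : ℕ∞) u) (hu : WeightedBounded ω u) (c : ℂ) : WeightedBounded ω (c • u) := by
  intro lam hlam k
  obtain ⟨C, hC⟩ := hu lam hlam k
  refine ⟨‖c‖ * C, fun x => ?_⟩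
  rw [iteratedFDeriv_const_smul_apply ((hu'.of_le (by exact_mod_cast le_top)).contDiffAt),
    norm_smul, mul_left_comm]
  exact mul_le_mul_of_nonneg_left (hC x) (norm_nonneg c)

theorem WeightedBounded.comp_sub {ω : WeightFunction} {u : RSpace d → ℂ}
    (hu : WeightedBounded ω u) (a : RSpace d) : WeightedBounded ω (fun x => u (x - a)) := by
  intro lam hlam k
  obtain ⟨C, hC⟩ := hu lam hlam k
  refine ⟨Real.exp (lam * ω.at a) * C, fun x => ?_⟩
  rw [iteratedFDeriv_comp_sub]
  have h : ω.at x ≤ ω.at a + ω.at (x - a) := by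
    simpa using ω.at_add_le a (x - a)
  calc _ ≤ Real.exp (lam * ω.at a + lam * ω.at (x - a)) * ‖iteratedFDeriv ℝ k u (x - a)‖ := by
        gcongr; nlinarith
    _ = Real.exp (lam * ω.at a) *
        (Real.exp (lam * ω.at (x - a)) * ‖iteratedFDeriv ℝ k u (x - a)‖) := by
        rw [Real.exp_add, mul_assoc]
    _ ≤ _ := by gcongr; exact hC _

theorem WeightedBounded.comp_neg {ω : WeightFunction} {u : RSpace d → ℂ}
    (hu : WeightedBounded ω u) : WeightedBounded ω (fun x => u (-x)) := by
  intro lam hlam k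
  obtain ⟨C, hC⟩ := hu lam hlam k
  refine ⟨C, fun x => ?_⟩
  have h := (LinearIsometryEquiv.neg ℝ (E := RSpace d)).norm_iteratedFDeriv_comp_right
    (𝕜 := ℝ) u x k
  have h2 : (u ∘ (LinearIsometryEquiv.neg ℝ (E := RSpace d))) = fun x => u (-x) := rfl
  rw [h2] at h
  rw [h, ← ω.at_neg]
  exact hC (-x)

theorem WeightedBounded.conj {ω : WeightFunction} {u : RSpace d → ℂ}
    (hu : WeightedBounded ω u) : WeightedBounded ω (fun x => conj (u x)) := by
  intro lam hlam k
  obtain ⟨C, hC⟩ := hu lam hlam k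
  refine ⟨C, fun x => ?_⟩
  have h := Complex.conjLIE.norm_iteratedFDeriv_comp_left (𝕜 := ℝ) u x k
  have h2 : (Complex.conjLIE ∘ u) = fun x => (starRingEnd ℂ) (u x) := rfl
  rw [h2] at h
  rw [h]
  exact hC x

/-- The character `y ↦ e^{i⟨y,ξ⟩}`. -/
def character (ξ y : RSpace d) : ℂ := Complex.exp (Complex.I * (inner ℝ y ξ : ℝ))

theorem character_eq (ξ : RSpace d) :
    character ξ = (fun t : ℝ => Complex.exp (Complex.I * t)) ∘ (innerSL ℝ ξ) := by
  ext y
  simp [character, real_inner_comm]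

theorem contDiff_cexp_I : ContDiff ℝ (⊤ : ℕ∞) (fun t : ℝ => Complex.exp (Complex.I * t)) :=
  (contDiff_const.mul Complex.ofRealCLM.contDiff).cexp

theorem contDiff_character (ξ : RSpace d) : ContDiff ℝ (⊤ : ℕ∞) (character ξ) := by
  rw [character_eq]
  exact contDiff_cexp_I.comp (innerSL ℝ ξ).contDiff

theorem norm_character (ξ y : RSpace d) : ‖character ξ y‖ = 1 := by
  rw [character, mul_comm]
  exact Complex.norm_exp_ofReal_mul_I _

theorem iteratedDeriv_cexp_I (k : ℕ) :
    iteratedDeriv k (fun t : ℝ => Complex.exp (Complex.I * t)) =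
      fun t : ℝ => Complex.I ^ k * Complex.exp (Complex.I * t) := by
  induction k with
  | zero => simp
  | succ k ih =>
    rw [iteratedDeriv_succ, ih]
    ext t
    have h : HasDerivAt (fun t : ℝ => Complex.I ^ k * Complex.exp (Complex.I * t))
        (Complex.I ^ k * (Complex.exp (Complex.I * t) * (Complex.I * 1))) t :=
      (((Complex.ofRealCLM.hasDerivAt (x := t)).const_mul Complex.I).cexp).const_mul _
    rw [h.deriv]
    ring

theorem norm_iteratedFDeriv_character_le (ξ y : RSpace d) (k : ℕ) :
    ‖iteratedFDeriv ℝ k (character ξ) y‖ ≤ ‖ξ‖ ^ k := by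
  rw [character_eq, (innerSL ℝ ξ).iteratedFDeriv_comp_right contDiff_cexp_I y
    (by exact_mod_cast le_top)]
  refine (ContinuousMultilinearMap.norm_compContinuousLinearMap_le _ _).trans ?_
  rw [norm_iteratedFDeriv_eq_norm_iteratedDeriv, iteratedDeriv_cexp_I]
  simp

theorem WeightedBounded.character_mul {ω : WeightFunction} {u : RSpace d → ℂ}
    (hu' : ContDiff ℝ (⊤ : ℕ∞) u) (hu : WeightedBounded ω u) (ξ : RSpace d) :
    WeightedBounded ω (fun x => character ξ x * u x) := by
  intro lam hlam k
  choose C hC using hu lam hlam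
  refine ⟨∑ i ∈ Finset.range (k + 1), (k.choose i : ℝ) * ‖ξ‖ ^ i * C (k - i), fun x => ?_⟩
  refine (mul_le_mul_of_nonneg_left (norm_iteratedFDeriv_mul_le (contDiff_character ξ) hu' x
    (n := k) (by exact_mod_cast le_top)) (Real.exp_pos _).le).trans ?_
  rw [Finset.mul_sum]
  refine Finset.sum_le_sum fun i _ => ?_
  calc _ = (k.choose i : ℝ) * ‖iteratedFDeriv ℝ i (character ξ) x‖ *
        (Real.exp (lam * ω.at x) * ‖iteratedFDeriv ℝ (k - i) u x‖) := by ring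
    _ ≤ _ := by
      gcongr
      · exact norm_iteratedFDeriv_character_le ξ x i
      · exact hC _ x

/-! ### Elementary properties of the Fourier transform -/

theorem hatTransform_eq (u : 𝓢(RSpace d, ℂ)) :
    hatTransform u = fun ξ => (FourierTransform.fourier u) ((2 * Real.pi)⁻¹ • ξ) := by
  ext ξ
  rw [SchwartzMap.fourier_coe, Real.fourier_eq', hatTransform]
  congr 1
  ext x
  rw [inner_smul_right, smul_eq_mul]
  congr 2
  have : (Real.pi : ℂ) ≠ 0 := by exact_mod_cast Real.pi_ne_zero
  push_cast
  field_simp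

theorem contDiff_hatTransform (u : 𝓢(RSpace d, ℂ)) : ContDiff ℝ (⊤ : ℕ∞) (hatTransform u) := by
  rw [hatTransform_eq]
  exact ((FourierTransform.fourier u).smooth ⊤).comp (contDiff_const_smul _)

theorem integrable_hat_integrand (u : 𝓢(RSpace d, ℂ)) (ξ : RSpace d) :
    Integrable (fun x : RSpace d => Complex.exp (-(Complex.I * (inner ℝ x ξ : ℝ))) * u x) := by
  refine Integrable.bdd_mul (c := 1) u.integrable (Continuous.aestronglyMeasurable (by fun_prop)) ?_
  refine Eventually.of_forall fun x => ?_
  have h : -(Complex.I * (inner ℝ x ξ : ℝ)) = ((-(inner ℝ x ξ : ℝ) : ℝ) : ℂ) * Complex.I := by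
    push_cast; ring
  rw [h, Complex.norm_exp_ofReal_mul_I]

theorem hatTransform_add (u v : 𝓢(RSpace d, ℂ)) :
    hatTransform (⇑(u + v)) = hatTransform u + hatTransform v := by
  ext ξ
  rw [Pi.add_apply, hatTransform, hatTransform, hatTransform,
    ← integral_add (integrable_hat_integrand u ξ) (integrable_hat_integrand v ξ)]
  congr 1
  ext x
  simp [mul_add]

theorem hatTransform_smul (c : ℂ) (u : 𝓢(RSpace d, ℂ)) :
    hatTransform (⇑(c • u)) = c • hatTransform u := by
  ext ξ
  rw [Pi.smul_apply, hatTransform, hatTransform, smul_eq_mul, ← integral_const_mul]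
  congr 1
  ext x
  simp only [smul_apply, smul_eq_mul]
  ring

theorem hatTransform_conj (u : RSpace d → ℂ) :
    hatTransform (fun x => conj (u x)) = fun ξ => conj (hatTransform u (-ξ)) := by
  ext ξ
  rw [hatTransform, hatTransform, ← integral_conj]
  congr 1
  ext x
  rw [map_mul, ← Complex.exp_conj]
  simp

theorem hatTransform_shift (u : RSpace d → ℂ) (a ξ : RSpace d) :
    hatTransform (fun y => character ξ y * u (y - a)) =
      fun η => character ξ a * (character (-a) η * hatTransform u (η - ξ)) := by
  ext η
  rw [hatTransform, ← integral_add_right_eq_self _ a, hatTransform, ← integral_const_mul,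
    ← integral_const_mul]
  congr 1
  ext y
  rw [add_sub_cancel_right, character, character, character, ← mul_assoc, ← mul_assoc, ← mul_assoc,
    ← Complex.exp_add, ← Complex.exp_add, ← Complex.exp_add]
  congr 2
  rw [inner_add_left, inner_add_left, inner_neg_right, inner_sub_right, real_inner_comm a η]
  push_cast
  ring

/-! ### The space `S_ω(ℝᵈ)` -/

/-- `S_ω(ℝᵈ)` as a subspace of the Schwartz space: the `u` such that `e^{λω} |Dᵏu|` and
`e^{λω} |Dᵏû|` are bounded for all `λ > 0` and all `k`. -/
def sOmegaSubmodule (ω : WeightFunction) (d : ℕ) : Submodule ℂ 𝓢(RSpace d, ℂ) where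
  carrier := {u | WeightedBounded ω u ∧ WeightedBounded ω (hatTransform u)}
  zero_mem' := by
    have h0 : (⇑(0 : 𝓢(RSpace d, ℂ))) = 0 := rfl
    have h2 (k : ℕ) (x : RSpace d) : iteratedFDeriv ℝ k (0 : RSpace d → ℂ) x = 0 := by
      have := congrFun (iteratedFDeriv_fun_zero (𝕜 := ℝ) (E := RSpace d) (F := ℂ) (n := k)) x
      exact this
    have h1 : hatTransform (0 : RSpace d → ℂ) = 0 := by ext; simp [hatTransform]
    refine ⟨fun lam _ k => ⟨0, fun x => ?_⟩, fun lam _ k => ⟨0, fun x => ?_⟩⟩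
    · rw [h0, h2]; simp
    · rw [h0, h1, h2]; simp
  add_mem' {u v} hu hv := by
    refine ⟨hu.1.add (u.smooth ⊤) (v.smooth ⊤) hv.1, ?_⟩
    rw [hatTransform_add]
    exact hu.2.add (contDiff_hatTransform u) (contDiff_hatTransform v) hv.2
  smul_mem' c u hu := by
    refine ⟨hu.1.smul (u.smooth ⊤) c, ?_⟩
    rw [hatTransform_smul]
    exact hu.2.smul (contDiff_hatTransform u) c

/-- The space `S_ω(ℝᵈ)`; it carries its own locally convex topology, defined below, and not the
one induced by the Schwartz space. -/
def SOmega (ω : WeightFunction) (d : ℕ) : Type := ↥(sOmegaSubmodule ω d)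

namespace SOmega

variable {ω : WeightFunction}

instance : AddCommGroup (SOmega ω d) := inferInstanceAs (AddCommGroup ↥(sOmegaSubmodule ω d))
instance : Module ℂ (SOmega ω d) := inferInstanceAs (Module ℂ ↥(sOmegaSubmodule ω d))

/-- The underlying Schwartz function. -/
def toSchwartz : SOmega ω d →ₗ[ℂ] 𝓢(RSpace d, ℂ) := (sOmegaSubmodule ω d).subtype

instance : CoeFun (SOmega ω d) (fun _ => RSpace d → ℂ) := ⟨fun u => u.toSchwartz⟩

theorem bounded (u : SOmega ω d) : WeightedBounded ω u := u.2.1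

theorem bounded_hat (u : SOmega ω d) : WeightedBounded ω (hatTransform u) := u.2.2

end SOmega

/-- The quantity `sup_x e^{λω(x)} |Dᵏu(x)|`. -/
def weightedSup (ω : WeightFunction) (lam : ℝ) (k : ℕ) (u : RSpace d → ℂ) : ℝ :=
  ⨆ x : RSpace d, Real.exp (lam * ω.at x) * ‖iteratedFDeriv ℝ k u x‖

theorem le_weightedSup {ω : WeightFunction} {lam : ℝ} (hlam : 0 < lam) (k : ℕ)
    {u : RSpace d → ℂ} (hu : WeightedBounded ω u) (x : RSpace d) :
    Real.exp (lam * ω.at x) * ‖iteratedFDeriv ℝ k u x‖ ≤ weightedSup ω lam k u := by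
  obtain ⟨C, hC⟩ := hu lam hlam k
  exact le_ciSup (f := fun x => Real.exp (lam * ω.at x) * ‖iteratedFDeriv ℝ k u x‖)
    ⟨C, by rintro _ ⟨y, rfl⟩; exact hC y⟩ x

theorem weightedSup_add_le {ω : WeightFunction} {lam : ℝ} (hlam : 0 < lam) (k : ℕ)
    {u v : RSpace d → ℂ} (hu' : ContDiff ℝ (⊤ : ℕ∞) u) (hv' : ContDiff ℝ (⊤ : ℕ∞) v)
    (hu : WeightedBounded ω u) (hv : WeightedBounded ω v) :
    weightedSup ω lam k (u + v) ≤ weightedSup ω lam k u + weightedSup ω lam k v := by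
  refine ciSup_le fun x => ?_
  rw [iteratedFDeriv_add_apply ((hu'.of_le (by exact_mod_cast le_top)).contDiffAt)
    ((hv'.of_le (by exact_mod_cast le_top)).contDiffAt)]
  calc _ ≤ Real.exp (lam * ω.at x) *
        (‖iteratedFDeriv ℝ k u x‖ + ‖iteratedFDeriv ℝ k v x‖) := by
        gcongr; exact norm_add_le _ _
    _ ≤ _ := by
        rw [mul_add]
        exact add_le_add (le_weightedSup hlam k hu x) (le_weightedSup hlam k hv x)

theorem weightedSup_smul {ω : WeightFunction} (lam : ℝ) (k : ℕ)
    {u : RSpace d → ℂ} (hu' : ContDiff ℝ (⊤ : ℕ∞) u) (c : ℂ) :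
    weightedSup ω lam k (c • u) = ‖c‖ * weightedSup ω lam k u := by
  rw [weightedSup, weightedSup, Real.mul_iSup_of_nonneg (norm_nonneg c)]
  congr 1
  ext x
  rw [iteratedFDeriv_const_smul_apply ((hu'.of_le (by exact_mod_cast le_top)).contDiffAt),
    norm_smul, mul_left_comm]

namespace SOmega

variable {ω : WeightFunction}

/-- The seminorm `u ↦ sup_x e^{λω(x)} |Dᵏu(x)|`. -/
def seminormFun (lam : {l : ℝ // 0 < l}) (k : ℕ) : Seminorm ℂ (SOmega ω d) :=
  Seminorm.of (fun u => weightedSup ω lam.1 k u)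
    (fun u v => weightedSup_add_le lam.2 k (u.toSchwartz.smooth ⊤) (v.toSchwartz.smooth ⊤)
      u.bounded v.bounded)
    (fun c u => weightedSup_smul lam.1 k (u.toSchwartz.smooth ⊤) c)

/-- The seminorm `u ↦ sup_ξ e^{λω(ξ)} |Dᵏû(ξ)|`. -/
def seminormHat (lam : {l : ℝ // 0 < l}) (k : ℕ) : Seminorm ℂ (SOmega ω d) :=
  Seminorm.of (fun u => weightedSup ω lam.1 k (hatTransform u))
    (fun u v => by
      have h : (⇑(u + v).toSchwartz : RSpace d → ℂ) = ⇑(u.toSchwartz + v.toSchwartz) := rfl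
      rw [h, hatTransform_add]
      exact weightedSup_add_le lam.2 k (contDiff_hatTransform u.toSchwartz)
        (contDiff_hatTransform v.toSchwartz) u.bounded_hat v.bounded_hat)
    (fun c u => by
      have h : (⇑(c • u).toSchwartz : RSpace d → ℂ) = ⇑(c • u.toSchwartz) := rfl
      rw [h, hatTransform_smul]
      exact weightedSup_smul lam.1 k (contDiff_hatTransform u.toSchwartz) c)

/-- The seminorms defining the topology of `S_ω(ℝᵈ)`. -/
def seminormFamily (ω : WeightFunction) (d : ℕ) :
    SeminormFamily ℂ (SOmega ω d) (({l : ℝ // 0 < l} × ℕ) ⊕ ({l : ℝ // 0 < l} × ℕ)) :=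
  Sum.elim (fun i => seminormFun i.1 i.2) (fun i => seminormHat i.1 i.2)

instance : TopologicalSpace (SOmega ω d) := (seminormFamily ω d).moduleFilterBasis.topology

theorem withSeminorms (ω : WeightFunction) (d : ℕ) : WithSeminorms (seminormFamily ω d) := ⟨rfl⟩

/-- Complex conjugation on `S_ω(ℝᵈ)`. -/
def conjugate (u : SOmega ω d) : SOmega ω d :=
  ⟨SchwartzMap.postcompCLM (𝕜 := ℝ) (Complex.conjCLE : ℂ →L[ℝ] ℂ) u.toSchwartz, by
    have h : (⇑(SchwartzMap.postcompCLM (𝕜 := ℝ) (Complex.conjCLE : ℂ →L[ℝ] ℂ) u.toSchwartz) :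
        RSpace d → ℂ) = fun x => conj (u x) := by
      ext x; simp
    refine ⟨?_, ?_⟩
    · rw [h]; exact u.bounded.conj
    · rw [h, hatTransform_conj]; exact u.bounded_hat.comp_neg.conj⟩

@[simp] theorem conjugate_apply (u : SOmega ω d) (y : RSpace d) : u.conjugate y = conj (u y) := by
  change (SchwartzMap.postcompCLM (𝕜 := ℝ) (Complex.conjCLE : ℂ →L[ℝ] ℂ) u.toSchwartz) y = _
  simp

theorem hasTemperateGrowth_character (ξ : RSpace d) : (character ξ).HasTemperateGrowth := by
  refine ⟨contDiff_character ξ, fun k => ⟨0, ‖ξ‖ ^ k, fun y => ?_⟩⟩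
  simpa using norm_iteratedFDeriv_character_le ξ y k

/-- The Schwartz function `y ↦ e^{i⟨y,ξ⟩} u(y - x)`. -/
def shiftSchwartz (z : RSpace d × RSpace d) (u : 𝓢(RSpace d, ℂ)) : 𝓢(RSpace d, ℂ) :=
  SchwartzMap.smulLeftCLM ℂ (character z.2) (SchwartzMap.compSubConstCLM ℂ z.1 u)

theorem shiftSchwartz_coe (z : RSpace d × RSpace d) (u : 𝓢(RSpace d, ℂ)) :
    ⇑(shiftSchwartz z u) = fun y => character z.2 y * u (y - z.1) := by
  ext y
  rw [shiftSchwartz, SchwartzMap.smulLeftCLM_apply_apply (hasTemperateGrowth_character z.2)]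
  simp

/-- The phase-space shift `Π(z)u(y) = e^{i⟨y,ξ⟩} u(y - x)`, `z = (x, ξ)`, on `S_ω(ℝᵈ)`. -/
def shift (z : RSpace d × RSpace d) (u : SOmega ω d) : SOmega ω d :=
  ⟨shiftSchwartz z u.toSchwartz, by
    have hs : ContDiff ℝ (⊤ : ℕ∞) (fun y => u (y - z.1)) :=
      (u.toSchwartz.smooth ⊤).comp (contDiff_id.sub contDiff_const)
    have hs' : ContDiff ℝ (⊤ : ℕ∞) (fun y => hatTransform u (y - z.2)) :=
      (contDiff_hatTransform u.toSchwartz).comp (contDiff_id.sub contDiff_const)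
    refine ⟨?_, ?_⟩
    · rw [shiftSchwartz_coe]
      exact (u.bounded.comp_sub z.1).character_mul hs z.2
    · rw [shiftSchwartz_coe, hatTransform_shift]
      exact ((u.bounded_hat.comp_sub z.2).character_mul hs' (-z.1)).smul
        ((contDiff_character (-z.1)).mul hs') (character z.2 z.1)⟩

theorem shift_apply (z : RSpace d × RSpace d) (u : SOmega ω d) (y : RSpace d) :
    u.shift z y = Complex.exp (Complex.I * (inner ℝ y z.2 : ℝ)) * u (y - z.1) :=
  congrFun (shiftSchwartz_coe z u.toSchwartz) y

end SOmega

/-- The space `S'_ω(ℝᵈ)` of `ω`-tempered distributions: continuous linear functionals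
on `S_ω(ℝᵈ)`. -/
abbrev OmegaDistribution (ω : WeightFunction) (d : ℕ) : Type := SOmega ω d →L[ℂ] ℂ

namespace OmegaDistribution

variable {ω : WeightFunction}

/-- The conjugate-linear action `⟨f, φ⟩ = f(φ̄)` of `S'_ω` on `S_ω`, which is consistent with the
inner product `⟨f, φ⟩ = ∫ f φ̄` of `L²`. -/
def conjPairing (f : OmegaDistribution ω d) (φ : SOmega ω d) : ℂ := f φ.conjugate

/-- The short-time Fourier transform `V_φ f(z) = ⟨f, Π(z)φ⟩`. -/
def stft (φ : SOmega ω d) (f : OmegaDistribution ω d) (z : RSpace d × RSpace d) : ℂ :=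
  f.conjPairing (φ.shift z)

end OmegaDistribution

theorem SOmega.integrable_mul {ω : WeightFunction} (g u : SOmega ω d) :
    Integrable (fun y => g y * u y) := by
  refine Integrable.mul_bdd (c := weightedSup ω 1 0 u) g.toSchwartz.integrable
    u.toSchwartz.continuous.aestronglyMeasurable (Eventually.of_forall fun y => ?_)
  have h := le_weightedSup one_pos 0 u.bounded y
  rw [norm_iteratedFDeriv_zero] at h
  refine le_trans ?_ h
  exact le_mul_of_one_le_left (norm_nonneg _)
    (Real.one_le_exp (by rw [one_mul]; exact ω.at_nonneg y))

/-- The linear functional `u ↦ ∫ g u` on `S_ω`. -/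
def SOmega.integralFunctional {ω : WeightFunction} (g : SOmega ω d) : SOmega ω d →ₗ[ℂ] ℂ where
  toFun u := ∫ y, g y * u y
  map_add' u v := by
    rw [← integral_add (g.integrable_mul u) (g.integrable_mul v)]
    congr 1; ext y; exact mul_add _ _ _
  map_smul' c u := by
    rw [RingHom.id_apply, smul_eq_mul, ← integral_const_mul]
    congr 1; ext y; exact mul_left_comm _ _ _

/-- The embedding `S_ω ⊂ S'_ω`: the function `g` acts by `u ↦ ∫ g u`. -/
def SOmega.toDistribution {ω : WeightFunction} (g : SOmega ω d) : OmegaDistribution ω d where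
  toLinearMap := g.integralFunctional
  cont := by
    refine WithSeminorms.continuous_normedSpace_rng ℂ (SOmega.withSeminorms ω d)
      g.integralFunctional ?_
    refine ⟨{Sum.inl (⟨1, one_pos⟩, 0)}, ⟨∫ y, ‖g y‖, integral_nonneg fun _ => norm_nonneg _⟩,
      fun u => ?_⟩
    rw [Finset.sup_singleton]
    change ‖∫ y, g y * u y‖ ≤ (∫ y, ‖g y‖) * weightedSup ω 1 0 u
    rw [← integral_mul_const]
    refine norm_integral_le_of_norm_le (g.toSchwartz.integrable.norm.mul_const _)
      (Eventually.of_forall fun y => ?_)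
    rw [norm_mul]
    refine mul_le_mul_of_nonneg_left ?_ (norm_nonneg _)
    have h := le_weightedSup one_pos 0 u.bounded y
    rw [norm_iteratedFDeriv_zero] at h
    exact le_trans (le_mul_of_one_le_left (norm_nonneg _)
      (Real.one_le_exp (by rw [one_mul]; exact ω.at_nonneg y))) h

/-! ### Weighted mixed-norm spaces and modulation spaces -/

/-- The weight `m_λ(z) = e^{λω(z)}` on `ℝ²ᵈ`, where `ω(z) = ω(|z|)` and
`|z|² = |x|² + |ξ|²` for `z = (x, ξ)`. -/
def expWeight (ω : WeightFunction) (lam : ℝ) (z : RSpace d × RSpace d) : ℝ :=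
  Real.exp (lam * ω.toFun (Real.sqrt (‖z.1‖ ^ 2 + ‖z.2‖ ^ 2)))

/-- `1 / m_λ = m_{-λ}`. -/
theorem expWeight_neg (ω : WeightFunction) (lam : ℝ) (z : RSpace d × RSpace d) :
    expWeight ω (-lam) z = 1 / expWeight ω lam z := by
  rw [expWeight, expWeight, neg_mul, Real.exp_neg, one_div]

/-- The mixed norm of `L^{p,q}_m`: the `L^p` norm in `x` of `F(x,ξ) m(x,ξ)`, followed by the `L^q`
norm in `ξ` (essential suprema where an exponent is `∞`). -/
def mixedNorm (p q : ℝ≥0∞) (m : RSpace d × RSpace d → ℝ) (F : RSpace d × RSpace d → ℂ) : ℝ≥0∞ :=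
  eLpNorm (fun ξ : RSpace d => eLpNorm (fun x : RSpace d => F (x, ξ) * (m (x, ξ) : ℂ)) p volume)
    q volume

/-- Membership in `L^{p,q}_m(ℝ²ᵈ)`. -/
def MemMixed (p q : ℝ≥0∞) (m : RSpace d × RSpace d → ℝ) (F : RSpace d × RSpace d → ℂ) : Prop :=
  Measurable F ∧ mixedNorm p q m F < ∞

variable {ω : WeightFunction}

theorem measurable_expWeight (ω : WeightFunction) (lam : ℝ) :
    Measurable (fun z : RSpace d × RSpace d => expWeight ω lam z) := by
  have h : Continuous (fun z : RSpace d × RSpace d =>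
      ω.toFun (Real.sqrt (‖z.1‖ ^ 2 + ‖z.2‖ ^ 2))) :=
    ω.continuousOn.comp_continuous (by fun_prop) (fun z => Real.sqrt_nonneg _)
  exact (Real.continuous_exp.comp (continuous_const.mul h)).measurable

theorem measurable_slice_eLpNorm (p : ℝ≥0∞) {G : RSpace d × RSpace d → ℂ} (hG : Measurable G) :
    Measurable (fun ξ : RSpace d => eLpNorm (fun x : RSpace d => G (x, ξ)) p volume) := by
  rcases eq_or_ne p 0 with rfl | h0
  · simp
  rcases eq_or_ne p ∞ with rfl | hp
  · simp only [eLpNorm_exponent_top, eLpNormEssSup]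
    refine measurable_of_Ioi fun a => ?_
    have h : (fun ξ : RSpace d => essSup (fun x : RSpace d => ‖G (x, ξ)‖ₑ) volume) ⁻¹' Ioi a =
        {ξ | volume ((fun x : RSpace d => (x, ξ)) ⁻¹' {z | a < ‖G z‖ₑ}) ≠ 0} := by
      ext ξ
      rw [mem_preimage, mem_Ioi, mem_ofPred_eq, ← not_le, not_iff_not]
      constructor
      · intro h
        have := (ENNReal.ae_le_essSup (fun x : RSpace d => ‖G (x, ξ)‖ₑ) (μ := volume)).mono
          fun x hx => hx.trans h
        rw [ae_iff] at this
        simpa using this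
      · intro h
        refine essSup_le_of_ae_le a ?_
        rw [EventuallyLE, ae_iff]
        simpa using h
    rw [h]
    exact (measurable_measure_prodMk_right (measurableSet_lt measurable_const hG.enorm))
      (measurableSet_singleton 0).compl
  · simp only [eLpNorm_eq_lintegral_rpow_enorm_toReal h0 hp]
    exact ((hG.enorm.pow_const _).lintegral_prod_left').pow_const _

theorem mixedNorm_add_le (p q : ℝ≥0∞) [Fact (1 ≤ p)] [Fact (1 ≤ q)]
    {m : RSpace d × RSpace d → ℝ} (hm : Measurable m) {F G : RSpace d × RSpace d → ℂ}
    (hF : Measurable F) (hG : Measurable G) :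
    mixedNorm p q m (F + G) ≤ mixedNorm p q m F + mixedNorm p q m G := by
  have hF' : Measurable (fun z => F z * (m z : ℂ)) := hF.mul (Complex.measurable_ofReal.comp hm)
  have hG' : Measurable (fun z => G z * (m z : ℂ)) := hG.mul (Complex.measurable_ofReal.comp hm)
  refine le_trans ?_ (eLpNorm_add_le
    (measurable_slice_eLpNorm p hF').aestronglyMeasurable
    (measurable_slice_eLpNorm p hG').aestronglyMeasurable Fact.out)
  refine eLpNorm_mono_enorm fun ξ => ?_
  simp only [Pi.add_apply, enorm_eq_self]
  refine le_trans (le_of_eq ?_) (eLpNorm_add_le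
    (hF'.comp measurable_prodMk_right).aestronglyMeasurable
    (hG'.comp measurable_prodMk_right).aestronglyMeasurable Fact.out)
  congr 1
  ext x
  simp [add_mul]

theorem mixedNorm_smul_le (p q : ℝ≥0∞) (m : RSpace d × RSpace d → ℝ) (c : ℂ)
    (F : RSpace d × RSpace d → ℂ) :
    mixedNorm p q m (c • F) ≤ ‖c‖ₑ * mixedNorm p q m F := by
  have h (ξ : RSpace d) : eLpNorm (fun x : RSpace d => (c • F) (x, ξ) * (m (x, ξ) : ℂ)) p volume =
      ‖c‖ₑ * eLpNorm (fun x : RSpace d => F (x, ξ) * (m (x, ξ) : ℂ)) p volume := by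
    rw [← eLpNorm_const_smul]
    congr 1
    ext x
    simp [mul_assoc]
  unfold mixedNorm
  refine eLpNorm_le_nnreal_smul_eLpNorm_of_ae_le_mul' (c := ‖c‖₊)
    (Eventually.of_forall fun ξ => ?_) q
  rw [h, enorm_eq_self, enorm_eq_self, enorm_eq_nnnorm]

/-- The modulation space `M^{p,q}_{m_λ}(ℝᵈ)` with window `φ`, as a subspace of `S'_ω(ℝᵈ)`: the `f`
with `V_φ f ∈ L^{p,q}_{m_λ}`. -/
def modulationSubmodule (φ : SOmega ω d) (p q : ℝ≥0∞) [Fact (1 ≤ p)] [Fact (1 ≤ q)] (lam : ℝ) :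
    Submodule ℂ (OmegaDistribution ω d) where
  carrier := {f | MemMixed p q (expWeight ω lam) (OmegaDistribution.stft φ f)}
  zero_mem' := by
    have h : OmegaDistribution.stft φ (0 : OmegaDistribution ω d) = 0 := rfl
    refine ⟨by rw [h]; exact measurable_zero, ?_⟩
    rw [h]
    simp [mixedNorm]
  add_mem' {f g} hf hg :=
    ⟨hf.1.add hg.1, (mixedNorm_add_le p q (measurable_expWeight ω lam) hf.1 hg.1).trans_lt
      (ENNReal.add_lt_top.2 ⟨hf.2, hg.2⟩)⟩
  smul_mem' c f hf :=
    ⟨hf.1.const_smul c, (mixedNorm_smul_le p q _ c _).trans_lt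
      (ENNReal.mul_lt_top enorm_lt_top hf.2)⟩

/-- The modulation space `M^{p,q}_{m_λ}(ℝᵈ)` with window `φ`; its norm is
`‖f‖ = ‖V_φ f‖_{L^{p,q}_{m_λ}}`. -/
def ModulationSpace (φ : SOmega ω d) (p q : ℝ≥0∞) [Fact (1 ≤ p)] [Fact (1 ≤ q)] (lam : ℝ) : Type :=
  ↥(modulationSubmodule φ p q lam)

namespace ModulationSpace

variable {φ : SOmega ω d} {p q : ℝ≥0∞} [Fact (1 ≤ p)] [Fact (1 ≤ q)] {lam : ℝ}

instance : AddCommGroup (ModulationSpace φ p q lam) :=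
  inferInstanceAs (AddCommGroup ↥(modulationSubmodule φ p q lam))
instance : Module ℂ (ModulationSpace φ p q lam) :=
  inferInstanceAs (Module ℂ ↥(modulationSubmodule φ p q lam))

/-- The inclusion `M^{p,q}_{m_λ} ⊂ S'_ω`. -/
def toDistribution : ModulationSpace φ p q lam →ₗ[ℂ] OmegaDistribution ω d :=
  (modulationSubmodule φ p q lam).subtype

/-- The short-time Fourier transform `V_φ f` of `f ∈ M^{p,q}_{m_λ}`, with respect to the window of
the space. -/
def stft (f : ModulationSpace φ p q lam) : RSpace d × RSpace d → ℂ :=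
  OmegaDistribution.stft φ f.toDistribution

theorem memMixed (f : ModulationSpace φ p q lam) :
    MemMixed p q (expWeight ω lam) f.stft := f.2

/-- `f ↦ ‖V_φ f‖_{L^{p,q}_{m_λ}}`. -/
def normSeminorm : Seminorm ℂ (ModulationSpace φ p q lam) :=
  Seminorm.ofSMulLE (fun f => (mixedNorm p q (expWeight ω lam) f.stft).toReal)
    (by
      have h : (0 : ModulationSpace φ p q lam).stft = 0 := rfl
      rw [h]
      simp [mixedNorm])
    (fun f g => by
      rw [← ENNReal.toReal_add f.memMixed.2.ne g.memMixed.2.ne]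
      exact ENNReal.toReal_mono (ENNReal.add_ne_top.2 ⟨f.memMixed.2.ne, g.memMixed.2.ne⟩)
        (mixedNorm_add_le p q (measurable_expWeight ω lam) f.memMixed.1 g.memMixed.1))
    (fun c f => by
      rw [← toReal_enorm, ← ENNReal.toReal_mul]
      exact ENNReal.toReal_mono (ENNReal.mul_ne_top enorm_ne_top f.memMixed.2.ne)
        (mixedNorm_smul_le p q _ c _))

/-- The norm `‖f‖ = ‖V_φ f‖_{L^{p,q}_{m_λ}}` and its topology.  (That `‖f‖ = 0` forces `f = 0` when
`φ ≠ 0` is a theorem and is not needed to set up the topology and the dual space.) -/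
instance : SeminormedAddCommGroup (ModulationSpace φ p q lam) :=
  (normSeminorm (φ := φ) (p := p) (q := q) (lam := lam)).toAddGroupSeminorm.toSeminormedAddCommGroup

theorem norm_def (f : ModulationSpace φ p q lam) :
    ‖f‖ = (mixedNorm p q (expWeight ω lam) f.stft).toReal := rfl

instance : NormedSpace ℂ (ModulationSpace φ p q lam) where
  norm_smul_le c f := (map_smul_eq_mul (normSeminorm (φ := φ) (p := p) (q := q) (lam := lam)) c f).le

end ModulationSpace

end

/-! Write c = (2π)^d ‖φ‖² and m = m_λ. By definition V_φ carries the norm of M^{p,q}_m to that of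
L^{p,q}_m, and it is inverted by synthesis along the orbit of the window: c f = ∫ V_φ f(z) Π(z)φ dz.
Both claims are read off from this formula and the boundedness of the synthesis operator F ↦ ∫ F(z)
Π(z)φ dz.

Boundedness: by covariance, the transform of a synthesised element is dominated by the convolution
|F| * |V_φ φ|. Since V_φ φ decays faster than every e^{-μω} and subadditivity of ω makes m moderate,
Young's inequality applies (`exists_mixedENorm_convolution_le`, `exists_synthesis`).

For finite p and q the truncations of V_φ f to balls converge in L^{p,q}_m, so every continuous
functional l satisfies c l(f) = lim ∫_{|z| ≤ n} V_φ f(z) l(Π(z)φ) dz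
(`tendsto_setIntegral_stft_mul`). Hence l is determined by its values on the orbit. Density of S_ω
follows by Hahn–Banach. For duality, testing l on synthesised elements and using the converse of
Hölder's inequality shows that z ↦ l(Π(z)φ) lies in L^{p',q'}_{1/m} with norm at most C‖l‖
(`exists_mixedNorm_orbit_le`). The distribution T(u) = c⁻¹ conj(l(ū)) therefore belongs to
M^{p',q'}_{1/m}, and the functional that it induces agrees with l on the orbit. This gives
surjectivity; the same estimate gives the lower norm bound, and Hölder gives the upper one.

Underneath lies Moyal's identity ∫ V_φ f conj(V_φ u) = c f(ū) for f in S'_ω and u in S_ω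
(`OmegaDistribution.integrable_and_integral_stft_mul_conj`). On S_ω it is Fourier inversion. To pass
to distributions, the seminorms of S_ω are bounded by weighted L¹, hence weighted L², norms of V_φ
u. Hahn–Banach and Riesz then give f(u) = ∫ K V_φ u with controlled growth of K, and Fubini reduces
the identity to S_ω. Combined with Hölder it embeds M^{p,q}_m continuously in S'_ω, whence
completeness, which the vector-valued synthesis integral needs. -/

noncomputable section

/-! ### L^p norms of [0,∞]-valued functions: Hölder, Fatou, Minkowski, near-extremals. -/

section MixedNormTheory

variable {α β Ξ : Type*} [MeasurableSpace α] [MeasurableSpace β] [MeasurableSpace Ξ]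

theorem eLpNorm_ennreal_eq {μ : Measure α} {p : ℝ≥0∞} (h0 : p ≠ 0) (hp : p ≠ ∞) (f : α → ℝ≥0∞) :
    eLpNorm f p μ = (∫⁻ x, f x ^ p.toReal ∂μ) ^ (1 / p.toReal) := by
  rw [eLpNorm_eq_lintegral_rpow_enorm_toReal h0 hp]
  simp only [enorm_eq_self]

theorem eLpNorm_ennreal_top {μ : Measure α} (f : α → ℝ≥0∞) :
    eLpNorm f ∞ μ = essSup f μ := by
  rw [eLpNorm_exponent_top, eLpNormEssSup]
  simp only [enorm_eq_self]

theorem eLpNorm_ennreal_mono {μ : Measure α} {p : ℝ≥0∞} {f g : α → ℝ≥0∞} (h : ∀ x, f x ≤ g x) :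
    eLpNorm f p μ ≤ eLpNorm g p μ :=
  eLpNorm_mono_enorm fun x => by simpa using h x

theorem eLpNorm_ennreal_const_mul {μ : Measure α} {p : ℝ≥0∞} {f : α → ℝ≥0∞}
    (hf : Measurable f) (c : ℝ≥0∞) (hp1 : 1 ≤ p) :
    eLpNorm (fun x => c * f x) p μ = c * eLpNorm f p μ := by
  have h0 : p ≠ 0 := (zero_lt_one.trans_le hp1).ne'
  rcases eq_or_ne p ∞ with rfl | hp
  · rw [eLpNorm_ennreal_top, eLpNorm_ennreal_top, ENNReal.essSup_const_mul]
  · have hpos : 0 < p.toReal := ENNReal.toReal_pos h0 hp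
    rw [eLpNorm_ennreal_eq h0 hp, eLpNorm_ennreal_eq h0 hp]
    simp_rw [ENNReal.mul_rpow_of_nonneg _ _ hpos.le]
    rw [lintegral_const_mul _ (hf.pow_const _), ENNReal.mul_rpow_of_nonneg _ _ (by positivity),
      ← ENNReal.rpow_mul, mul_one_div_cancel hpos.ne', ENNReal.rpow_one]

/-- Hölder's inequality for functions with values in `[0,∞]` and all conjugate exponents. -/
theorem lintegral_mul_le_eLpNorm_mul_eLpNorm {μ : Measure α} {p q : ℝ≥0∞}
    (hpq : p.HolderConjugate q) {f g : α → ℝ≥0∞} (hf : Measurable f) (hg : Measurable g) :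
    ∫⁻ x, f x * g x ∂μ ≤ eLpNorm f p μ * eLpNorm g q μ := by
  rcases eq_or_ne p ∞ with rfl | hp
  · have := hpq
    obtain rfl : q = 1 := ENNReal.HolderConjugate.unique ∞ q 1
    rw [eLpNorm_ennreal_top, eLpNorm_ennreal_eq one_ne_zero ENNReal.one_ne_top]
    simp only [ENNReal.toReal_one, ENNReal.rpow_one, ne_eq, one_ne_zero, not_false_eq_true,
      div_self]
    rw [← lintegral_const_mul _ hg]
    refine lintegral_mono_ae ?_
    filter_upwards [ENNReal.ae_le_essSup (μ := μ) f] with x hx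
    gcongr
  rcases eq_or_ne q ∞ with rfl | hq
  · obtain rfl : p = 1 := by
      have := hpq.symm
      exact ENNReal.HolderConjugate.unique ∞ p 1
    rw [eLpNorm_ennreal_top, eLpNorm_ennreal_eq one_ne_zero ENNReal.one_ne_top]
    simp only [ENNReal.toReal_one, ENNReal.rpow_one, ne_eq, one_ne_zero, not_false_eq_true,
      div_self]
    rw [← lintegral_mul_const _ hf]
    refine lintegral_mono_ae ?_
    filter_upwards [ENNReal.ae_le_essSup (μ := μ) g] with x hx
    gcongr
  have hr := ENNReal.HolderConjugate.toReal_of_ne_top hp hq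
  rw [eLpNorm_ennreal_eq (ENNReal.HolderConjugate.ne_zero p q) hp,
    eLpNorm_ennreal_eq (ENNReal.HolderConjugate.ne_zero q p) hq]
  exact ENNReal.lintegral_mul_le_Lp_mul_Lq μ hr hf.aemeasurable hg.aemeasurable

/-- Fatou's lemma for `L^p` norms, `p ∈ [1,∞]`. -/
theorem eLpNorm_le_of_le_liminf {μ : Measure α} {p : ℝ≥0∞} (h0 : p ≠ 0) {f : α → ℝ≥0∞}
    {g : ℕ → α → ℝ≥0∞} (hg : ∀ n, Measurable (g n))
    (hfg : ∀ᵐ x ∂μ, f x ≤ liminf (fun n => g n x) atTop) :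
    eLpNorm f p μ ≤ liminf (fun n => eLpNorm (g n) p μ) atTop := by
  rcases eq_or_ne p ∞ with rfl | hp
  · simp only [eLpNorm_ennreal_top]
    refine essSup_le_of_ae_le _ ?_
    filter_upwards [hfg, ae_all_iff.2 fun n => ENNReal.ae_le_essSup (μ := μ) (g n)] with x hx hx'
    exact hx.trans (liminf_le_liminf (Eventually.of_forall hx'))
  · have hpos : 0 < p.toReal := ENNReal.toReal_pos h0 hp
    simp only [eLpNorm_ennreal_eq h0 hp]
    have hmono (y : ℝ) (hy : 0 < y) (u : ℕ → ℝ≥0∞) :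
        (liminf u atTop) ^ y = liminf (fun n => u n ^ y) atTop :=
      (ENNReal.orderIsoRpow y hy).liminf_apply
    rw [← hmono _ (by positivity)]
    refine ENNReal.rpow_le_rpow ?_ (by positivity)
    calc ∫⁻ x, f x ^ p.toReal ∂μ
        ≤ ∫⁻ x, liminf (fun n => g n x ^ p.toReal) atTop ∂μ := by
          refine lintegral_mono_ae ?_
          filter_upwards [hfg] with x hx
          rw [← hmono _ hpos]
          exact ENNReal.rpow_le_rpow hx hpos.le
      _ ≤ _ := lintegral_liminf_le fun n => (hg n).pow_const _

/-- For p = ∞ the superlevel set {ess sup > a} consists of the ξ for which the section of {f > a}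
has nonzero measure, and section measures depend measurably on ξ. For finite p this is Tonelli. -/
theorem measurable_eLpNorm_slice {μ : Measure α} [SFinite μ] (p : ℝ≥0∞) {f : Ξ → α → ℝ≥0∞}
    (hf : Measurable (Function.uncurry f)) :
    Measurable (fun ξ => eLpNorm (f ξ) p μ) := by
  rcases eq_or_ne p 0 with rfl | h0
  · simp
  rcases eq_or_ne p ∞ with rfl | hp
  · simp only [eLpNorm_ennreal_top]
    refine measurable_of_Ioi fun a => ?_
    have h : (fun ξ => essSup (f ξ) μ) ⁻¹' Ioi a =
        {ξ | μ (Prod.mk ξ ⁻¹' {z | a < Function.uncurry f z}) ≠ 0} := by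
      ext ξ
      rw [mem_preimage, mem_Ioi, mem_ofPred_eq, ← not_le, not_iff_not]
      constructor
      · intro h
        have := (ENNReal.ae_le_essSup (f ξ) (μ := μ)).mono fun x hx => hx.trans h
        rw [ae_iff] at this
        simpa using this
      · intro h
        refine essSup_le_of_ae_le a ?_
        rw [EventuallyLE, ae_iff]
        simpa using h
    rw [h]
    exact (measurable_measure_prodMk_left (measurableSet_lt measurable_const hf))
      (measurableSet_singleton 0).compl
  · simp only [eLpNorm_ennreal_eq h0 hp]
    exact ((hf.pow_const _).lintegral_prod_right').pow_const _

/-- Minkowski's integral inequality. -/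
theorem eLpNorm_lintegral_le {μ : Measure α} [SigmaFinite μ] {ν : Measure β} [SFinite ν]
    {p : ℝ≥0∞} (hp1 : 1 ≤ p) (hp : p ≠ ∞) {f : α → β → ℝ≥0∞}
    (hf : Measurable (Function.uncurry f)) :
    eLpNorm (fun x => ∫⁻ z, f x z ∂ν) p μ ≤ ∫⁻ z, eLpNorm (fun x => f x z) p μ ∂ν := by
  have h0 : p ≠ 0 := (zero_lt_one.trans_le hp1).ne'
  have hswap : Measurable (Function.uncurry fun z x => f x z) := hf.comp measurable_swap
  rcases eq_or_ne p 1 with rfl | hp1'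
  · simp only [eLpNorm_ennreal_eq one_ne_zero ENNReal.one_ne_top, ENNReal.toReal_one,
      ENNReal.rpow_one, ne_eq, one_ne_zero, not_false_eq_true, div_self]
    exact (lintegral_lintegral_swap hf.aemeasurable).le
  set r := p.toReal with hr
  have hr1 : 1 < r := by
    rw [hr, ← ENNReal.toReal_one]
    exact (ENNReal.toReal_lt_toReal ENNReal.one_ne_top hp).2 (lt_of_le_of_ne hp1 hp1'.symm)
  have hr0 : 0 < r := zero_lt_one.trans hr1
  have hconj := Real.HolderConjugate.conjExponent hr1
  set s := r.conjExponent
  have hs0 : 0 < s := hconj.symm.pos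
  set I : α → ℝ≥0∞ := fun x => ∫⁻ z, f x z ∂ν with hI
  have hIm : Measurable I := hf.lintegral_prod_right'
  -- Capping I at n and restricting to a set of finite measure makes A = ∫ J^r finite, so that a
  -- power of A can be cancelled; Fatou removes the truncation at the end.
  set J : ℕ → α → ℝ≥0∞ := fun n => (spanningSets μ n).indicator fun x => min (I x) n with hJ
  have hJm n : Measurable (J n) :=
    (hIm.min measurable_const).indicator (measurableSet_spanningSets μ n)
  have hJI n x : J n x ≤ I x := by
    rw [hJ]; exact (indicator_le_self _ _ x).trans (min_le_left _ _)
  set R := ∫⁻ z, eLpNorm (fun x => f x z) p μ ∂ν with hR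
  have key n : eLpNorm (J n) p μ ≤ R := by
    rw [eLpNorm_ennreal_eq h0 hp]
    set A := ∫⁻ x, J n x ^ r ∂μ with hA
    have hAtop : A ≠ ∞ := by
      refine ne_top_of_le_ne_top (b := (n : ℝ≥0∞) ^ r * μ (spanningSets μ n)) ?_ ?_
      · exact ENNReal.mul_ne_top (ENNReal.rpow_ne_top_of_nonneg hr0.le (ENNReal.natCast_ne_top n))
          (measure_spanningSets_lt_top μ n).ne
      · rw [hA, ← setLIntegral_const, ← lintegral_indicator (measurableSet_spanningSets μ n)]
        refine lintegral_mono fun x => ?_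
        by_cases hx : x ∈ spanningSets μ n
        · simp only [hJ, indicator_of_mem hx]
          exact ENNReal.rpow_le_rpow (min_le_right _ _) hr0.le
        · simp [hJ, indicator_of_notMem hx, hr0]
    -- Write J^r ≤ I · J^(r-1), exchange the integrals and apply Hölder in x for fixed z; the second
    -- factor is A^(1/s) because (r-1)s = r.
    have h1 : A ≤ R * A ^ (1 / s) := by
      calc A ≤ ∫⁻ x, I x * J n x ^ (r - 1) ∂μ := by
            refine lintegral_mono fun x => ?_
            have : J n x ^ r = J n x * J n x ^ (r - 1) := by
              conv_rhs => rw [← ENNReal.rpow_one (J n x), ENNReal.rpow_one (J n x)]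
              nth_rw 2 [← ENNReal.rpow_one (J n x)]
              rw [← ENNReal.rpow_add_of_nonneg _ _ zero_le_one (by linarith)]
              ring_nf
            rw [this]
            gcongr
            exact hJI n x
        _ = ∫⁻ x, ∫⁻ z, f x z * J n x ^ (r - 1) ∂ν ∂μ := by
            refine lintegral_congr fun x => ?_
            rw [lintegral_mul_const _ (hf.of_uncurry_left)]
        _ = ∫⁻ z, ∫⁻ x, f x z * J n x ^ (r - 1) ∂μ ∂ν := by
            refine lintegral_lintegral_swap ?_
            exact (hf.mul (((hJm n).comp measurable_fst).pow_const _)).aemeasurable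
        _ ≤ ∫⁻ z, eLpNorm (fun x => f x z) p μ * A ^ (1 / s) ∂ν := by
            refine lintegral_mono fun z => ?_
            refine (ENNReal.lintegral_mul_le_Lp_mul_Lq μ hconj
              (hf.comp (measurable_id.prodMk measurable_const)).aemeasurable
              ((hJm n).pow_const _).aemeasurable).trans (le_of_eq ?_)
            rw [eLpNorm_ennreal_eq h0 hp]
            congr 2
            refine lintegral_congr fun x => ?_
            rw [← ENNReal.rpow_mul, hconj.sub_one_mul_conj]
        _ = R * A ^ (1 / s) :=
            lintegral_mul_const _ (measurable_eLpNorm_slice p hswap)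
    by_cases hA0 : A = 0
    · rw [hA0, ENNReal.zero_rpow_of_pos (by positivity)]; exact zero_le
    have h2 : A = A ^ (1 / r) * A ^ (1 / s) := by
      rw [← ENNReal.rpow_add _ _ hA0 hAtop, one_div, one_div, hconj.inv_add_inv_eq_one,
        ENNReal.rpow_one]
    have h3 : A ^ (1 / s) ≠ 0 := by simp [ENNReal.rpow_eq_zero_iff, hA0, hAtop]
    have h4 : A ^ (1 / s) ≠ ∞ := ENNReal.rpow_ne_top_of_nonneg (by positivity) hAtop
    have h1 : A ^ (1 / r) * A ^ (1 / s) ≤ R * A ^ (1 / s) := h2.symm.le.trans h1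
    exact (ENNReal.mul_le_mul_iff_left h3 h4).1 h1
  refine (eLpNorm_le_of_le_liminf h0 hJm (Eventually.of_forall fun x => ?_)).trans
    (liminf_le_of_le (by isBoundedDefault) fun b hb => ?_)
  · refine le_of_eq (Tendsto.liminf_eq ?_).symm
    have h1 : Tendsto (fun n : ℕ => min (I x) (n : ℝ≥0∞)) atTop (𝓝 (min (I x) ∞)) :=
      tendsto_const_nhds.min ENNReal.tendsto_nat_nhds_top
    rw [min_eq_left le_top] at h1
    refine h1.congr' ?_
    filter_upwards [eventually_ge_atTop (spanningSetsIndex μ x)] with n hn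
    have : x ∈ spanningSets μ n :=
      monotone_spanningSets μ hn (mem_spanningSetsIndex μ x)
    simp [hJ, indicator_of_mem this]
  · obtain ⟨n, hn⟩ := hb.exists
    exact hn.trans (key n)

/-- Near-extremal functions for Hölder's inequality, depending measurably on a parameter. -/
theorem exists_measurable_near_extremal {μ : Measure α} [SFinite μ] {p p' : ℝ≥0∞}
    (hpp' : p.HolderConjugate p') (hp : p ≠ ∞) {g : Ξ → α → ℝ≥0∞}
    (hg : Measurable (Function.uncurry g)) (hgfin : ∀ ξ x, g ξ x ≠ ∞)
    (hN : ∀ ξ, eLpNorm (g ξ) p' μ ≠ ∞) {S : Set α} (hS : μ S ≠ ∞)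
    (hgS : ∀ ξ x, x ∉ S → g ξ x = 0) {r : ℝ≥0∞} (hr : r < 1) :
    ∃ k : Ξ → α → ℝ≥0∞, Measurable (Function.uncurry k) ∧ (∀ ξ x, k ξ x ≠ ∞) ∧
      (∀ ξ x, g ξ x = 0 → k ξ x = 0) ∧ (∀ ξ, eLpNorm (k ξ) p μ ≤ 1) ∧
      ∀ ξ, r * eLpNorm (g ξ) p' μ ≤ ∫⁻ x, k ξ x * g ξ x ∂μ := by
  have hNm : Measurable fun ξ => eLpNorm (g ξ) p' μ := measurable_eLpNorm_slice p' hg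
  have hgξ ξ : Measurable (g ξ) := hg.of_uncurry_left
  set N : Ξ → ℝ≥0∞ := fun ξ => eLpNorm (g ξ) p' μ with hNdef
  have hN0set : MeasurableSet {z : Ξ × α | N z.1 ≠ 0} :=
    (hNm.comp measurable_fst) (measurableSet_singleton 0).compl
  rcases eq_or_ne p' ∞ with rfl | hp'
  · obtain rfl : p = 1 := by
      have := hpp'.symm
      exact ENNReal.HolderConjugate.unique ∞ p 1
    -- Here p = 1 and N is an essential supremum. The section of A has positive measure because r <
    -- 1, and finite measure because it lies in S, so its normalised indicator is the desired test
    -- function.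
    set A : Set (Ξ × α) := {z | r * N z.1 < Function.uncurry g z} with hA
    have hAm : MeasurableSet A :=
      measurableSet_lt ((hNm.comp measurable_fst).const_mul r) hg
    have hAξ ξ : MeasurableSet (Prod.mk ξ ⁻¹' A) := measurable_prodMk_left hAm
    have hAS ξ : Prod.mk ξ ⁻¹' A ⊆ S := fun x hx => by
      by_contra hxS
      have : r * N ξ < g ξ x := hx
      rw [hgS ξ x hxS] at this
      exact not_lt_zero this
    have hAtop ξ : μ (Prod.mk ξ ⁻¹' A) ≠ ∞ := ne_top_of_le_ne_top hS (measure_mono (hAS ξ))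
    have hA0 ξ (h : N ξ ≠ 0) : μ (Prod.mk ξ ⁻¹' A) ≠ 0 := by
      intro h0
      have h1 : N ξ ≤ r * N ξ := by
        rw [hNdef]
        simp only [eLpNorm_ennreal_top]
        rw [← eLpNorm_ennreal_top]
        refine essSup_le_of_ae_le _ ?_
        rw [EventuallyLE, ae_iff]
        refine Eq.trans ?_ h0
        congr 1
        ext x
        simp [hA, hNdef]
      have h2 : r * N ξ < 1 * N ξ := (ENNReal.mul_lt_mul_iff_left h (hN ξ)).2 hr
      rw [one_mul] at h2
      exact absurd h1 (not_le.2 h2)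
    classical
    refine ⟨fun ξ x => if N ξ ≠ 0 ∧ (ξ, x) ∈ A then (μ (Prod.mk ξ ⁻¹' A))⁻¹ else 0, ?_, ?_, ?_, ?_,
      ?_⟩
    · exact Measurable.ite (hN0set.inter hAm)
        (((measurable_measure_prodMk_left hAm).comp measurable_fst).inv) measurable_const
    · intro ξ x
      beta_reduce
      split_ifs with h
      · exact ENNReal.inv_ne_top.2 (hA0 ξ h.1)
      · exact ENNReal.zero_ne_top
    · intro ξ x h
      refine if_neg fun h' => ?_
      have : r * N ξ < g ξ x := h'.2
      rw [h] at this
      exact not_lt_zero this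
    · intro ξ
      rw [eLpNorm_ennreal_eq one_ne_zero ENNReal.one_ne_top]
      simp only [ENNReal.toReal_one, ENNReal.rpow_one, ne_eq, one_ne_zero, not_false_eq_true,
        div_self]
      by_cases h : N ξ = 0
      · simp [h]
      · simp only [h, not_false_eq_true, true_and]
        calc _ = ∫⁻ x, (Prod.mk ξ ⁻¹' A).indicator (fun _ => (μ (Prod.mk ξ ⁻¹' A))⁻¹) x ∂μ := by
              refine lintegral_congr fun x => ?_
              simp [indicator]
          _ ≤ 1 := by
              rw [lintegral_indicator_const (hAξ ξ)]
              exact ENNReal.inv_mul_le_one _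
    · intro ξ
      by_cases h : N ξ = 0
      · change r * N ξ ≤ _
        simp [h]
      · simp only [ne_eq, h, not_false_eq_true, true_and]
        calc r * N ξ = ∫⁻ x, (Prod.mk ξ ⁻¹' A).indicator
              (fun _ => (μ (Prod.mk ξ ⁻¹' A))⁻¹ * (r * N ξ)) x ∂μ := by
              rw [lintegral_indicator_const (hAξ ξ), mul_right_comm,
                ENNReal.inv_mul_cancel (hA0 ξ h) (hAtop ξ), one_mul]
          _ ≤ _ := by
              refine lintegral_mono fun x => ?_
              by_cases hx : (ξ, x) ∈ A
              · have : x ∈ Prod.mk ξ ⁻¹' A := hx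
                rw [indicator_of_mem this, if_pos hx]
                gcongr
                exact le_of_lt hx
              · have : x ∉ Prod.mk ξ ⁻¹' A := hx
                rw [indicator_of_notMem this]
                exact zero_le
  · have hconj := (ENNReal.HolderConjugate.toReal_of_ne_top hp hp' : _)
    have h0 : p ≠ 0 := ENNReal.HolderConjugate.ne_zero p p'
    have h0' : p' ≠ 0 := ENNReal.HolderConjugate.ne_zero p' p
    set s := p'.toReal with hs
    have hs1 : 1 < s := hconj.symm.lt
    have hs0 : 0 < s := zero_lt_one.trans hs1
    have hNs ξ : N ξ ^ s = ∫⁻ x, g ξ x ^ s ∂μ := by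
      simp only [hNdef, eLpNorm_ennreal_eq h0' hp']
      rw [← ENNReal.rpow_mul, one_div_mul_cancel hs0.ne', ENNReal.rpow_one]
    classical
    -- For finite p' the classical extremal (g/N)^(s-1) works without loss: since (s-1)p = s it has
    -- norm 1, and it pairs with g to N. Slices with N = 0 get k = 0.
    refine ⟨fun ξ x => if N ξ ≠ 0 then (g ξ x / N ξ) ^ (s - 1) else 0, ?_, ?_, ?_, ?_, ?_⟩
    · exact Measurable.ite hN0set ((hg.div (hNm.comp measurable_fst)).pow_const _) measurable_const
    · intro ξ x
      beta_reduce
      split_ifs with h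
      · exact ENNReal.rpow_ne_top_of_nonneg (by linarith) (ENNReal.div_ne_top (hgfin ξ x) h)
      · exact ENNReal.zero_ne_top
    · intro ξ x h
      simp [h, hs1]
    · intro ξ
      by_cases h : N ξ = 0
      · simp [h]
      · simp only [ne_eq, h, not_false_eq_true, if_true]
        rw [eLpNorm_ennreal_eq h0 hp]
        have : ∀ x, ((g ξ x / N ξ) ^ (s - 1)) ^ p.toReal = g ξ x ^ s * (N ξ ^ s)⁻¹ := fun x => by
          rw [← ENNReal.rpow_mul, hconj.symm.sub_one_mul_conj, ENNReal.div_rpow_of_nonneg _ _ hs0.le,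
            div_eq_mul_inv]
        simp_rw [this]
        rw [lintegral_mul_const _ ((hgξ ξ).pow_const _), ← hNs]
        exact ENNReal.rpow_le_one (ENNReal.mul_inv_le_one _) (by positivity)
    · intro ξ
      by_cases h : N ξ = 0
      · change r * N ξ ≤ _
        simp [h]
      · simp only [ne_eq, h, not_false_eq_true, if_true]
        have : ∀ x, (g ξ x / N ξ) ^ (s - 1) * g ξ x = g ξ x ^ s * (N ξ ^ (s - 1))⁻¹ := fun x => by
          rw [ENNReal.div_rpow_of_nonneg _ _ (by linarith), div_eq_mul_inv, mul_right_comm]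
          congr 1
          nth_rw 2 [← ENNReal.rpow_one (g ξ x)]
          rw [← ENNReal.rpow_add_of_nonneg _ _ (by linarith) zero_le_one]
          ring_nf
        simp_rw [this]
        rw [lintegral_mul_const _ ((hgξ ξ).pow_const _), ← hNs, ← ENNReal.rpow_neg,
          ← ENNReal.rpow_add _ _ h (hN ξ)]
        have : s + -(s - 1) = 1 := by ring
        rw [this, ENNReal.rpow_one]
        exact mul_le_of_le_one_left' hr.le

end MixedNormTheory

/-! ### Mixed norms: Hölder and its converse, Minkowski, dominated convergence. -/

section MixedENorm

variable {α β : Type*} [MeasurableSpace α] [MeasurableSpace β]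

/-- The mixed norm of a function with values in `[0,∞]`: the `L^p` norm in the first variable,
followed by the `L^q` norm in the second one. -/
def mixedENorm (p q : ℝ≥0∞) (μ : Measure α) (ν : Measure β) (f : α × β → ℝ≥0∞) : ℝ≥0∞ :=
  eLpNorm (fun ξ => eLpNorm (fun x => f (x, ξ)) p μ) q ν

variable {μ : Measure α} {ν : Measure β} {p q p' q' : ℝ≥0∞}

theorem mixedENorm_mono {f g : α × β → ℝ≥0∞} (h : ∀ z, f z ≤ g z) :
    mixedENorm p q μ ν f ≤ mixedENorm p q μ ν g :=
  eLpNorm_ennreal_mono fun _ => eLpNorm_ennreal_mono fun _ => h _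

theorem measurable_slice [SFinite μ] {f : α × β → ℝ≥0∞} (hf : Measurable f) :
    Measurable fun ξ => eLpNorm (fun x => f (x, ξ)) p μ :=
  measurable_eLpNorm_slice (f := fun ξ x => f (x, ξ)) p (hf.comp measurable_swap)

theorem mixedENorm_const_mul [SFinite μ] (hp : 1 ≤ p) (hq : 1 ≤ q) {f : α × β → ℝ≥0∞}
    (hf : Measurable f) (c : ℝ≥0∞) :
    mixedENorm p q μ ν (fun z => c * f z) = c * mixedENorm p q μ ν f := by
  unfold mixedENorm
  rw [← eLpNorm_ennreal_const_mul (measurable_slice hf) c hq]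
  congr 1
  ext ξ
  exact eLpNorm_ennreal_const_mul (hf.comp measurable_prodMk_right) c hp

/-- Hölder's inequality for mixed norms. -/
theorem lintegral_mul_le_mixedENorm_mul [SFinite μ] [SFinite ν] (hp : p.HolderConjugate p')
    (hq : q.HolderConjugate q') {f g : α × β → ℝ≥0∞} (hf : Measurable f) (hg : Measurable g) :
    ∫⁻ z, f z * g z ∂(μ.prod ν) ≤ mixedENorm p q μ ν f * mixedENorm p' q' μ ν g := by
  rw [lintegral_prod_symm' (fun z => f z * g z) (hf.mul hg)]
  refine (lintegral_mono fun ξ => lintegral_mul_le_eLpNorm_mul_eLpNorm hp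
    (hf.comp measurable_prodMk_right) (hg.comp measurable_prodMk_right)).trans ?_
  exact lintegral_mul_le_eLpNorm_mul_eLpNorm hq (measurable_slice hf) (measurable_slice hg)

/-- Minkowski's integral inequality for mixed norms. -/
theorem mixedENorm_lintegral_le [SigmaFinite μ] [SigmaFinite ν] {γ : Type*} [MeasurableSpace γ]
    {τ : Measure γ} [SFinite τ] (hp1 : 1 ≤ p) (hp : p ≠ ∞) (hq1 : 1 ≤ q) (hq : q ≠ ∞)
    {f : α × β → γ → ℝ≥0∞} (hf : Measurable (Function.uncurry f)) :
    mixedENorm p q μ ν (fun z => ∫⁻ t, f z t ∂τ) ≤ ∫⁻ t, mixedENorm p q μ ν (fun z => f z t) ∂τ := by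
  refine (eLpNorm_ennreal_mono fun ξ => ?_).trans
    (eLpNorm_lintegral_le (f := fun ξ t => eLpNorm (fun x => f (x, ξ) t) p μ) hq1 hq ?_)
  · exact eLpNorm_lintegral_le (f := fun x t => f (x, ξ) t) hp1 hp
      (hf.comp (measurable_prodMk_right.prodMap measurable_id))
  · refine measurable_eLpNorm_slice (Ξ := β × γ) (f := fun w x => f (x, w.1) w.2) p ?_
    exact hf.comp (by fun_prop : Measurable fun w : (β × γ) × α => ((w.2, w.1.1), w.1.2))

/-- Fatou's lemma for mixed norms. -/
theorem mixedENorm_le_of_le_liminf [SFinite μ] (hp : p ≠ 0) (hq : q ≠ 0) {f : α × β → ℝ≥0∞}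
    {g : ℕ → α × β → ℝ≥0∞} (hg : ∀ n, Measurable (g n))
    (hfg : ∀ z, f z ≤ liminf (fun n => g n z) atTop) {C : ℝ≥0∞}
    (hC : ∀ᶠ n in atTop, mixedENorm p q μ ν (g n) ≤ C) : mixedENorm p q μ ν f ≤ C := by
  refine (eLpNorm_le_of_le_liminf (g := fun n ξ => eLpNorm (fun x => g n (x, ξ)) p μ) hq
    (fun n => measurable_slice (hg n)) (Eventually.of_forall fun ξ => ?_)).trans
    (liminf_le_of_le (by isBoundedDefault) fun b hb => ?_)
  · exact eLpNorm_le_of_le_liminf hp (fun n => (hg n).comp measurable_prodMk_right)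
      (Eventually.of_forall fun x => hfg _)
  · obtain ⟨n, hn, hn'⟩ := (hb.and hC).exists
    exact hn.trans hn'

theorem tendsto_eLpNorm_zero_of_dominated {ι : Type*} {l : Filter ι} [l.IsCountablyGenerated]
    (hp0 : p ≠ 0) (hp : p ≠ ∞) {f : ι → α → ℝ≥0∞} {G : α → ℝ≥0∞} (hf : ∀ i, Measurable (f i))
    (hfG : ∀ᶠ i in l, ∀ x, f i x ≤ G x) (hG : eLpNorm G p μ ≠ ∞)
    (hlim : ∀ᵐ x ∂μ, Tendsto (fun i => f i x) l (𝓝 0)) :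
    Tendsto (fun i => eLpNorm (f i) p μ) l (𝓝 0) := by
  have hpos : 0 < p.toReal := ENNReal.toReal_pos hp0 hp
  simp only [eLpNorm_ennreal_eq hp0 hp] at hG ⊢
  have h : Tendsto (fun i => ∫⁻ x, f i x ^ p.toReal ∂μ) l (𝓝 (∫⁻ _, 0 ∂μ)) := by
    refine tendsto_lintegral_filter_of_dominated_convergence (fun x => G x ^ p.toReal)
      (Eventually.of_forall fun i => (hf i).pow_const _) ?_ ?_ ?_
    · filter_upwards [hfG] with i hi
      exact Eventually.of_forall fun x => ENNReal.rpow_le_rpow (hi x) hpos.le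
    · intro h
      rw [h, ENNReal.top_rpow_of_pos (by positivity)] at hG
      exact hG rfl
    · filter_upwards [hlim] with x hx
      have := (ENNReal.continuous_rpow_const (y := p.toReal)).continuousAt.tendsto.comp hx
      simpa [hpos, Function.comp_def] using this
  rw [lintegral_zero] at h
  have h2 := (ENNReal.continuous_rpow_const (y := 1 / p.toReal)).continuousAt.tendsto.comp h
  simpa [hpos, Function.comp_def] using h2

/-- Dominated convergence for mixed norms with finite exponents. -/
theorem tendsto_mixedENorm_zero_of_dominated [SFinite μ] {ι : Type*} {l : Filter ι}
    [l.IsCountablyGenerated] (hp0 : p ≠ 0) (hp : p ≠ ∞) (hq0 : q ≠ 0) (hq : q ≠ ∞)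
    {f : ι → α × β → ℝ≥0∞} {G : α × β → ℝ≥0∞} (hf : ∀ i, Measurable (f i)) (hGm : Measurable G)
    (hfG : ∀ᶠ i in l, ∀ z, f i z ≤ G z) (hG : mixedENorm p q μ ν G ≠ ∞)
    (hlim : ∀ z, Tendsto (fun i => f i z) l (𝓝 0)) :
    Tendsto (fun i => mixedENorm p q μ ν (f i)) l (𝓝 0) := by
  refine tendsto_eLpNorm_zero_of_dominated (G := fun ξ => eLpNorm (fun x => G (x, ξ)) p μ) hq0 hq
    (fun i => measurable_slice (hf i)) ?_ hG ?_
  · filter_upwards [hfG] with i hi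
    exact fun ξ => eLpNorm_ennreal_mono fun x => hi _
  · have hqpos : 0 < q.toReal := ENNReal.toReal_pos hq0 hq
    -- The inner dominated convergence needs a finite dominating slice norm. Finiteness of the mixed
    -- norm of G with q < ∞ provides it for almost every ξ.
    have h1 : ∀ᵐ ξ ∂ν, eLpNorm (fun x => G (x, ξ)) p μ ≠ ∞ := by
      rw [mixedENorm, eLpNorm_ennreal_eq hq0 hq] at hG
      have h2 : ∫⁻ ξ, eLpNorm (fun x => G (x, ξ)) p μ ^ q.toReal ∂ν ≠ ∞ := by
        intro h
        rw [h, ENNReal.top_rpow_of_pos (by positivity)] at hG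
        exact hG rfl
      filter_upwards [ae_lt_top ((measurable_slice hGm).pow_const _) h2] with ξ hξ h
      rw [h, ENNReal.top_rpow_of_pos hqpos] at hξ
      exact lt_irrefl _ hξ
    filter_upwards [h1] with ξ hξ
    refine tendsto_eLpNorm_zero_of_dominated (G := fun x => G (x, ξ)) hp0 hp
      (fun i => (hf i).comp measurable_prodMk_right) ?_ hξ (Eventually.of_forall fun x => hlim _)
    filter_upwards [hfG] with i hi
    exact fun x => hi _

theorem eLpNorm_ne_top_of_bounded_of_support (hp1 : 1 ≤ p) {f : α → ℝ≥0∞} {S : Set α}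
    (hSm : MeasurableSet S) (hS : μ S ≠ ∞) {b : ℝ≥0∞} (hb : b ≠ ∞)
    (h : ∀ x, f x ≤ S.indicator (fun _ => b) x) :
    eLpNorm f p μ ≠ ∞ := by
  refine ne_top_of_le_ne_top ?_ (eLpNorm_ennreal_mono h)
  have h0 : p ≠ 0 := (zero_lt_one.trans_le hp1).ne'
  rcases eq_or_ne p ∞ with rfl | hp
  · rw [eLpNorm_ennreal_top]
    exact ne_top_of_le_ne_top hb (essSup_le_of_ae_le _
      (Eventually.of_forall fun x => indicator_le_self _ _ x))
  · rw [eLpNorm_ennreal_eq h0 hp]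
    refine ENNReal.rpow_ne_top_of_nonneg (by positivity) ?_
    have hpos : 0 < p.toReal := ENNReal.toReal_pos h0 hp
    have h3 : ∀ x, S.indicator (fun _ => b) x ^ p.toReal = S.indicator (fun _ => b ^ p.toReal) x := by
      intro x
      by_cases hx : x ∈ S <;> simp [hx, hpos]
    simp_rw [h3]
    rw [lintegral_indicator_const hSm]
    exact ENNReal.mul_ne_top (ENNReal.rpow_ne_top_of_nonneg hpos.le hb) hS

/-- The converse of Hölder's inequality for mixed norms: it suffices to test against functions that
are finite and supported in boxes of finite measure. -/
theorem mixedENorm_le_of_forall_lintegral_le [SFinite μ] [SFinite ν]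
    (hpp' : p.HolderConjugate p') (hqq' : q.HolderConjugate q') (hp : p ≠ ∞) (hq : q ≠ ∞)
    {S : ℕ → Set α} {T : ℕ → Set β} (hSm : ∀ n, MeasurableSet (S n)) (hTm : ∀ n, MeasurableSet (T n))
    (hS : ∀ n, μ (S n) ≠ ∞) (hT : ∀ n, ν (T n) ≠ ∞)
    (hcov : ∀ z : α × β, ∀ᶠ n in atTop, z ∈ S n ×ˢ T n)
    {g : α × β → ℝ≥0∞} (hg : Measurable g) (hb : ∀ n, ∃ b : ℝ≥0∞, b ≠ ∞ ∧ ∀ z ∈ S n ×ˢ T n, g z ≤ b)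
    {C : ℝ≥0∞}
    (hC : ∀ n, ∀ k : α × β → ℝ≥0∞, Measurable k → (∀ z, k z ≠ ∞) → (∀ z, z ∉ S n ×ˢ T n → k z = 0) →
      mixedENorm p q μ ν k ≤ 1 → ∫⁻ z, k z * g z ∂(μ.prod ν) ≤ C) :
    mixedENorm p' q' μ ν g ≤ C := by
  have hp'1 : 1 ≤ p' := ENNReal.HolderConjugate.one_le p' p
  have hq'1 : 1 ≤ q' := ENNReal.HolderConjugate.one_le q' q
  have hbox n : MeasurableSet (S n ×ˢ T n) := (hSm n).prod (hTm n)
  -- On a box g is bounded, so all norms of the truncation are finite and near-extremals exist;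
  -- Fatou for mixed norms recovers g.
  set G : ℕ → α × β → ℝ≥0∞ := fun n => (S n ×ˢ T n).indicator g with hG
  have hGm n : Measurable (G n) := hg.indicator (hbox n)
  refine mixedENorm_le_of_le_liminf (g := G) (zero_lt_one.trans_le hp'1).ne'
    (zero_lt_one.trans_le hq'1).ne' hGm (fun z => ?_) (Eventually.of_forall fun n => ?_)
  · refine le_of_eq (Tendsto.liminf_eq ?_).symm
    refine tendsto_const_nhds.congr' ?_
    filter_upwards [hcov z] with n hn
    simp [hG, indicator_of_mem hn]
  obtain ⟨b, hbtop, hbz⟩ := hb n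
  have hslice ξ x : G n (x, ξ) ≤ (S n).indicator (fun _ => b) x := by
    by_cases h : (x, ξ) ∈ S n ×ˢ T n
    · rw [hG]
      simp only
      rw [indicator_of_mem h, indicator_of_mem h.1]
      exact hbz _ h
    · simp [hG, indicator_of_notMem h]
  have hN ξ : eLpNorm (fun x => G n (x, ξ)) p' μ ≠ ∞ :=
    eLpNorm_ne_top_of_bounded_of_support hp'1 (hSm n) (hS n) hbtop (hslice ξ)
  have hbS : eLpNorm ((S n).indicator fun _ => b) p' μ ≠ ∞ :=
    eLpNorm_ne_top_of_bounded_of_support hp'1 (hSm n) (hS n) hbtop fun x => le_rfl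
  have hM ξ : eLpNorm (fun x => G n (x, ξ)) p' μ ≤
      (T n).indicator (fun _ => eLpNorm ((S n).indicator fun _ => b) p' μ) ξ := by
    by_cases h : ξ ∈ T n
    · rw [indicator_of_mem h]
      exact eLpNorm_ennreal_mono (hslice ξ)
    · have : (fun x => G n (x, ξ)) = 0 := by
        ext x
        have : (x, ξ) ∉ S n ×ˢ T n := fun h' => h h'.2
        simp [hG, indicator_of_notMem this]
      rw [this]
      simp
  have hMtop := eLpNorm_ne_top_of_bounded_of_support (p := q') hq'1 (hTm n) (hT n) hbS hM
  -- The test function is j(ξ) k_ξ(x): k_ξ is nearly extremal for the slice at ξ, and j is nearly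
  -- extremal for the function of slice norms (with a one-point parameter space). Each choice costs
  -- a factor r, and r tends to 1 afterwards.
  have key (r : ℝ≥0∞) (hr : r < 1) : r * r * mixedENorm p' q' μ ν (G n) ≤ C := by
    obtain ⟨k, hkm, hkfin, hk0, hk1, hkN⟩ := exists_measurable_near_extremal (μ := μ)
      (g := fun ξ x => G n (x, ξ)) hpp' hp ((hGm n).comp measurable_swap)
      (fun ξ x => ne_top_of_le_ne_top hbtop ((hslice ξ x).trans (indicator_le_self _ _ x))) hN
      (hS n) (fun ξ x hx => by simpa [hx] using hslice ξ x) hr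
    obtain ⟨j, hjm, hjfin, hj0, hj1, hjN⟩ := exists_measurable_near_extremal (μ := ν) (Ξ := Unit)
      (g := fun _ ξ => eLpNorm (fun x => G n (x, ξ)) p' μ) hqq' hq
      ((measurable_slice (hGm n)).comp measurable_snd) (fun _ => hN) (fun _ => hMtop)
      (hT n) (fun _ ξ hξ => by simpa [hξ] using hM ξ) hr
    have hjm' : Measurable (j ()) := hjm.of_uncurry_left
    have hKm : Measurable fun z : α × β => j () z.2 * k z.2 z.1 :=
      (hjm'.comp measurable_snd).mul (hkm.comp measurable_swap)
    have h := hC n (fun z => j () z.2 * k z.2 z.1) hKm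
      (fun z => ENNReal.mul_ne_top (hjfin _ _) (hkfin _ _))
      (fun z hz => by rw [hk0 z.2 z.1 (by simp [hG, indicator_of_notMem hz]), mul_zero]) ?_
    · refine le_trans ?_ h
      calc r * r * mixedENorm p' q' μ ν (G n)
          = r * (r * mixedENorm p' q' μ ν (G n)) := mul_assoc _ _ _
        _ ≤ r * ∫⁻ ξ, j () ξ * eLpNorm (fun x => G n (x, ξ)) p' μ ∂ν := by
            gcongr
            exact hjN ()
        _ = ∫⁻ ξ, j () ξ * (r * eLpNorm (fun x => G n (x, ξ)) p' μ) ∂ν := by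
            refine (lintegral_const_mul r (hjm'.mul (measurable_slice (hGm n)))).symm.trans
              (lintegral_congr fun ξ => ?_)
            simp only [Pi.mul_apply]
            ring
        _ ≤ ∫⁻ ξ, j () ξ * ∫⁻ x, k ξ x * G n (x, ξ) ∂μ ∂ν := by
            gcongr with ξ
            exact hkN ξ
        _ = ∫⁻ ξ, ∫⁻ x, j () ξ * k ξ x * G n (x, ξ) ∂μ ∂ν := by
            refine lintegral_congr fun ξ => ?_
            rw [← lintegral_const_mul]
            · simp_rw [mul_assoc]
            · exact (hkm.of_uncurry_left).mul ((hGm n).comp measurable_prodMk_right)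
        _ = ∫⁻ z, j () z.2 * k z.2 z.1 * G n z ∂(μ.prod ν) := by
            rw [lintegral_prod_symm' (fun z => j () z.2 * k z.2 z.1 * G n z) (hKm.mul (hGm n))]
        _ ≤ ∫⁻ z, j () z.2 * k z.2 z.1 * g z ∂(μ.prod ν) := by
            gcongr with z
            exact indicator_le_self _ _ z
    · refine le_trans (eLpNorm_ennreal_mono fun ξ => ?_) (hj1 ())
      change eLpNorm (fun x => j () ξ * k ξ x) p μ ≤ _
      rw [eLpNorm_ennreal_const_mul hkm.of_uncurry_left _ (ENNReal.HolderConjugate.one_le p p')]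
      exact mul_le_of_le_one_right' (hk1 ξ)
  have hcont : Tendsto (fun r : ℝ≥0∞ => r * r * mixedENorm p' q' μ ν (G n)) (𝓝[<] 1)
      (𝓝 (1 * 1 * mixedENorm p' q' μ ν (G n))) := by
    refine Tendsto.mono_left ?_ nhdsWithin_le_nhds
    refine ENNReal.Tendsto.mul_const ?_ (Or.inr hMtop)
    exact ENNReal.Tendsto.mul tendsto_id (Or.inr ENNReal.one_ne_top) tendsto_id
      (Or.inr ENNReal.one_ne_top)
  rw [one_mul, one_mul] at hcont
  have : (𝓝[<] (1 : ℝ≥0∞)).NeBot := nhdsLT_neBot_of_exists_lt ⟨0, zero_lt_one⟩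
  exact le_of_tendsto hcont (eventually_nhdsWithin_of_forall fun r hr => key r hr)

end MixedENorm

variable {d : ℕ}

/-! ### The weight on phase space and the integrability of its negative exponentials. -/

namespace WeightFunction

variable (ω : WeightFunction)

/-- `ω(z) = ω(|z|)` for `z` in phase space. -/
def phase (z : RSpace d × RSpace d) : ℝ := ω.toFun (Real.sqrt (‖z.1‖ ^ 2 + ‖z.2‖ ^ 2))

theorem phase_nonneg (z : RSpace d × RSpace d) : 0 ≤ ω.phase z := ω.nonneg _ (Real.sqrt_nonneg _)

theorem phase_neg (z : RSpace d × RSpace d) : ω.phase (-z) = ω.phase z := by simp [phase]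

/-- The product type carries the maximum norm; in `WithLp 2` the square root becomes a norm, and its
triangle inequality combines with monotonicity and subadditivity of ω. -/
theorem phase_add_le (z w : RSpace d × RSpace d) : ω.phase (z + w) ≤ ω.phase z + ω.phase w := by
  have h (z : RSpace d × RSpace d) :
      Real.sqrt (‖z.1‖ ^ 2 + ‖z.2‖ ^ 2) = ‖WithLp.toLp 2 z‖ := by
    rw [WithLp.prod_norm_eq_of_L2]; rfl
  unfold phase
  rw [h, h, h]
  refine (ω.increasing (norm_nonneg _) (add_nonneg (norm_nonneg _) (norm_nonneg _)) ?_).trans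
    (ω.subadditive _ _ (norm_nonneg _) (norm_nonneg _))
  rw [WithLp.toLp_add]
  exact norm_add_le _ _

theorem phase_le_add_sub (z w : RSpace d × RSpace d) :
    ω.phase w ≤ ω.phase z + ω.phase (w - z) := by
  simpa using ω.phase_add_le z (w - z)

theorem at_fst_le_phase (z : RSpace d × RSpace d) : ω.at z.1 ≤ ω.phase z :=
  ω.increasing (norm_nonneg _) (Real.sqrt_nonneg _)
    (Real.le_sqrt_of_sq_le (le_add_of_nonneg_right (sq_nonneg _)))

theorem at_snd_le_phase (z : RSpace d × RSpace d) : ω.at z.2 ≤ ω.phase z :=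
  ω.increasing (norm_nonneg _) (Real.sqrt_nonneg _)
    (Real.le_sqrt_of_sq_le (le_add_of_nonneg_left (sq_nonneg _)))

theorem phase_le_at_add_at (z : RSpace d × RSpace d) : ω.phase z ≤ ω.at z.1 + ω.at z.2 := by
  refine (ω.increasing (Real.sqrt_nonneg _) (add_nonneg (norm_nonneg z.1) (norm_nonneg z.2)) ?_).trans
    (ω.subadditive _ _ (norm_nonneg _) (norm_nonneg _))
  refine Real.sqrt_le_iff.2 ⟨by positivity, ?_⟩
  nlinarith [mul_nonneg (norm_nonneg z.1) (norm_nonneg z.2)]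

theorem continuous_at : Continuous (fun x : RSpace d => ω.at x) :=
  ω.continuousOn.comp_continuous continuous_norm fun x => norm_nonneg x

theorem continuous_phase : Continuous (fun z : RSpace d × RSpace d => ω.phase z) :=
  ω.continuousOn.comp_continuous (by fun_prop) fun z => Real.sqrt_nonneg _

theorem expWeight_eq (lam : ℝ) (z : RSpace d × RSpace d) :
    expWeight ω lam z = Real.exp (lam * ω.phase z) := rfl

/-- Moderateness of the weight: subadditivity and evenness give |ω(w) - ω(w-z)| ≤ ω(z), which serves
both signs of the exponent. This lets weighted norms survive convolution. -/
theorem expWeight_le (lam : ℝ) (z w : RSpace d × RSpace d) :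
    expWeight ω lam w ≤ Real.exp (|lam| * ω.phase z) * expWeight ω lam (w - z) := by
  rw [expWeight_eq, expWeight_eq, ← Real.exp_add]
  refine Real.exp_le_exp.2 ?_
  have h1 := ω.phase_le_add_sub z w
  have h2 : ω.phase (w - z) ≤ ω.phase w + ω.phase z := by
    simpa [sub_eq_add_neg, phase_neg] using ω.phase_add_le w (-z)
  rcases abs_cases lam with ⟨h, h'⟩ | ⟨h, h'⟩ <;> rw [h] <;> nlinarith

/-- From log t = o(ω(t)) one gets |x| ≤ e^{ω(x)} for large |x|. Polynomial factors can thus be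
absorbed into exponential weights, and negative exponentials become integrable. -/
theorem exists_one_add_norm_pow_le (n : ℕ) :
    ∃ C : ℝ, 0 < C ∧ ∀ x : RSpace d, (1 + ‖x‖) ^ n ≤ C * Real.exp (n * ω.at x) := by
  have h := ω.log_isLittleO.bound one_pos
  obtain ⟨T, hT⟩ := eventually_atTop.1 h
  set R := max T 1 with hR
  have hR1 : 1 ≤ R := le_max_right _ _
  refine ⟨2 ^ n * (1 + R) ^ n, by positivity, fun x => ?_⟩
  rcases le_total R ‖x‖ with hx | hx
  · have hx1 : 1 ≤ ‖x‖ := hR1.trans hx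
    have h1 : ‖x‖ ≤ Real.exp (ω.at x) := by
      have := hT ‖x‖ ((le_max_left _ _).trans hx)
      rw [Real.norm_eq_abs, Real.norm_eq_abs, one_mul, abs_of_nonneg (ω.nonneg _ (norm_nonneg x)),
        abs_of_nonneg (Real.log_nonneg hx1)] at this
      exact (Real.log_le_iff_le_exp (by linarith)).1 this
    calc (1 + ‖x‖) ^ n ≤ (2 * Real.exp (ω.at x)) ^ n := by gcongr; linarith
      _ = 2 ^ n * Real.exp (n * ω.at x) := by rw [mul_pow, Real.exp_nat_mul]
      _ ≤ _ := by
        gcongr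
        exact le_mul_of_one_le_right (by positivity) (one_le_pow₀ (by linarith))
  · calc (1 + ‖x‖) ^ n ≤ (1 + R) ^ n := by gcongr
      _ ≤ 2 ^ n * (1 + R) ^ n := le_mul_of_one_le_left (by positivity) (one_le_pow₀ one_le_two)
      _ ≤ _ := le_mul_of_one_le_right (by positivity)
        (Real.one_le_exp (mul_nonneg n.cast_nonneg (ω.at_nonneg x)))

/-- The exponent d + 1 is enough because (1+|x|)^{-(d+1)} is integrable on ℝ^d. -/
theorem integrable_exp_neg_at {b : ℝ} (hb : (d + 1 : ℕ) ≤ b) :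
    Integrable (fun x : RSpace d => Real.exp (-(b * ω.at x))) := by
  obtain ⟨C, hC0, hC⟩ := ω.exists_one_add_norm_pow_le (d := d) (d + 1)
  have h := (integrable_one_add_norm (E := RSpace d) (μ := volume) (r := (d + 1 : ℕ))
    (by simp)).const_mul C
  refine h.mono' (by have := ω.continuous_at (d := d); fun_prop) (Eventually.of_forall fun x => ?_)
  have h1 : 0 < (1 + ‖x‖) ^ (d + 1) := by positivity
  rw [Real.norm_eq_abs, abs_of_pos (Real.exp_pos _), Real.rpow_neg (by positivity),
    Real.rpow_natCast, Real.exp_neg, ← div_eq_mul_inv, inv_le_comm₀ (Real.exp_pos _) (by positivity),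
    inv_div, div_le_iff₀ hC0, mul_comm]
  refine (hC x).trans ?_
  gcongr
  exact ω.at_nonneg x

/-- Since ω(x) and ω(ξ) are both at most ω(z), half of the exponent can be spent on each variable.
This tensor-product bound explains the recurring constant 2(d+1). -/
theorem exp_neg_phase_le {b : ℝ} (hb : 0 ≤ b) (z : RSpace d × RSpace d) :
    Real.exp (-(2 * b * ω.phase z)) ≤ Real.exp (-(b * ω.at z.1)) * Real.exp (-(b * ω.at z.2)) := by
  rw [← Real.exp_add]
  refine Real.exp_le_exp.2 ?_
  nlinarith [ω.at_fst_le_phase z, ω.at_snd_le_phase z]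

theorem integrable_exp_neg_phase {b : ℝ} (hb : 2 * (d + 1 : ℕ) ≤ b) :
    Integrable (fun z : RSpace d × RSpace d => Real.exp (-(b * ω.phase z))) := by
  have h := (ω.integrable_exp_neg_at (d := d) (b := b / 2) (by linarith)).mul_prod
    (ω.integrable_exp_neg_at (d := d) (b := b / 2) (by linarith))
  refine h.mono' (by have := ω.continuous_phase (d := d); fun_prop) (Eventually.of_forall fun z => ?_)
  rw [Real.norm_eq_abs, abs_of_pos (Real.exp_pos _)]
  have := ω.exp_neg_phase_le (d := d) (b := b / 2)
    (by have := (d + 1).cast_nonneg (α := ℝ); linarith) z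
  rwa [mul_div_cancel₀ b two_ne_zero] at this

theorem eLpNorm_exp_neg_at_ne_top {b : ℝ} (hb : (d + 1 : ℕ) ≤ b) {p : ℝ≥0∞} (hp1 : 1 ≤ p) :
    eLpNorm (fun x : RSpace d => ENNReal.ofReal (Real.exp (-(b * ω.at x)))) p volume ≠ ∞ := by
  have hb0 : 0 ≤ b := le_trans (Nat.cast_nonneg _) hb
  have h0 : p ≠ 0 := (zero_lt_one.trans_le hp1).ne'
  rcases eq_or_ne p ∞ with rfl | hp
  · rw [eLpNorm_ennreal_top]
    refine ne_top_of_le_ne_top ENNReal.one_ne_top (essSup_le_of_ae_le _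
      (Eventually.of_forall fun x => ENNReal.ofReal_le_one.2 (Real.exp_le_one_iff.2 ?_)))
    exact neg_nonpos.2 (mul_nonneg hb0 (ω.at_nonneg x))
  · have hr : 1 ≤ p.toReal := by
      rw [← ENNReal.toReal_one]
      exact ENNReal.toReal_mono hp hp1
    rw [eLpNorm_ennreal_eq h0 hp]
    refine ENNReal.rpow_ne_top_of_nonneg (by positivity) ?_
    have h := (ω.integrable_exp_neg_at (d := d) (b := b * p.toReal) (by nlinarith)).lintegral_lt_top
    refine ne_of_eq_of_ne (lintegral_congr fun x => ?_) h.ne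
    rw [ENNReal.ofReal_rpow_of_pos (Real.exp_pos _), ← Real.exp_mul]
    congr 2
    ring

theorem mixedENorm_exp_neg_phase_ne_top {b : ℝ} (hb : 2 * (d + 1 : ℕ) ≤ b) {p q : ℝ≥0∞}
    (hp1 : 1 ≤ p) (hq1 : 1 ≤ q) :
    mixedENorm p q volume volume
      (fun z : RSpace d × RSpace d => ENNReal.ofReal (Real.exp (-(b * ω.phase z)))) ≠ ∞ := by
  have hb2 : (d + 1 : ℕ) ≤ b / 2 := by linarith
  have hm : Measurable (fun x : RSpace d => ENNReal.ofReal (Real.exp (-(b / 2 * ω.at x)))) := by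
    have := (ω.continuous_at (d := d)).measurable
    fun_prop
  have hle : ∀ z : RSpace d × RSpace d, ENNReal.ofReal (Real.exp (-(b * ω.phase z))) ≤
      ENNReal.ofReal (Real.exp (-(b / 2 * ω.at z.2))) *
        ENNReal.ofReal (Real.exp (-(b / 2 * ω.at z.1))) := fun z => by
    rw [← ENNReal.ofReal_mul (Real.exp_pos _).le]
    refine ENNReal.ofReal_le_ofReal ?_
    have := ω.exp_neg_phase_le (d := d) (b := b / 2)
      (by have := (d + 1).cast_nonneg (α := ℝ); linarith) z
    rwa [mul_div_cancel₀ b two_ne_zero, mul_comm (Real.exp _)] at this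
  refine ne_top_of_le_ne_top ?_ (mixedENorm_mono hle)
  unfold mixedENorm
  simp only [eLpNorm_ennreal_const_mul hm _ hp1]
  simp only [mul_comm _ (eLpNorm _ p volume)]
  rw [eLpNorm_ennreal_const_mul hm _ hq1]
  exact ENNReal.mul_ne_top (ω.eLpNorm_exp_neg_at_ne_top hb2 hp1)
    (ω.eLpNorm_exp_neg_at_ne_top hb2 hq1)

end WeightFunction

/-- Passing to absolute values brings complex weighted functions under the [0,∞]-valued theory. -/
theorem mixedNorm_eq_mixedENorm (p q : ℝ≥0∞) (m : RSpace d × RSpace d → ℝ)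
    (F : RSpace d × RSpace d → ℂ) :
    mixedNorm p q m F = mixedENorm p q volume volume (fun z => ‖F z‖ₑ * ‖m z‖ₑ) := by
  unfold mixedNorm mixedENorm
  congr 1
  ext ξ
  rw [← eLpNorm_enorm]
  congr 1
  ext x
  rw [enorm_mul]
  congr 1
  simp [enorm_eq_nnnorm]

variable {ω : WeightFunction}

/-! ### Characters, Fourier inversion and Plancherel for the unnormalised transform. -/

theorem character_add (ξ η y : RSpace d) :
    character (ξ + η) y = character ξ y * character η y := by
  simp only [character, ← Complex.exp_add, inner_add_right]
  push_cast
  ring_nf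

theorem character_add_right (ξ y w : RSpace d) :
    character ξ (y + w) = character ξ y * character ξ w := by
  simp only [character, ← Complex.exp_add, inner_add_left]
  push_cast
  ring_nf

theorem conj_character (ξ y : RSpace d) : conj (character ξ y) = character (-ξ) y := by
  simp only [character, ← Complex.exp_conj, inner_neg_right]
  simp

theorem character_symm (ξ y : RSpace d) : character ξ y = character y ξ := by
  simp only [character, real_inner_comm]

theorem continuous_character_uncurry :
    Continuous (fun z : RSpace d × RSpace d => character z.1 z.2) := by
  unfold character
  fun_prop

theorem hatTransform_eq_character (u : RSpace d → ℂ) (ξ : RSpace d) :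
    hatTransform u ξ = ∫ y, character (-ξ) y * u y := by
  unfold hatTransform character
  congr 1
  ext y
  simp

/-- The Fourier transform of a Schwartz function, in the normalisation of `hatTransform`. -/
def hatSchwartz (u : 𝓢(RSpace d, ℂ)) : 𝓢(RSpace d, ℂ) :=
  SchwartzMap.compCLMOfContinuousLinearEquiv ℂ
    (ContinuousLinearEquiv.smulLeft (Units.mk0 ((2 * Real.pi)⁻¹) (by positivity) : ℝˣ))
    (FourierTransform.fourier u)

theorem hatSchwartz_coe (u : 𝓢(RSpace d, ℂ)) : ⇑(hatSchwartz u) = hatTransform u := by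
  rw [hatTransform_eq]
  rfl

theorem integral_comp_inv_two_pi_smul (f : RSpace d → ℂ) :
    ∫ ξ, f ((2 * Real.pi)⁻¹ • ξ) = ((2 * Real.pi) ^ d : ℝ) * ∫ ξ, f ξ := by
  rw [Measure.integral_comp_smul, finrank_euclideanSpace_fin, inv_pow, inv_inv,
    abs_of_pos (by positivity), Complex.real_smul]

/-- Fourier inversion for kernel e^{-2πi⟨x,ξ⟩}, rescaled by 2π in frequency; the Jacobian is the
factor (2π)^d. -/
theorem integral_hatTransform_mul_character (u : 𝓢(RSpace d, ℂ)) (y : RSpace d) :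
    ∫ ξ, hatTransform u ξ * character ξ y = ((2 * Real.pi) ^ d : ℝ) * u y := by
  have h1 : u y = ∫ η, FourierTransform.fourier u η * character ((2 * Real.pi) • η) y := by
    conv_lhs => rw [← FourierTransform.fourierInv_fourier_eq u (F := 𝓢(RSpace d, ℂ)),
      SchwartzMap.fourierInv_coe, Real.fourierInv_eq']
    congr 1
    ext η
    rw [smul_eq_mul, mul_comm, character, inner_smul_right, real_inner_comm]
    congr 2
    push_cast
    ring
  rw [h1, ← integral_comp_inv_two_pi_smul, hatTransform_eq]
  congr 1
  ext ξ
  rw [smul_inv_smul₀ (by positivity)]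

theorem integral_hatTransform_mul_conj (u v : 𝓢(RSpace d, ℂ)) :
    ∫ ξ, hatTransform u ξ * conj (hatTransform v ξ) =
      ((2 * Real.pi) ^ d : ℝ) * ∫ y, u y * conj (v y) := by
  have h := SchwartzMap.integral_inner_fourier_fourier v u
  simp only [RCLike.inner_apply] at h
  rw [← h, ← integral_comp_inv_two_pi_smul, hatTransform_eq, hatTransform_eq]

/-! ### The short-time Fourier transform on S_ω: covariance and decay. -/

namespace SOmega

theorem ext' {u v : SOmega ω d} (h : ∀ y, u y = v y) : u = v :=
  Subtype.ext (SchwartzMap.ext h)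

theorem contDiff (u : SOmega ω d) : ContDiff ℝ (⊤ : ℕ∞) u := u.toSchwartz.smooth ⊤

theorem continuous (u : SOmega ω d) : Continuous u := u.toSchwartz.continuous

theorem integrable (u : SOmega ω d) : Integrable u := u.toSchwartz.integrable

/-- The Fourier transform on `S_ω(ℝᵈ)`. -/
def hat (u : SOmega ω d) : SOmega ω d :=
  ⟨hatSchwartz u.toSchwartz, by
    -- Transforming twice is reflection times (2π)^d, so the bounds on the transform of û are the
    -- bounds on u itself.
    have h : hatTransform (hatTransform u.toSchwartz) =
        (((2 * Real.pi) ^ d : ℝ) : ℂ) • fun y => u (-y) := by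
      ext y
      rw [hatTransform_eq_character, Pi.smul_apply, smul_eq_mul,
        ← integral_hatTransform_mul_character]
      congr 1
      ext ξ
      rw [mul_comm, character_symm]
    refine ⟨by rw [hatSchwartz_coe]; exact u.bounded_hat, ?_⟩
    rw [hatSchwartz_coe, h]
    exact u.bounded.comp_neg.smul (u.contDiff.comp contDiff_neg) _⟩

theorem hat_coe (u : SOmega ω d) : ⇑u.hat = hatTransform u := hatSchwartz_coe u.toSchwartz

theorem shift_apply' (z : RSpace d × RSpace d) (u : SOmega ω d) (y : RSpace d) :
    u.shift z y = character z.2 y * u (y - z.1) := u.shift_apply z y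

theorem conjugate_conjugate (u : SOmega ω d) : u.conjugate.conjugate = u :=
  ext' fun y => by simp

theorem conjugate_add (u v : SOmega ω d) : (u + v).conjugate = u.conjugate + v.conjugate :=
  ext' fun y => by
    rw [conjugate_apply]
    change conj (u y + v y) = u.conjugate y + v.conjugate y
    simp

theorem conjugate_smul (c : ℂ) (u : SOmega ω d) : (c • u).conjugate = conj c • u.conjugate :=
  ext' fun y => by
    rw [conjugate_apply]
    change conj (c * u y) = conj c * u.conjugate y
    simp

theorem norm_le (u : SOmega ω d) {lam : ℝ} (hlam : 0 < lam) (y : RSpace d) :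
    ‖u y‖ ≤ weightedSup ω lam 0 u * Real.exp (-(lam * ω.at y)) := by
  have h := le_weightedSup hlam 0 u.bounded y
  rw [norm_iteratedFDeriv_zero] at h
  rw [Real.exp_neg, ← div_eq_mul_inv, le_div_iff₀ (Real.exp_pos _), mul_comm]
  exact h

theorem weightedSup_nonneg (u : RSpace d → ℂ) (lam : ℝ) (k : ℕ) : 0 ≤ weightedSup ω lam k u :=
  Real.iSup_nonneg fun x => by positivity

theorem exists_norm_le (u : SOmega ω d) : ∃ B, ∀ y, ‖u y‖ ≤ B :=
  ⟨weightedSup ω 1 0 u, fun y => (u.norm_le one_pos y).trans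
    (mul_le_of_le_one_right (weightedSup_nonneg _ _ _)
      (Real.exp_le_one_iff.2 (by simpa using ω.at_nonneg y)))⟩

/-- The short-time Fourier transform of elements of `S_ω(ℝᵈ)`. -/
def stft (φ u : SOmega ω d) (z : RSpace d × RSpace d) : ℂ := ∫ y, u y * conj (φ.shift z y)

theorem stft_toDistribution (φ u : SOmega ω d) (z : RSpace d × RSpace d) :
    OmegaDistribution.stft φ u.toDistribution z = stft φ u z := by
  change ∫ y, u y * (φ.shift z).conjugate y = _
  simp [stft]

theorem norm_shift (φ : SOmega ω d) (z : RSpace d × RSpace d) (y : RSpace d) :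
    ‖φ.shift z y‖ = ‖φ (y - z.1)‖ := by
  rw [shift_apply', norm_mul, norm_character, one_mul]

theorem continuous_shift_apply (φ : SOmega ω d) (y : RSpace d) :
    Continuous (fun z => φ.shift z y) := by
  simp only [shift_apply']
  exact (continuous_character_uncurry.comp (continuous_snd.prodMk continuous_const)).mul
    (φ.continuous.comp (continuous_const.sub continuous_fst))

theorem continuous_shift_uncurry (φ : SOmega ω d) :
    Continuous (fun w : (RSpace d × RSpace d) × RSpace d => φ.shift w.1 w.2) := by
  simp only [shift_apply']
  exact (continuous_character_uncurry.comp (by fun_prop :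
    Continuous fun w : (RSpace d × RSpace d) × RSpace d => (w.1.2, w.2))).mul
    (φ.continuous.comp (by fun_prop))

theorem continuous_stft (φ u : SOmega ω d) : Continuous (stft φ u) := by
  obtain ⟨B, hB⟩ := φ.exists_norm_le
  refine continuous_of_dominated (bound := fun y => ‖u y‖ * B) (fun z => ?_) (fun z => ?_)
    (u.integrable.norm.mul_const B) (Eventually.of_forall fun y => ?_)
  · exact (u.continuous.mul (Complex.continuous_conj.comp
      (φ.shift z).continuous)).aestronglyMeasurable
  · refine Eventually.of_forall fun y => ?_
    rw [norm_mul, RCLike.norm_conj, norm_shift]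
    exact mul_le_mul_of_nonneg_left (hB _) (norm_nonneg _)
  · exact continuous_const.mul (Complex.continuous_conj.comp (φ.continuous_shift_apply y))

/-- Covariance: a phase-space shift of u translates its transform up to a unimodular factor. It is
the reason why analysis after synthesis is dominated by a convolution with |V_φ φ|. -/
theorem stft_shift (φ u : SOmega ω d) (w z : RSpace d × RSpace d) :
    stft φ (u.shift w) z = character (w.2 - z.2) w.1 * stft φ u (z - w) := by
  rw [stft, ← integral_add_right_eq_self _ w.1, stft, ← integral_const_mul]
  congr 1
  ext y
  simp only [shift_apply', map_mul, conj_character, add_sub_cancel_right, Prod.fst_sub,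
    Prod.snd_sub, character_add_right]
  rw [sub_eq_add_neg w.2 z.2, neg_sub, sub_eq_add_neg w.2 z.2, character_add, character_add]
  have : y + w.1 - z.1 = y - (z.1 - w.1) := by abel
  rw [this]
  ring

theorem norm_stft_shift (φ u : SOmega ω d) (w z : RSpace d × RSpace d) :
    ‖stft φ (u.shift w) z‖ = ‖stft φ u (z - w)‖ := by
  rw [stft_shift, norm_mul, norm_character, one_mul]

theorem conj_stft_shift (φ : SOmega ω d) (w z : RSpace d × RSpace d) :
    conj (stft φ (φ.shift w) z) = stft φ (φ.shift z) w := by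
  rw [stft, stft, ← integral_conj]
  congr 1
  ext y
  rw [map_mul, Complex.conj_conj, mul_comm]

theorem conjugate_shift (φ : SOmega ω d) (w : RSpace d × RSpace d) :
    (φ.shift w).conjugate = φ.conjugate.shift (w.1, -w.2) :=
  ext' fun y => by
    rw [conjugate_apply, shift_apply', shift_apply', conjugate_apply, map_mul, conj_character]

theorem hat_shift (φ : SOmega ω d) (z : RSpace d × RSpace d) (η : RSpace d) :
    (φ.shift z).hat η = character z.2 z.1 * φ.hat.shift (z.2, -z.1) η := by
  rw [hat_coe, shift_apply', hat_coe]
  have h : ⇑(φ.shift z) = fun y => character z.2 y * φ (y - z.1) := by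
    ext y; exact φ.shift_apply' z y
  change hatTransform ⇑(φ.shift z) η = _
  rw [h, hatTransform_shift]

/-- By Plancherel, the Fourier transform acts on phase space as the rotation (x,ξ) ↦ (ξ,-x).
Estimates in x thereby yield estimates in ξ. -/
theorem norm_stft_hat (φ u : SOmega ω d) (z : RSpace d × RSpace d) :
    ‖stft φ.hat u.hat (z.2, -z.1)‖ = (2 * Real.pi) ^ d * ‖stft φ u z‖ := by
  have h := integral_hatTransform_mul_conj u.toSchwartz (φ.shift z).toSchwartz
  have h2 : ∫ ξ, hatTransform u.toSchwartz ξ * conj (hatTransform (φ.shift z).toSchwartz ξ) =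
      conj (character z.2 z.1) * stft φ.hat u.hat (z.2, -z.1) := by
    rw [stft, ← integral_const_mul]
    congr 1
    ext η
    rw [← hat_coe, ← hat_coe, hat_shift, map_mul]
    ring
  rw [h2] at h
  have h3 := congrArg norm h
  rw [norm_mul, RCLike.norm_conj, norm_character, one_mul, norm_mul, Complex.norm_real,
    Real.norm_eq_abs, abs_of_pos (by positivity)] at h3
  exact h3

/-- Both factors decay like e^{-(μ+d+1)ω}. As ω(x) ≤ ω(y) + ω(y-x), the part μ produces decay in x,
while the remaining d + 1 on u makes the integral over y converge. -/
theorem norm_stft_le_at_fst (φ u : SOmega ω d) {mu : ℝ} (hmu : 0 ≤ mu) (z : RSpace d × RSpace d) :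
    ‖stft φ u z‖ ≤ weightedSup ω (mu + (d + 1 : ℕ)) 0 u * weightedSup ω (mu + (d + 1 : ℕ)) 0 φ *
      (∫ y : RSpace d, Real.exp (-((d + 1 : ℕ) * ω.at y))) * Real.exp (-(mu * ω.at z.1)) := by
  set lam := mu + (d + 1 : ℕ) with hlam
  have hd : (0 : ℝ) < (d + 1 : ℕ) := by positivity
  have hpos : 0 < lam := by positivity
  rw [mul_assoc, mul_assoc, ← integral_mul_const, ← integral_const_mul, ← integral_const_mul]
  refine norm_integral_le_of_norm_le
    ((((ω.integrable_exp_neg_at le_rfl).mul_const _).const_mul _).const_mul _)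
    (Eventually.of_forall fun y => ?_)
  rw [norm_mul, RCLike.norm_conj, norm_shift, ← mul_assoc]
  refine (mul_le_mul (u.norm_le hpos y) (φ.norm_le hpos (y - z.1)) (norm_nonneg _)
    (mul_nonneg (weightedSup_nonneg _ _ _) (Real.exp_pos _).le)).trans ?_
  rw [mul_mul_mul_comm]
  refine mul_le_mul_of_nonneg_left ?_
    (mul_nonneg (weightedSup_nonneg _ _ _) (weightedSup_nonneg _ _ _))
  rw [← Real.exp_add, ← Real.exp_add]
  refine Real.exp_le_exp.2 ?_
  have h1 : ω.at z.1 ≤ ω.at y + ω.at (y - z.1) := by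
    have := ω.at_add_le y (z.1 - y)
    rw [add_sub_cancel, ← neg_sub y z.1, ω.at_neg] at this
    exact this
  have h2 := mul_le_mul_of_nonneg_left h1 hmu
  have h3 := mul_nonneg hd.le (ω.at_nonneg (y - z.1))
  rw [hlam]
  nlinarith

/-- Decay in x is direct, decay in ξ comes from û with window φ̂. Both are taken at rate 2μ, because
ω(z) ≤ ω(x) + ω(ξ) is at most twice the larger of the two. The dependence on u is through two
seminorms of order zero only. -/
theorem exists_norm_stft_le (φ : SOmega ω d) {mu : ℝ} (hmu : 0 ≤ mu) :
    ∃ C : ℝ, 0 ≤ C ∧ ∀ (u : SOmega ω d) (z : RSpace d × RSpace d),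
      ‖stft φ u z‖ ≤ C * (weightedSup ω (2 * mu + (d + 1 : ℕ)) 0 u +
        weightedSup ω (2 * mu + (d + 1 : ℕ)) 0 (hatTransform u)) * Real.exp (-(mu * ω.phase z)) := by
  set lam := 2 * mu + (d + 1 : ℕ)
  set D := ∫ y : RSpace d, Real.exp (-((d + 1 : ℕ) * ω.at y))
  have hD : 0 ≤ D := integral_nonneg fun y => (Real.exp_pos _).le
  set P := weightedSup ω lam 0 φ
  set Q := weightedSup ω lam 0 φ.hat
  have hP : 0 ≤ P := weightedSup_nonneg _ _ _
  have hQ : 0 ≤ Q := weightedSup_nonneg _ _ _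
  refine ⟨(P + Q) * D, by positivity, fun u z => ?_⟩
  set A := weightedSup ω lam 0 u
  set B := weightedSup ω lam 0 (hatTransform u) with hB
  have hA0 : 0 ≤ A := weightedSup_nonneg _ _ _
  have hB0 : 0 ≤ B := weightedSup_nonneg _ _ _
  have h1 : ‖stft φ u z‖ ≤ A * P * D * Real.exp (-(2 * mu * ω.at z.1)) :=
    norm_stft_le_at_fst φ u (by positivity) z
  have h2 : ‖stft φ u z‖ ≤ B * Q * D * Real.exp (-(2 * mu * ω.at z.2)) := by
    have h := norm_stft_le_at_fst φ.hat u.hat (mu := 2 * mu) (by positivity) (z.2, -z.1)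
    rw [norm_stft_hat] at h
    change _ ≤ weightedSup ω lam 0 u.hat * Q * D * Real.exp (-(2 * mu * ω.at z.2)) at h
    rw [hat_coe u, ← hB] at h
    refine le_trans (le_mul_of_one_le_left (norm_nonneg _) (one_le_pow₀ ?_)) h
    linarith [Real.pi_gt_three]
  have h3 := ω.phase_le_at_add_at z
  have hAB : A * P * D ≤ (P + Q) * D * (A + B) ∧ B * Q * D ≤ (P + Q) * D * (A + B) := by
    have := mul_nonneg (mul_nonneg hP hD) hB0
    have := mul_nonneg (mul_nonneg hQ hD) hA0
    have := mul_nonneg (mul_nonneg hQ hD) hB0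
    have := mul_nonneg (mul_nonneg hP hD) hA0
    constructor <;> nlinarith
  rcases le_total (ω.at z.2) (ω.at z.1) with h | h
  · refine h1.trans (mul_le_mul hAB.1 (Real.exp_le_exp.2 ?_) (Real.exp_pos _).le (by positivity))
    nlinarith
  · refine h2.trans (mul_le_mul hAB.2 (Real.exp_le_exp.2 ?_) (Real.exp_pos _).le (by positivity))
    nlinarith

theorem exists_norm_stft_le_exp (φ u : SOmega ω d) {mu : ℝ} (hmu : 0 ≤ mu) :
    ∃ C : ℝ, 0 ≤ C ∧ ∀ z, ‖stft φ u z‖ ≤ C * Real.exp (-(mu * ω.phase z)) := by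
  obtain ⟨C, hC, h⟩ := exists_norm_stft_le φ hmu
  exact ⟨_, mul_nonneg hC (add_nonneg (weightedSup_nonneg _ _ _) (weightedSup_nonneg _ _ _)), h u⟩

theorem integrable_exp_mul_stft (φ u : SOmega ω d) (mu : ℝ) :
    Integrable (fun z => Real.exp (mu * ω.phase z) * ‖stft φ u z‖) := by
  set b : ℝ := 2 * (d + 1 : ℕ)
  have hb : 0 ≤ b := by positivity
  obtain ⟨C, hC, h⟩ := exists_norm_stft_le_exp φ u (mu := |mu| + b) (by positivity)
  refine ((ω.integrable_exp_neg_phase (b := b) le_rfl).const_mul C).mono' ?_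
    (Eventually.of_forall fun z => ?_)
  · have := ω.continuous_phase (d := d)
    have := continuous_stft φ u
    exact Continuous.aestronglyMeasurable (by fun_prop)
  · rw [norm_mul, norm_norm, Real.norm_eq_abs, abs_of_pos (Real.exp_pos _)]
    calc _ ≤ Real.exp (mu * ω.phase z) * (C * Real.exp (-((|mu| + b) * ω.phase z))) := by
          gcongr; exact h z
      _ = C * Real.exp (mu * ω.phase z + -((|mu| + b) * ω.phase z)) := by rw [Real.exp_add]; ring
      _ ≤ _ := by
          gcongr
          nlinarith [le_abs_self mu, ω.phase_nonneg z]

theorem integrable_stft (φ u : SOmega ω d) : Integrable (stft φ u) := by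
  have h := integrable_exp_mul_stft φ u 0
  simp only [zero_mul, Real.exp_zero, one_mul] at h
  exact (integrable_norm_iff (continuous_stft φ u).aestronglyMeasurable).1 h

end SOmega

/-! ### Inversion formula and Moyal's identity on S_ω. -/

namespace SOmega

/-- The constant `(2π)ᵈ ‖φ‖²` of the inversion formula. -/
def inversionConst (φ : SOmega ω d) : ℝ := (2 * Real.pi) ^ d * ∫ y, ‖φ y‖ ^ 2

theorem integrable_norm_sq (φ : SOmega ω d) : Integrable (fun y => ‖φ y‖ ^ 2) := by
  have h := (φ.integrable_mul φ).norm
  simp only [← sq, norm_pow] at h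
  exact h

theorem inversionConst_pos {φ : SOmega ω d} (hφ : φ ≠ 0) : 0 < inversionConst φ := by
  refine mul_pos (by positivity) ?_
  obtain ⟨y, hy⟩ : ∃ y, φ y ≠ 0 := by
    by_contra! h
    exact hφ (ext' h)
  refine integral_pos_of_integrable_nonneg_nonzero (x := y)
    (φ.continuous.norm.pow 2) φ.integrable_norm_sq (fun y => by positivity) (by simpa using hy)

theorem stft_eq_hatTransform (φ u : SOmega ω d) (x ξ : RSpace d) :
    stft φ u (x, ξ) = hatTransform (fun y => u y * conj (φ (y - x))) ξ := by
  rw [stft, hatTransform_eq_character]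
  congr 1
  ext y
  rw [shift_apply', map_mul, conj_character]
  ring

theorem integrable_stft_mul_shift (φ u : SOmega ω d) (y : RSpace d) :
    Integrable (fun z => stft φ u z * φ.shift z y) := by
  obtain ⟨B, hB⟩ := φ.exists_norm_le
  exact (integrable_stft φ u).mul_bdd (c := B) (φ.continuous_shift_apply y).aestronglyMeasurable
    (Eventually.of_forall fun z => by rw [norm_shift]; exact hB _)

/-- The inversion formula for the short-time Fourier transform on `S_ω(ℝᵈ)`. -/
theorem integral_stft_mul_shift (φ u : SOmega ω d) (y : RSpace d) :
    ∫ z, stft φ u z * φ.shift z y = inversionConst φ * u y := by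
  rw [Measure.volume_eq_prod, integral_prod _ (integrable_stft_mul_shift φ u y)]
  -- For fixed x the function ξ ↦ V_φ u(x,ξ) is the Fourier transform of y ↦ u(y) conj(φ(y-x)), so
  -- integrating over ξ is Fourier inversion; integrating the resulting |φ(y-x)|² over x then gives
  -- ‖φ‖².
  have h (x : RSpace d) : ∫ ξ, stft φ u (x, ξ) * φ.shift (x, ξ) y =
      ((2 * Real.pi) ^ d : ℝ) * u y * ((‖φ (y - x)‖ ^ 2 : ℝ) : ℂ) := by
    set a : 𝓢(RSpace d, ℂ) :=
      SchwartzMap.smulLeftCLM ℂ (fun y => u y) (φ.shift (x, 0)).conjugate.toSchwartz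
    have ha (y : RSpace d) : a y = u y * conj (φ (y - x)) := by
      rw [SchwartzMap.smulLeftCLM_apply_apply u.toSchwartz.hasTemperateGrowth]
      change u y * (φ.shift (x, 0)).conjugate y = _
      rw [conjugate_apply, shift_apply']
      simp [character]
    have h1 := integral_hatTransform_mul_character a y
    have h2 : ∀ ξ, stft φ u (x, ξ) * φ.shift (x, ξ) y =
        φ (y - x) * (hatTransform a ξ * character ξ y) := fun ξ => by
      have : ⇑a = fun y => u y * conj (φ (y - x)) := funext ha
      rw [stft_eq_hatTransform, shift_apply', ← this]
      ring
    simp_rw [h2]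
    rw [integral_const_mul, h1, ha]
    push_cast
    rw [← Complex.mul_conj']
    ring
  simp_rw [h]
  rw [integral_const_mul, integral_complex_ofReal, integral_sub_left_eq_self (fun x => ‖φ x‖ ^ 2),
    inversionConst]
  push_cast
  ring

/-- Moyal's identity on `S_ω(ℝᵈ)`. -/
theorem integral_stft_mul_conj_stft (φ u v : SOmega ω d) :
    ∫ z, stft φ u z * conj (stft φ v z) = inversionConst φ * ∫ y, u y * conj (v y) := by
  obtain ⟨B, hB⟩ := φ.exists_norm_le
  -- Moyal's identity follows from inversion by Fubini; this product is absolutely integrable since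
  -- V_φ u and v are integrable and φ is bounded.
  have hint : Integrable (fun w : (RSpace d × RSpace d) × RSpace d =>
      (stft φ u w.1 * conj (v w.2)) * φ.shift w.1 w.2) (volume.prod volume) := by
    refine ((integrable_stft φ u).mul_prod v.conjugate.integrable).congr ?_ |>.mul_bdd (c := B)
      (φ.continuous_shift_uncurry).aestronglyMeasurable
      (Eventually.of_forall fun w => by rw [norm_shift]; exact hB _)
    exact Eventually.of_forall fun w => by simp
  have h1 (z : RSpace d × RSpace d) : stft φ u z * conj (stft φ v z) =
      ∫ y, (stft φ u z * conj (v y)) * φ.shift z y := by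
    rw [stft, stft, ← integral_conj, ← integral_const_mul]
    congr 1
    ext y
    simp [mul_assoc]
  have h2 (y : RSpace d) : ∫ z, (stft φ u z * conj (v y)) * φ.shift z y =
      inversionConst φ * (u y * conj (v y)) := by
    rw [← mul_assoc, ← integral_stft_mul_shift, ← integral_mul_const]
    congr 1
    ext z
    ring
  simp_rw [h1]
  rw [integral_integral_swap hint]
  simp_rw [h2]
  rw [integral_const_mul]

theorem stft_add (φ u v : SOmega ω d) : stft φ (u + v) = stft φ u + stft φ v := by
  ext z
  rw [Pi.add_apply, stft, stft, stft, ← integral_add]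
  · congr 1
    ext y
    change (u y + v y) * _ = _
    ring
  · simpa using u.integrable_mul (φ.shift z).conjugate
  · simpa using v.integrable_mul (φ.shift z).conjugate

theorem stft_smul (φ : SOmega ω d) (c : ℂ) (u : SOmega ω d) : stft φ (c • u) = c • stft φ u := by
  ext z
  rw [Pi.smul_apply, stft, stft, smul_eq_mul, ← integral_const_mul]
  congr 1
  ext y
  change (c * u y) * _ = _
  ring

theorem stft_injective {φ : SOmega ω d} (hφ : φ ≠ 0) {u : SOmega ω d}
    (h : ∀ᵐ z, stft φ u z = 0) : u = 0 := by
  refine ext' fun y => ?_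
  have h1 := integral_stft_mul_shift φ u y
  have h2 : ∫ z, stft φ u z * φ.shift z y = 0 := by
    refine integral_eq_zero_of_ae ?_
    filter_upwards [h] with z hz
    simp [hz]
  rw [h2] at h1
  have h3 : (inversionConst φ : ℂ) ≠ 0 := by exact_mod_cast (inversionConst_pos hφ).ne'
  exact (mul_eq_zero.1 h1.symm).resolve_left h3

end SOmega

/-! ### Differentiation under the integral sign to all orders. -/

/-- Evaluating the multilinear derivative on fixed vectors keeps the induction on the order among
scalar functions, where the first-order theorem on parametric integrals applies. -/
theorem iteratedFDeriv_succ_apply_eq_fderiv {E : Type*} [NormedAddCommGroup E] [NormedSpace ℝ E]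
    {f : E → ℂ} (hf : ContDiff ℝ (⊤ : ℕ∞) f) (k : ℕ) (y : E) (v : Fin (k + 1) → E) :
    iteratedFDeriv ℝ (k + 1) f y v =
      fderiv ℝ (fun y => iteratedFDeriv ℝ k f y (Fin.tail v)) y (v 0) := by
  rw [iteratedFDeriv_succ_apply_left, fderiv_continuousMultilinear_apply_const_apply]
  exact hf.differentiable_iteratedFDeriv (by exact_mod_cast WithTop.coe_lt_top k) y

section ParametricIntegral

variable {P E : Type*} [NormedAddCommGroup P] [NormedSpace ℝ P] [NormedAddCommGroup E]
  [NormedSpace ℝ E] {g : P → E → ℂ}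

theorem contDiff_slice (hg : ContDiff ℝ (⊤ : ℕ∞) (Function.uncurry g)) (z : P) :
    ContDiff ℝ (⊤ : ℕ∞) (g z) :=
  hg.comp (contDiff_const.prodMk contDiff_id)

theorem contDiff_iteratedFDeriv_apply_uncurry (hg : ContDiff ℝ (⊤ : ℕ∞) (Function.uncurry g))
    (k : ℕ) (v : Fin k → E) :
    ContDiff ℝ (⊤ : ℕ∞) (Function.uncurry fun z y => iteratedFDeriv ℝ k (g z) y v) := by
  induction k with
  | zero =>
    simp only [iteratedFDeriv_zero_apply]
    exact hg
  | succ k ih =>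
    have h : (Function.uncurry fun z y => iteratedFDeriv ℝ (k + 1) (g z) y v) =
        fun w : P × E => fderiv ℝ (fun y => iteratedFDeriv ℝ k (g w.1) y (Fin.tail v)) w.2 (v 0) := by
      ext w
      exact iteratedFDeriv_succ_apply_eq_fderiv (contDiff_slice hg w.1) k w.2 v
    rw [h]
    refine ContDiff.clm_apply (ContDiff.fderiv (m := (⊤ : ℕ∞))
      (f := fun (w : P × E) y => iteratedFDeriv ℝ k (g w.1) y (Fin.tail v)) ?_ contDiff_snd
      (by simp)) contDiff_const
    exact (ih (Fin.tail v)).comp ((contDiff_fst.comp contDiff_fst).prodMk contDiff_snd)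

variable [MeasurableSpace P] [BorelSpace P] {μ : Measure P}
  [SecondCountableTopologyEither P (E →L[ℝ] ℂ)] {F : P → ℂ}

/-- Differentiation under the integral sign to all orders. -/
theorem iteratedFDeriv_integral_mul_apply (hg : ContDiff ℝ (⊤ : ℕ∞) (Function.uncurry g))
    (hF : Continuous F) (hw : ContDiff ℝ (⊤ : ℕ∞) (fun y => ∫ z, F z * g z y ∂μ))
    (hint : ∀ k : ℕ, ∃ B : P → ℝ, Integrable B μ ∧
      ∀ z y, ‖F z‖ * ‖iteratedFDeriv ℝ k (g z) y‖ ≤ B z) (k : ℕ) (y : E) (v : Fin k → E) :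
    iteratedFDeriv ℝ k (fun y => ∫ z, F z * g z y ∂μ) y v =
      ∫ z, F z * iteratedFDeriv ℝ k (g z) y v ∂μ := by
  induction k generalizing y with
  | zero => simp
  | succ k ih =>
    have hG := contDiff_iteratedFDeriv_apply_uncurry hg k (Fin.tail v)
    have hcont (y : E) : Continuous fun z => iteratedFDeriv ℝ k (g z) y (Fin.tail v) :=
      hG.continuous.comp (continuous_id.prodMk continuous_const)
    have hcont' : Continuous fun z =>
        fderiv ℝ (fun y => iteratedFDeriv ℝ k (g z) y (Fin.tail v)) y := by
      refine (ContDiff.fderiv (m := (⊤ : ℕ∞)) (n := 0) hG contDiff_const ?_).continuous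
      simp
    obtain ⟨B, hB, hB'⟩ := hint k
    obtain ⟨B₁, hB₁, hB₁'⟩ := hint (k + 1)
    -- The derivative in direction a of the order-k derivative along the tail is the order-(k+1)
    -- derivative with a in its first slot, so the dominating function of order k+1 controls it.
    have hbound (z : P) (y : E) : ‖F z • fderiv ℝ
        (fun y => iteratedFDeriv ℝ k (g z) y (Fin.tail v)) y‖ ≤ B₁ z * ∏ i, ‖Fin.tail v i‖ := by
      rw [norm_smul]
      have h : ‖fderiv ℝ (fun y => iteratedFDeriv ℝ k (g z) y (Fin.tail v)) y‖ ≤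
          ‖iteratedFDeriv ℝ (k + 1) (g z) y‖ * ∏ i, ‖Fin.tail v i‖ := by
        refine ContinuousLinearMap.opNorm_le_bound _ (by positivity) fun a => ?_
        have := iteratedFDeriv_succ_apply_eq_fderiv (contDiff_slice hg z) k y
          (Fin.cons a (Fin.tail v))
        rw [Fin.tail_cons, Fin.cons_zero] at this
        rw [← this]
        refine (ContinuousMultilinearMap.le_opNorm _ _).trans (le_of_eq ?_)
        rw [Fin.prod_univ_succ]
        simp only [Fin.cons_zero, Fin.cons_succ]
        ring
      calc _ ≤ ‖F z‖ * (‖iteratedFDeriv ℝ (k + 1) (g z) y‖ * ∏ i, ‖Fin.tail v i‖) := by gcongr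
        _ = ‖F z‖ * ‖iteratedFDeriv ℝ (k + 1) (g z) y‖ * ∏ i, ‖Fin.tail v i‖ := by ring
        _ ≤ _ := by gcongr; exact hB₁' z y
    have hI : Integrable (fun z => F z * iteratedFDeriv ℝ k (g z) y (Fin.tail v)) μ := by
      refine (hB.mul_const (∏ i, ‖Fin.tail v i‖)).mono' (hF.mul (hcont y)).aestronglyMeasurable
        (Eventually.of_forall fun z => ?_)
      rw [norm_mul]
      calc _ ≤ ‖F z‖ * (‖iteratedFDeriv ℝ k (g z) y‖ * ∏ i, ‖Fin.tail v i‖) := by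
            gcongr
            exact ContinuousMultilinearMap.le_opNorm _ _
        _ = ‖F z‖ * ‖iteratedFDeriv ℝ k (g z) y‖ * ∏ i, ‖Fin.tail v i‖ := by ring
        _ ≤ _ := by gcongr; exact hB' z y
    have hmeas : AEStronglyMeasurable (fun z => F z •
        fderiv ℝ (fun y => iteratedFDeriv ℝ k (g z) y (Fin.tail v)) y) μ :=
      (hF.smul hcont').aestronglyMeasurable
    have hder : HasFDerivAt (fun y => ∫ z, F z * iteratedFDeriv ℝ k (g z) y (Fin.tail v) ∂μ)
        (∫ z, F z • fderiv ℝ (fun y => iteratedFDeriv ℝ k (g z) y (Fin.tail v)) y ∂μ) y := by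
      refine hasFDerivAt_integral_of_dominated_of_fderiv_le (s := univ)
        (bound := fun z => B₁ z * ∏ i, ‖Fin.tail v i‖)
        (F' := fun y z => F z • fderiv ℝ (fun y => iteratedFDeriv ℝ k (g z) y (Fin.tail v)) y)
        univ_mem (Eventually.of_forall fun y => (hF.mul (hcont y)).aestronglyMeasurable) hI hmeas
        (Eventually.of_forall fun z y _ => hbound z y) (hB₁.mul_const _)
        (Eventually.of_forall fun z y _ => ?_)
      have : Differentiable ℝ fun y => iteratedFDeriv ℝ k (g z) y (Fin.tail v) :=
        (contDiff_slice hG z).differentiable (by simp)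
      exact (this y).hasFDerivAt.const_smul (F z)
    have hfun : (fun y => iteratedFDeriv ℝ k (fun y => ∫ z, F z * g z y ∂μ) y (Fin.tail v)) =
        fun y => ∫ z, F z * iteratedFDeriv ℝ k (g z) y (Fin.tail v) ∂μ :=
      funext fun y => ih y (Fin.tail v)
    rw [iteratedFDeriv_succ_apply_eq_fderiv hw, hfun, hder.fderiv, ContinuousLinearMap.integral_apply
      ((hB₁.mul_const _).mono' hmeas (Eventually.of_forall fun z => hbound z y))]
    refine integral_congr_ae (Eventually.of_forall fun z => ?_)
    beta_reduce
    rw [iteratedFDeriv_succ_apply_eq_fderiv (contDiff_slice hg z)]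
    rfl

theorem norm_iteratedFDeriv_integral_mul_le (hg : ContDiff ℝ (⊤ : ℕ∞) (Function.uncurry g))
    (hF : Continuous F) (hw : ContDiff ℝ (⊤ : ℕ∞) (fun y => ∫ z, F z * g z y ∂μ))
    (hint : ∀ k : ℕ, ∃ B : P → ℝ, Integrable B μ ∧
      ∀ z y, ‖F z‖ * ‖iteratedFDeriv ℝ k (g z) y‖ ≤ B z) (k : ℕ) (y : E) {B : P → ℝ}
    (hB : Integrable B μ) (hB' : ∀ z, ‖F z‖ * ‖iteratedFDeriv ℝ k (g z) y‖ ≤ B z) :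
    ‖iteratedFDeriv ℝ k (fun y => ∫ z, F z * g z y ∂μ) y‖ ≤ ∫ z, B z ∂μ := by
  refine ContinuousMultilinearMap.opNorm_le_bound
    (integral_nonneg fun z => le_trans (by positivity) (hB' z)) fun v => ?_
  rw [iteratedFDeriv_integral_mul_apply hg hF hw hint, ← integral_mul_const]
  refine norm_integral_le_of_norm_le (hB.mul_const _) (Eventually.of_forall fun z => ?_)
  rw [norm_mul]
  calc _ ≤ ‖F z‖ * (‖iteratedFDeriv ℝ k (g z) y‖ * ∏ i, ‖v i‖) := by
        gcongr
        exact ContinuousMultilinearMap.le_opNorm _ _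
    _ = ‖F z‖ * ‖iteratedFDeriv ℝ k (g z) y‖ * ∏ i, ‖v i‖ := by ring
    _ ≤ _ := by gcongr; exact hB' z

end ParametricIntegral

/-! ### The seminorms of S_ω are controlled by weighted L¹ norms of the transform. -/

namespace SOmega

theorem contDiff_shift_uncurry (φ : SOmega ω d) :
    ContDiff ℝ (⊤ : ℕ∞) (Function.uncurry fun z : RSpace d × RSpace d => ⇑(φ.shift z)) := by
  have h : (Function.uncurry fun z : RSpace d × RSpace d => ⇑(φ.shift z)) =
      fun w => Complex.exp (Complex.I * (inner ℝ w.2 w.1.2 : ℝ)) * φ (w.2 - w.1.1) := by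
    ext w
    exact φ.shift_apply w.1 w.2
  rw [h]
  have h1 : ContDiff ℝ (⊤ : ℕ∞) fun w : (RSpace d × RSpace d) × RSpace d =>
      (inner ℝ w.2 w.1.2 : ℝ) := contDiff_snd.inner ℝ (contDiff_snd.comp contDiff_fst)
  exact (contDiff_const.mul (Complex.ofRealCLM.contDiff.comp h1)).cexp.mul
    (φ.contDiff.comp (contDiff_snd.sub (contDiff_fst.comp contDiff_fst)))

/-- Leibniz' rule: derivatives of the character cost powers of |ξ|, at most a multiple of e^{kω(z)},
and moving the weight from y to y-x costs e^{λω(z)}. -/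
theorem exists_norm_iteratedFDeriv_shift_le (φ : SOmega ω d) {lam : ℝ} (hlam : 0 < lam) (k : ℕ) :
    ∃ C : ℝ, 0 ≤ C ∧ ∀ z y, Real.exp (lam * ω.at y) * ‖iteratedFDeriv ℝ k (φ.shift z) y‖ ≤
      C * Real.exp ((lam + k) * ω.phase z) := by
  choose P hP using φ.bounded lam hlam
  obtain ⟨D, hD0, hD⟩ := ω.exists_one_add_norm_pow_le (d := d) k
  have hP0 i : 0 ≤ P i := le_trans (by positivity) (hP i 0)
  refine ⟨(∑ i ∈ Finset.range (k + 1), (k.choose i : ℝ) * P (k - i)) * D,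
    mul_nonneg (Finset.sum_nonneg fun i _ => mul_nonneg (Nat.cast_nonneg _) (hP0 _)) hD0.le,
    fun z y => ?_⟩
  have hs : ⇑(φ.shift z) = fun y => character z.2 y * φ (y - z.1) := funext (φ.shift_apply' z)
  have hφz : ContDiff ℝ (⊤ : ℕ∞) fun y => φ (y - z.1) :=
    φ.contDiff.comp (contDiff_id.sub contDiff_const)
  rw [hs]
  refine (mul_le_mul_of_nonneg_left (norm_iteratedFDeriv_mul_le (contDiff_character z.2) hφz y
    (n := k) (by exact_mod_cast le_top)) (Real.exp_pos _).le).trans ?_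
  rw [Finset.mul_sum, Finset.sum_mul, Finset.sum_mul]
  refine Finset.sum_le_sum fun i hi => ?_
  have h1 : ‖iteratedFDeriv ℝ i (character z.2) y‖ ≤ D * Real.exp (k * ω.phase z) := by
    refine (norm_iteratedFDeriv_character_le z.2 y i).trans ?_
    calc ‖z.2‖ ^ i ≤ (1 + ‖z.2‖) ^ i := by gcongr; linarith
      _ ≤ (1 + ‖z.2‖) ^ k := pow_le_pow_right₀ (by linarith [norm_nonneg z.2])
          (Nat.lt_succ_iff.1 (Finset.mem_range.1 hi))
      _ ≤ D * Real.exp (k * ω.at z.2) := hD z.2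
      _ ≤ _ := by gcongr; exact ω.at_snd_le_phase z
  have h2 : Real.exp (lam * ω.at y) * ‖iteratedFDeriv ℝ (k - i) (fun y => φ (y - z.1)) y‖ ≤
      Real.exp (lam * ω.phase z) * P (k - i) := by
    rw [iteratedFDeriv_comp_sub]
    have h3 : ω.at y ≤ ω.phase z + ω.at (y - z.1) := by
      have := ω.at_add_le z.1 (y - z.1)
      rw [add_sub_cancel] at this
      linarith [ω.at_fst_le_phase z]
    calc _ ≤ Real.exp (lam * ω.phase z + lam * ω.at (y - z.1)) *
          ‖iteratedFDeriv ℝ (k - i) φ (y - z.1)‖ := by gcongr; nlinarith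
      _ = Real.exp (lam * ω.phase z) * (Real.exp (lam * ω.at (y - z.1)) *
          ‖iteratedFDeriv ℝ (k - i) φ (y - z.1)‖) := by rw [Real.exp_add, mul_assoc]
      _ ≤ _ := by gcongr; exact hP _ _
  calc _ = (k.choose i : ℝ) * ‖iteratedFDeriv ℝ i (character z.2) y‖ * (Real.exp (lam * ω.at y) *
        ‖iteratedFDeriv ℝ (k - i) (fun y => φ (y - z.1)) y‖) := by ring
    _ ≤ (k.choose i : ℝ) * (D * Real.exp (k * ω.phase z)) *
        (Real.exp (lam * ω.phase z) * P (k - i)) := by gcongr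
    _ = _ := by rw [add_mul, Real.exp_add]; ring

/-- Differentiate the inversion formula c u = ∫ V_φ u(z) Π(z)φ dz under the integral and insert the
growth bound for the derivatives of Π(z)φ. -/
theorem exists_weightedSup_le {φ : SOmega ω d} (hφ : φ ≠ 0) {lam : ℝ} (hlam : 0 < lam) (k : ℕ) :
    ∃ C : ℝ, 0 ≤ C ∧ ∀ u : SOmega ω d, weightedSup ω lam k u ≤
      C * ∫ z, Real.exp ((lam + k) * ω.phase z) * ‖stft φ u z‖ := by
  have hc := inversionConst_pos hφ
  obtain ⟨C, hC0, hC⟩ := exists_norm_iteratedFDeriv_shift_le φ hlam k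
  refine ⟨(inversionConst φ)⁻¹ * C, by positivity, fun u => ciSup_le fun y => ?_⟩
  -- This also supplies the smoothness of the integral that differentiation under the integral sign
  -- presupposes.
  have hu : (fun y => ∫ z, stft φ u z * φ.shift z y) = (inversionConst φ : ℂ) • ⇑u := by
    ext y
    rw [integral_stft_mul_shift]
    rfl
  have hbd {lam : ℝ} {C : ℝ} {k : ℕ} {z : RSpace d × RSpace d} {y : RSpace d}
      (h : Real.exp (lam * ω.at y) * ‖iteratedFDeriv ℝ k (φ.shift z) y‖ ≤
        C * Real.exp ((lam + k) * ω.phase z)) :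
      ‖stft φ u z‖ * ‖iteratedFDeriv ℝ k (φ.shift z) y‖ ≤ Real.exp (-(lam * ω.at y)) *
        (C * (Real.exp ((lam + k) * ω.phase z) * ‖stft φ u z‖)) := by
    rw [Real.exp_neg, ← div_eq_inv_mul, le_div_iff₀ (Real.exp_pos _)]
    nlinarith [mul_le_mul_of_nonneg_left h (norm_nonneg (stft φ u z))]
  have hmain := norm_iteratedFDeriv_integral_mul_le (μ := volume) φ.contDiff_shift_uncurry
    (continuous_stft φ u) (by rw [hu]; exact contDiff_const.smul u.contDiff) (fun k => by
      obtain ⟨C, hC0, hC⟩ := exists_norm_iteratedFDeriv_shift_le φ one_pos k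
      refine ⟨fun z => C * (Real.exp ((1 + k) * ω.phase z) * ‖stft φ u z‖),
        (integrable_exp_mul_stft φ u _).const_mul C, fun z y => (hbd (hC z y)).trans ?_⟩
      refine mul_le_of_le_one_left (by positivity) (Real.exp_le_one_iff.2 ?_)
      simpa using ω.at_nonneg y) k y
    (((integrable_exp_mul_stft φ u _).const_mul C).const_mul _) (fun z => hbd (hC z y))
  rw [hu, iteratedFDeriv_const_smul_apply ((u.contDiff.of_le
    (by exact_mod_cast le_top)).contDiffAt), norm_smul, Complex.norm_real, Real.norm_eq_abs,
    abs_of_pos hc, integral_const_mul, integral_const_mul, Real.exp_neg, ← div_eq_inv_mul,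
    le_div_iff₀ (Real.exp_pos _)] at hmain
  rw [mul_assoc, ← div_eq_inv_mul, le_div_iff₀ hc]
  linarith

theorem hat_ne_zero {φ : SOmega ω d} (hφ : φ ≠ 0) : φ.hat ≠ 0 := by
  intro h
  refine hφ (ext' fun y => ?_)
  have h1 := integral_hatTransform_mul_character φ.toSchwartz y
  have h2 (ξ : RSpace d) : hatTransform φ.toSchwartz ξ = 0 := by
    change hatTransform φ ξ = 0
    rw [← hat_coe, h]
    rfl
  simp only [h2, zero_mul, integral_zero] at h1
  refine (mul_eq_zero.1 h1.symm).resolve_left ?_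
  exact_mod_cast (by positivity : ((2 * Real.pi) ^ d : ℝ) ≠ 0)

theorem integral_comp_swap_neg (G : RSpace d × RSpace d → ℝ) :
    ∫ z : RSpace d × RSpace d, G (z.2, -z.1) = ∫ z, G z := by
  let e : RSpace d × RSpace d ≃ₜ RSpace d × RSpace d :=
    (Homeomorph.prodComm _ _).trans ((Homeomorph.refl _).prodCongr (Homeomorph.neg _))
  have h1 : MeasurePreserving (Prod.map id (fun x : RSpace d => -x))
      (volume : Measure (RSpace d × RSpace d)) volume :=
    (MeasurePreserving.id volume).prod (Measure.measurePreserving_neg volume)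
  have h : MeasurePreserving e volume volume := h1.comp Measure.measurePreserving_swap
  exact h.integral_comp e.measurableEmbedding G

theorem integral_exp_mul_norm_stft_hat (φ u : SOmega ω d) (mu : ℝ) :
    ∫ z, Real.exp (mu * ω.phase z) * ‖stft φ.hat u.hat z‖ =
      (2 * Real.pi) ^ d * ∫ z, Real.exp (mu * ω.phase z) * ‖stft φ u z‖ := by
  rw [← integral_comp_swap_neg, ← integral_const_mul]
  congr 1
  ext z
  have h : ω.phase (z.2, -z.1) = ω.phase z := by
    simp [WeightFunction.phase, add_comm]
  rw [h, norm_stft_hat]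
  ring

/-- Seminorms of û are handled by applying the first case to û with window φ̂; the rotation of phase
space preserves both ω and Lebesgue measure. -/
theorem exists_seminorm_le {φ : SOmega ω d} (hφ : φ ≠ 0)
    (i : ({l : ℝ // 0 < l} × ℕ) ⊕ ({l : ℝ // 0 < l} × ℕ)) :
    ∃ C mu : ℝ, 0 ≤ C ∧ 0 ≤ mu ∧ ∀ u : SOmega ω d, seminormFamily ω d i u ≤
      C * ∫ z, Real.exp (mu * ω.phase z) * ‖stft φ u z‖ := by
  rcases i with ⟨lam, k⟩ | ⟨lam, k⟩
  · obtain ⟨C, hC0, hC⟩ := exists_weightedSup_le hφ lam.2 k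
    have := lam.2
    exact ⟨C, lam.1 + k, hC0, by positivity, hC⟩
  · obtain ⟨C, hC0, hC⟩ := exists_weightedSup_le (hat_ne_zero hφ) lam.2 k
    have := lam.2
    refine ⟨C * (2 * Real.pi) ^ d, lam.1 + k, by positivity, by positivity, fun u => ?_⟩
    have h := hC u.hat
    rw [integral_exp_mul_norm_stft_hat, ← mul_assoc, hat_coe] at h
    exact h

theorem exists_sup_seminorm_le {φ : SOmega ω d} (hφ : φ ≠ 0)
    (s : Finset (({l : ℝ // 0 < l} × ℕ) ⊕ ({l : ℝ // 0 < l} × ℕ))) :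
    ∃ C mu : ℝ, 0 ≤ C ∧ 0 ≤ mu ∧ ∀ u : SOmega ω d, s.sup (seminormFamily ω d) u ≤
      C * ∫ z, Real.exp (mu * ω.phase z) * ‖stft φ u z‖ := by
  classical
  induction s using Finset.induction_on with
  | empty => exact ⟨0, 0, le_rfl, le_rfl, fun u => by simp⟩
  | insert i s _ ih =>
    obtain ⟨C, mu, hC0, hmu, hC⟩ := ih
    obtain ⟨C', mu', hC0', hmu', hC'⟩ := exists_seminorm_le hφ i
    refine ⟨max C C', max mu mu', le_max_of_le_left hC0, le_max_of_le_left hmu, fun u => ?_⟩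
    have hmono {a b c c' : ℝ} (hab : a ≤ b) (hc0 : 0 ≤ c') (hcc : c ≤ c') :
        c * ∫ z, Real.exp (a * ω.phase z) * ‖stft φ u z‖ ≤
        c' * ∫ z, Real.exp (b * ω.phase z) * ‖stft φ u z‖ := by
      refine mul_le_mul hcc (integral_mono (integrable_exp_mul_stft φ u _)
        (integrable_exp_mul_stft φ u _) fun z => ?_)
        (integral_nonneg fun z => by positivity) hc0
      have := ω.phase_nonneg z
      beta_reduce
      gcongr
    rw [Finset.sup_insert, Seminorm.sup_apply]
    exact max_le ((hC' u).trans (hmono (le_max_right _ _) (le_max_of_le_left hC0) (le_max_right _ _)))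
      ((hC u).trans (hmono (le_max_left _ _) (le_max_of_le_left hC0) (le_max_left _ _)))

end SOmega

/-- A distribution in `S'_ω(ℝᵈ)` is controlled by a weighted `L¹` norm of the short-time Fourier
transform. -/
theorem OmegaDistribution.exists_norm_le {φ : SOmega ω d} (hφ : φ ≠ 0)
    (f : OmegaDistribution ω d) :
    ∃ C mu : ℝ, 0 ≤ C ∧ 0 ≤ mu ∧ ∀ u : SOmega ω d, ‖f u‖ ≤
      C * ∫ z, Real.exp (mu * ω.phase z) * ‖SOmega.stft φ u z‖ := by
  obtain ⟨s, D, _, h⟩ := Seminorm.bound_of_continuous (SOmega.withSeminorms ω d)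
    ((normSeminorm ℂ ℂ).comp f.toLinearMap) (continuous_norm.comp f.continuous)
  obtain ⟨C, mu, hC0, hmu, hC⟩ := SOmega.exists_sup_seminorm_le hφ s
  refine ⟨D * C, mu, by positivity, hmu, fun u => ?_⟩
  rw [mul_assoc]
  exact (h u).trans (mul_le_mul_of_nonneg_left (hC u) D.2)

/-! ### Distributions represented as weighted integrals against the transform. -/

namespace SOmega

theorem memLp_two_exp_mul_stft (φ u : SOmega ω d) (nu : ℝ) :
    MemLp (fun z => (Real.exp (nu * ω.phase z) : ℂ) * stft φ u z) 2 volume := by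
  have hm : Continuous fun z => (Real.exp (nu * ω.phase z) : ℂ) * stft φ u z := by
    have := ω.continuous_phase (d := d)
    have := continuous_stft φ u
    fun_prop
  rw [memLp_two_iff_integrable_sq_norm hm.aestronglyMeasurable]
  obtain ⟨C, hC, h⟩ := exists_norm_stft_le_exp φ u le_rfl
  refine ((integrable_exp_mul_stft φ u (2 * nu)).mul_const C).mono'
    (hm.norm.pow 2).aestronglyMeasurable (Eventually.of_forall fun z => ?_)
  have hz := h z
  rw [zero_mul, neg_zero, Real.exp_zero, mul_one] at hz
  rw [norm_pow, norm_norm, norm_mul, Complex.norm_real, Real.norm_eq_abs,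
    abs_of_pos (Real.exp_pos _), mul_pow, ← Real.exp_nat_mul, sq, ← mul_assoc, ← mul_assoc,
    Nat.cast_two]
  gcongr

/-- The map `u ↦ e^{νω} V_φ u` from `S_ω(ℝᵈ)` to `L²(ℝ²ᵈ)`. -/
def weightedStftL2 (φ : SOmega ω d) (nu : ℝ) :
    SOmega ω d →ₗ[ℂ] Lp ℂ 2 (volume : Measure (RSpace d × RSpace d)) where
  toFun u := (memLp_two_exp_mul_stft φ u nu).toLp
  map_add' u v := by
    rw [← MemLp.toLp_add]
    congr 1
    ext z
    rw [stft_add, Pi.add_apply, Pi.add_apply, mul_add]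
  map_smul' c u := by
    rw [RingHom.id_apply, ← MemLp.toLp_const_smul]
    congr 1
    ext z
    rw [stft_smul, Pi.smul_apply, Pi.smul_apply, smul_eq_mul, smul_eq_mul, mul_left_comm]

theorem weightedStftL2_injective {φ : SOmega ω d} (hφ : φ ≠ 0) (nu : ℝ) :
    Function.Injective (weightedStftL2 φ nu) := by
  rw [injective_iff_map_eq_zero]
  intro u hu
  have h : (fun z => (Real.exp (nu * ω.phase z) : ℂ) * stft φ u z) =ᵐ[volume] 0 := by
    refine (memLp_two_exp_mul_stft φ u nu).coeFn_toLp.symm.trans ?_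
    change ⇑(weightedStftL2 φ nu u) =ᵐ[volume] 0
    rw [hu]
    exact Lp.coeFn_zero _ _ _
  refine stft_injective hφ ?_
  filter_upwards [h] with z hz
  refine (mul_eq_zero.1 hz).resolve_left ?_
  exact_mod_cast (Real.exp_pos _).ne'

theorem memLp_two_exp_neg_phase (ω : WeightFunction) {b : ℝ} (hb : 2 * (d + 1 : ℕ) ≤ b) :
    MemLp (fun z : RSpace d × RSpace d => Real.exp (-(b * ω.phase z))) 2 volume := by
  have hm : Continuous fun z : RSpace d × RSpace d => Real.exp (-(b * ω.phase z)) := by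
    have := ω.continuous_phase (d := d)
    fun_prop
  rw [memLp_two_iff_integrable_sq hm.aestronglyMeasurable]
  have h0 : (0 : ℝ) ≤ 2 * (d + 1 : ℕ) := by positivity
  refine (ω.integrable_exp_neg_phase (d := d) (b := 2 * b) (by linarith)).congr
    (Eventually.of_forall fun z => ?_)
  beta_reduce
  rw [← Real.exp_nat_mul]
  congr 1
  push_cast
  ring

/-- Cauchy–Schwarz against e^{-bω}, which is in L² for b = 2(d+1). Trading L¹ for L² makes the Riesz
representation theorem available. -/
theorem integral_exp_mul_norm_stft_le (φ : SOmega ω d) (mu : ℝ) :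
    ∃ D : ℝ, 0 ≤ D ∧ ∀ u : SOmega ω d, ∫ z, Real.exp (mu * ω.phase z) * ‖stft φ u z‖ ≤
      D * ‖weightedStftL2 φ (mu + 2 * (d + 1 : ℕ)) u‖ := by
  set b : ℝ := 2 * (d + 1 : ℕ) with hb
  have hexp := memLp_two_exp_neg_phase (d := d) ω (b := b) le_rfl
  refine ⟨(eLpNorm (fun z : RSpace d × RSpace d => Real.exp (-(b * ω.phase z))) 2 volume).toReal,
    ENNReal.toReal_nonneg, fun u => ?_⟩
  have hu := memLp_two_exp_mul_stft φ u (mu + b)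
  change _ ≤ _ * ‖hu.toLp‖
  rw [Lp.norm_toLp, ← ENNReal.toReal_mul]
  have h1 : ∫ z, Real.exp (mu * ω.phase z) * ‖stft φ u z‖ =
      ∫ z, ‖(Real.exp (-(b * ω.phase z)) : ℂ) *
        ((Real.exp ((mu + b) * ω.phase z) : ℂ) * stft φ u z)‖ := by
    congr 1
    ext z
    rw [norm_mul, norm_mul, Complex.norm_real, Complex.norm_real, Real.norm_eq_abs,
      Real.norm_eq_abs, abs_of_pos (Real.exp_pos _), abs_of_pos (Real.exp_pos _), ← mul_assoc,
      ← Real.exp_add]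
    congr 2
    ring
  have hc := ω.continuous_phase (d := d)
  have hs := continuous_stft φ u
  rw [h1, integral_norm_eq_lintegral_enorm (Continuous.aestronglyMeasurable (by fun_prop))]
  refine ENNReal.toReal_mono (ENNReal.mul_ne_top hexp.2.ne hu.2.ne) ?_
  rw [← eLpNorm_enorm, ← eLpNorm_enorm (fun z => (Real.exp ((mu + b) * ω.phase z) : ℂ) * stft φ u z)]
  refine le_trans (le_of_eq ?_) (lintegral_mul_le_eLpNorm_mul_eLpNorm (p := 2) (q := 2)
    ⟨by simp [ENNReal.inv_two_add_inv_two]⟩ (Continuous.measurable (by fun_prop))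
    (Continuous.measurable (by fun_prop)))
  refine lintegral_congr fun z => ?_
  rw [enorm_mul, enorm_eq_nnnorm, enorm_eq_nnnorm, enorm_eq_nnnorm,
    Complex.nnnorm_real]

end SOmega

namespace OmegaDistribution

/-- Every `f ∈ S'_ω(ℝᵈ)` is of the form `u ↦ ∫ K V_φ u` with a function `K` of growth
`e^{aω}`. -/
theorem exists_representation {φ : SOmega ω d} (hφ : φ ≠ 0) (f : OmegaDistribution ω d) :
    ∃ (K : RSpace d × RSpace d → ℂ) (a : ℝ), 0 ≤ a ∧ AEStronglyMeasurable K ∧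
      Integrable (fun z => Real.exp (-(a * ω.phase z)) * ‖K z‖) ∧
      ∀ u : SOmega ω d, f u = ∫ z, SOmega.stft φ u z * K z := by
  obtain ⟨C, mu, hC0, hmu, hC⟩ := f.exists_norm_le hφ
  obtain ⟨D, hD0, hD⟩ := SOmega.integral_exp_mul_norm_stft_le φ mu
  set b : ℝ := 2 * (d + 1 : ℕ) with hb
  set T := SOmega.weightedStftL2 φ (mu + b) with hT
  -- As V_φ is injective, f becomes a functional on the range of T, bounded for the L² norm.
  -- Hahn–Banach extends it to L², and Riesz gives a density k.
  let e := LinearEquiv.ofInjective T (SOmega.weightedStftL2_injective hφ (mu + b))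
  let g₀ : StrongDual ℂ (LinearMap.range T) :=
    LinearMap.mkContinuous (f.toLinearMap ∘ₗ e.symm.toLinearMap) (C * D) fun x => by
      obtain ⟨u, rfl⟩ := e.surjective x
      change ‖f (e.symm (e u))‖ ≤ C * D * ‖T u‖
      rw [e.symm_apply_apply, mul_assoc]
      exact (hC u).trans (mul_le_mul_of_nonneg_left (hD u) hC0)
  obtain ⟨g, hg, -⟩ := exists_extension_norm_eq (LinearMap.range T) g₀
  set k := (InnerProductSpace.toDual ℂ _).symm g with hk
  have hkm : AEStronglyMeasurable k (volume : Measure (RSpace d × RSpace d)) :=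
    Lp.aestronglyMeasurable k
  have hc := ω.continuous_phase (d := d)
  -- The factor e^{(μ+b)ω} undoes the weight in T. The further b in the growth exponent leaves
  -- e^{-bω}|k|, a product of two L² functions.
  refine ⟨fun z => conj (k z) * (Real.exp ((mu + b) * ω.phase z) : ℂ), mu + b + b, by positivity,
    ?_, ?_, fun u => ?_⟩
  · exact (Complex.continuous_conj.comp_aestronglyMeasurable hkm).mul
      (Continuous.aestronglyMeasurable (by fun_prop))
  · have h := (SOmega.memLp_two_exp_neg_phase (d := d) ω (b := b) le_rfl).integrable_mul
      (q := 2) (Lp.memLp k).norm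
    refine h.congr (Eventually.of_forall fun z => ?_)
    simp only [Pi.mul_apply]
    rw [norm_mul, RCLike.norm_conj, Complex.norm_real, Real.norm_eq_abs,
      abs_of_pos (Real.exp_pos _), mul_comm ‖k z‖, ← mul_assoc, ← Real.exp_add]
    congr 2
    ring
  · have h1 : f u = g (T u) := by
      have h2 := hg (e u)
      have h3 : g₀ (e u) = f u := by
        change f (e.symm (e u)) = f u
        rw [e.symm_apply_apply]
      rw [← h3, ← h2]
      rfl
    have h4 : g (T u) = inner ℂ k (T u) := by
      rw [hk, InnerProductSpace.toDual_symm_apply]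
    rw [h1, h4, L2.inner_def]
    refine integral_congr_ae ?_
    filter_upwards [(SOmega.memLp_two_exp_mul_stft φ u (mu + b)).coeFn_toLp] with z hz
    have hz' : T u z = (Real.exp ((mu + b) * ω.phase z) : ℂ) * SOmega.stft φ u z := hz
    rw [hz', RCLike.inner_apply]
    ring

end OmegaDistribution

/-! ### Moyal's identity for distributions. -/

namespace SOmega

/-- Both sides are ∫ conj(Π(w)φ) conj(Π(z)φ). The symmetry lets Moyal's identity on S_ω be applied
in w to the kernel through which V_φ f depends on K. -/
theorem stft_conjugate_shift_comm (φ : SOmega ω d) (w z : RSpace d × RSpace d) :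
    stft φ (φ.shift w).conjugate z = stft φ (φ.shift z).conjugate w := by
  unfold stft
  congr 1
  ext y
  rw [conjugate_apply, conjugate_apply, mul_comm]

theorem stft_conjugate_shift (φ : SOmega ω d) (w z : RSpace d × RSpace d) :
    stft φ (φ.shift w).conjugate z =
      character (-w.2 - z.2) w.1 * stft φ φ.conjugate (z - (w.1, -w.2)) := by
  rw [conjugate_shift, stft_shift]

theorem inversionConst_mul_stft_conjugate (φ u : SOmega ω d) (z : RSpace d × RSpace d) :
    inversionConst φ * stft φ u.conjugate z =
      ∫ w, stft φ (φ.shift w).conjugate z * conj (stft φ u w) := by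
  simp_rw [stft_conjugate_shift_comm φ _ z]
  rw [integral_stft_mul_conj_stft, stft]
  congr 2
  ext y
  rw [conjugate_apply, conjugate_apply, mul_comm]

end SOmega

namespace OmegaDistribution

/-- Moyal's identity for `f ∈ S'_ω(ℝᵈ)` and `u ∈ S_ω(ℝᵈ)`. -/
theorem integrable_and_integral_stft_mul_conj {φ : SOmega ω d} (hφ : φ ≠ 0)
    (f : OmegaDistribution ω d) (u : SOmega ω d) :
    Integrable (fun w => stft φ f w * conj (SOmega.stft φ u w)) ∧
    ∫ w, stft φ f w * conj (SOmega.stft φ u w) = SOmega.inversionConst φ * f u.conjugate := by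
  obtain ⟨K, a, ha, hKm, hK, hf⟩ := f.exists_representation hφ
  obtain ⟨C, hC0, hC⟩ := SOmega.exists_norm_stft_le_exp φ φ.conjugate ha
  have hkern : Continuous fun v : (RSpace d × RSpace d) × (RSpace d × RSpace d) =>
      SOmega.stft φ (φ.shift v.1).conjugate v.2 := by
    simp only [SOmega.stft_conjugate_shift]
    exact (continuous_character_uncurry.comp (by fun_prop :
      Continuous fun v : (RSpace d × RSpace d) × (RSpace d × RSpace d) =>
        (-v.1.2 - v.2.2, v.1.1))).mul ((SOmega.continuous_stft φ φ.conjugate).comp (by fun_prop))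
  have hbound (w z : RSpace d × RSpace d) : ‖SOmega.stft φ (φ.shift w).conjugate z‖ ≤
      C * (Real.exp (a * ω.phase w) * Real.exp (-(a * ω.phase z))) := by
    rw [SOmega.stft_conjugate_shift, norm_mul, norm_character, one_mul]
    refine (hC _).trans (mul_le_mul_of_nonneg_left ?_ hC0)
    rw [← Real.exp_add]
    refine Real.exp_le_exp.2 ?_
    have h1 := ω.phase_le_add_sub (w.1, -w.2) z
    have h2 : ω.phase (w.1, -w.2) = ω.phase w := by simp [WeightFunction.phase]
    rw [h2] at h1
    nlinarith
  -- The kernel is at most C e^{aω(w)} e^{-aω(z)}: the rapid decay of V_φ u absorbs the growth in w,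
  -- and the decay in z is what integrability against K requires.
  have hint : Integrable (fun v : (RSpace d × RSpace d) × (RSpace d × RSpace d) =>
      SOmega.stft φ (φ.shift v.1).conjugate v.2 * K v.2 * conj (SOmega.stft φ u v.1))
      (volume.prod volume) := by
    refine (((SOmega.integrable_exp_mul_stft φ u a).mul_prod hK).const_mul C).mono' ?_
      (Eventually.of_forall fun v => ?_)
    · refine (hkern.aestronglyMeasurable.mul hKm.comp_snd).mul ?_
      exact (Complex.continuous_conj.comp ((SOmega.continuous_stft φ u).comp
        continuous_fst)).aestronglyMeasurable
    · rw [norm_mul, norm_mul, RCLike.norm_conj]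
      calc _ ≤ C * (Real.exp (a * ω.phase v.1) * Real.exp (-(a * ω.phase v.2))) * ‖K v.2‖ *
            ‖SOmega.stft φ u v.1‖ := by gcongr; exact hbound _ _
        _ = _ := by ring
  have h1 (w : RSpace d × RSpace d) : stft φ f w * conj (SOmega.stft φ u w) =
      ∫ z, SOmega.stft φ (φ.shift w).conjugate z * K z * conj (SOmega.stft φ u w) := by
    rw [integral_mul_const, ← hf]
    rfl
  simp_rw [h1]
  refine ⟨hint.integral_prod_left, ?_⟩
  rw [integral_integral_swap hint, hf, ← integral_const_mul]
  congr 1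
  ext z
  rw [← mul_assoc, SOmega.inversionConst_mul_stft_conjugate, ← integral_mul_const]
  congr 1
  ext w
  ring

end OmegaDistribution

/-! ### Weighted Hölder inequality and the embedding of S_ω in the modulation spaces. -/

/-- A mixed norm that is finite and dominates, after scaling, the `L^{p,q}_{m_λ}` norms of rapidly
decaying functions. -/
def decayNorm (ω : WeightFunction) (d : ℕ) (p q : ℝ≥0∞) : ℝ≥0∞ :=
  mixedENorm p q volume volume (fun z : RSpace d × RSpace d =>
    ENNReal.ofReal (Real.exp (-((2 * (d + 1 : ℕ) : ℝ) * ω.phase z))))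

theorem decayNorm_ne_top (ω : WeightFunction) (d : ℕ) (p q : ℝ≥0∞) [hp : Fact (1 ≤ p)]
    [hq : Fact (1 ≤ q)] : decayNorm ω d p q ≠ ∞ :=
  ω.mixedENorm_exp_neg_phase_ne_top le_rfl hp.out hq.out

/-- The share |λ| of the decay pays for the weight; the share 2(d+1) remains and has finite mixed
norm for all exponents. -/
theorem enorm_mul_expWeight_le {lam D : ℝ} (hD : 0 ≤ D) {F : RSpace d × RSpace d → ℂ}
    {z : RSpace d × RSpace d}
    (h : ‖F z‖ ≤ D * Real.exp (-((|lam| + 2 * (d + 1 : ℕ)) * ω.phase z))) :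
    ‖F z‖ₑ * ‖expWeight ω lam z‖ₑ ≤ ENNReal.ofReal D *
      ENNReal.ofReal (Real.exp (-((2 * (d + 1 : ℕ) : ℝ) * ω.phase z))) := by
  rw [← ofReal_norm, ← ofReal_norm, ← ENNReal.ofReal_mul (norm_nonneg _),
    ← ENNReal.ofReal_mul hD, ω.expWeight_eq, Real.norm_eq_abs, abs_of_pos (Real.exp_pos _)]
  refine ENNReal.ofReal_le_ofReal ?_
  refine (mul_le_mul_of_nonneg_right h (Real.exp_pos _).le).trans ?_
  rw [mul_assoc, ← Real.exp_add]
  refine mul_le_mul_of_nonneg_left (Real.exp_le_exp.2 ?_) hD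
  nlinarith [mul_le_mul_of_nonneg_right (le_abs_self lam) (ω.phase_nonneg z)]

theorem measurable_exp_neg_phase (ω : WeightFunction) (d : ℕ) (b : ℝ) :
    Measurable (fun z : RSpace d × RSpace d => ENNReal.ofReal (Real.exp (-(b * ω.phase z)))) := by
  have := (ω.continuous_phase (d := d)).measurable
  fun_prop

theorem mixedNorm_le_of_decay (p q : ℝ≥0∞) [hp : Fact (1 ≤ p)] [hq : Fact (1 ≤ q)] {lam D : ℝ}
    (hD : 0 ≤ D) {F : RSpace d × RSpace d → ℂ}
    (h : ∀ z, ‖F z‖ ≤ D * Real.exp (-((|lam| + 2 * (d + 1 : ℕ)) * ω.phase z))) :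
    mixedNorm p q (expWeight ω lam) F ≤ ENNReal.ofReal D * decayNorm ω d p q := by
  rw [mixedNorm_eq_mixedENorm, decayNorm,
    ← mixedENorm_const_mul hp.out hq.out (measurable_exp_neg_phase ω d _)]
  exact mixedENorm_mono fun z => enorm_mul_expWeight_le hD (h z)

theorem lintegral_enorm_mul_le_mixedNorm {p q p' q' : ℝ≥0∞} (hp : p.HolderConjugate p')
    (hq : q.HolderConjugate q') {lam : ℝ} {F G : RSpace d × RSpace d → ℂ} (hF : Measurable F)
    (hG : Measurable G) :
    ∫⁻ z, ‖F z * G z‖ₑ ≤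
      mixedNorm p q (expWeight ω lam) F * mixedNorm p' q' (expWeight ω (-lam)) G := by
  rw [mixedNorm_eq_mixedENorm, mixedNorm_eq_mixedENorm]
  refine le_trans (le_of_eq ?_) (lintegral_mul_le_mixedENorm_mul hp hq
    (hF.enorm.mul (measurable_expWeight ω lam).enorm)
    (hG.enorm.mul (measurable_expWeight ω (-lam)).enorm))
  refine lintegral_congr fun z => ?_
  have h : ‖expWeight ω lam z‖ₑ * ‖expWeight ω (-lam) z‖ₑ = 1 := by
    rw [← enorm_mul, ω.expWeight_eq, ω.expWeight_eq, ← Real.exp_add]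
    simp
  rw [mul_mul_mul_comm, h, mul_one, enorm_mul]

namespace SOmega

theorem weightedSup_conjugate (u : SOmega ω d) (lam : ℝ) :
    weightedSup ω lam 0 u.conjugate = weightedSup ω lam 0 u := by
  simp [weightedSup]

theorem weightedSup_hatTransform_conjugate (u : SOmega ω d) {lam : ℝ} (hlam : 0 < lam) :
    weightedSup ω lam 0 (hatTransform u.conjugate) ≤ weightedSup ω lam 0 (hatTransform u) := by
  have h : ⇑u.conjugate = fun x => conj (u x) := funext u.conjugate_apply
  rw [h, hatTransform_conj]
  refine ciSup_le fun x => ?_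
  rw [norm_iteratedFDeriv_zero, RCLike.norm_conj, ← ω.at_neg x,
    ← norm_iteratedFDeriv_zero (𝕜 := ℝ) (f := hatTransform u)]
  exact le_weightedSup hlam 0 u.bounded_hat (-x)

/-- The sum of the two seminorms of order zero. -/
def seminormSum (lam : ℝ) (u : SOmega ω d) : ℝ :=
  weightedSup ω lam 0 u + weightedSup ω lam 0 (hatTransform u)

theorem seminormSum_nonneg (lam : ℝ) (u : SOmega ω d) : 0 ≤ seminormSum lam u :=
  add_nonneg (weightedSup_nonneg _ _ _) (weightedSup_nonneg _ _ _)

theorem seminormSum_conjugate_le {lam : ℝ} (hlam : 0 < lam) (u : SOmega ω d) :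
    seminormSum lam u.conjugate ≤ seminormSum lam u :=
  add_le_add (weightedSup_conjugate u lam).le (weightedSup_hatTransform_conjugate u hlam)

theorem continuous_of_seminormSum_bound (L : SOmega ω d →ₗ[ℂ] ℂ) {C lam : ℝ} (hlam : 0 < lam)
    (hC : 0 ≤ C) (h : ∀ u, ‖L u‖ ≤ C * seminormSum lam u) : Continuous L := by
  classical
  -- The supremum of two seminorms is their maximum, hence the factor 2 in front of C.
  refine WithSeminorms.continuous_normedSpace_rng ℂ (SOmega.withSeminorms ω d) L
    ⟨{Sum.inl (⟨lam, hlam⟩, 0), Sum.inr (⟨lam, hlam⟩, 0)}, ⟨2 * C, by positivity⟩, fun u => ?_⟩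
  rw [Finset.sup_insert, Finset.sup_singleton]
  change ‖L u‖ ≤ 2 * C * max (weightedSup ω lam 0 u) (weightedSup ω lam 0 (hatTransform u))
  refine (h u).trans ?_
  unfold seminormSum
  nlinarith [mul_le_mul_of_nonneg_left (le_max_left (weightedSup ω lam 0 u)
    (weightedSup ω lam 0 (hatTransform u))) hC, mul_le_mul_of_nonneg_left (le_max_right
    (weightedSup ω lam 0 u) (weightedSup ω lam 0 (hatTransform u))) hC]

theorem exists_mixedNorm_stft_le (φ : SOmega ω d) (p q : ℝ≥0∞) [Fact (1 ≤ p)] [Fact (1 ≤ q)]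
    (lam : ℝ) : ∃ C l : ℝ, 0 ≤ C ∧ 0 < l ∧ ∀ u : SOmega ω d,
      mixedNorm p q (expWeight ω lam) (stft φ u) ≤ ENNReal.ofReal (C * seminormSum l u) := by
  obtain ⟨C, hC0, hC⟩ := exists_norm_stft_le φ (mu := |lam| + 2 * (d + 1 : ℕ)) (by positivity)
  refine ⟨C * (decayNorm ω d p q).toReal, _, by positivity,
    (by positivity : 0 < 2 * (|lam| + 2 * (d + 1 : ℕ)) + ((d + 1 : ℕ) : ℝ)), fun u => ?_⟩
  refine (mixedNorm_le_of_decay p q (mul_nonneg hC0 (seminormSum_nonneg _ u)) (hC u)).trans ?_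
  rw [mul_right_comm, ENNReal.ofReal_mul (mul_nonneg hC0 (seminormSum_nonneg _ u)),
    ENNReal.ofReal_toReal (decayNorm_ne_top ω d p q)]

theorem toDistribution_mem (φ g : SOmega ω d) (p q : ℝ≥0∞) [Fact (1 ≤ p)] [Fact (1 ≤ q)]
    (lam : ℝ) : g.toDistribution ∈ modulationSubmodule φ p q lam := by
  have h : OmegaDistribution.stft φ g.toDistribution = stft φ g :=
    funext (stft_toDistribution φ g)
  change MemMixed _ _ _ _
  rw [h]
  obtain ⟨C, l, -, -, hC⟩ := exists_mixedNorm_stft_le φ p q lam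
  exact ⟨(continuous_stft φ g).measurable, (hC g).trans_lt ENNReal.ofReal_lt_top⟩

end SOmega

/-! ### Continuous embedding in S'_ω, completeness, continuity of the orbit. -/

namespace ModulationSpace

variable {φ : SOmega ω d} {p q p' q' : ℝ≥0∞} [hp1 : Fact (1 ≤ p)] [hq1 : Fact (1 ≤ q)]
  [hp1' : Fact (1 ≤ p')] [hq1' : Fact (1 ≤ q')] {lam : ℝ}

/-- The inclusion `S_ω ⊂ M^{p,q}_{m_λ}`. -/
def ofSOmega (φ : SOmega ω d) (p q : ℝ≥0∞) [Fact (1 ≤ p)] [Fact (1 ≤ q)] (lam : ℝ) :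
    SOmega ω d →ₗ[ℂ] ModulationSpace φ p q lam where
  toFun u := ⟨u.toDistribution, SOmega.toDistribution_mem φ u p q lam⟩
  map_add' u v := Subtype.ext (ContinuousLinearMap.ext fun g => by
    change ∫ y, (u y + v y) * g y = (∫ y, u y * g y) + ∫ y, v y * g y
    rw [← integral_add (u.integrable_mul g) (v.integrable_mul g)]
    simp_rw [add_mul])
  map_smul' c u := Subtype.ext (ContinuousLinearMap.ext fun g => by
    change ∫ y, (c * u y) * g y = c * ∫ y, u y * g y
    rw [← integral_const_mul]
    simp_rw [mul_assoc])

theorem stft_ofSOmega (u : SOmega ω d) :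
    (ofSOmega φ p q lam u).stft = SOmega.stft φ u :=
  funext (SOmega.stft_toDistribution φ u)

theorem exists_norm_ofSOmega_le (φ : SOmega ω d) (p q : ℝ≥0∞) [Fact (1 ≤ p)] [Fact (1 ≤ q)]
    (lam : ℝ) : ∃ C l : ℝ, 0 ≤ C ∧ 0 < l ∧ ∀ u : SOmega ω d,
      ‖ofSOmega φ p q lam u‖ ≤ C * SOmega.seminormSum l u := by
  obtain ⟨C, l, hC0, hl, hC⟩ := SOmega.exists_mixedNorm_stft_le φ p q lam
  refine ⟨C, l, hC0, hl, fun u => ?_⟩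
  rw [norm_def, stft_ofSOmega]
  exact ENNReal.toReal_le_of_le_ofReal (mul_nonneg hC0 (SOmega.seminormSum_nonneg l u)) (hC u)

theorem stft_add (f g : ModulationSpace φ p q lam) : (f + g).stft = f.stft + g.stft := rfl

theorem stft_sub (f g : ModulationSpace φ p q lam) : (f - g).stft = f.stft - g.stft := rfl

theorem stft_smul (c : ℂ) (f : ModulationSpace φ p q lam) : (c • f).stft = c • f.stft := rfl

theorem lintegral_enorm_stft_mul_conj_le (hpp' : p.HolderConjugate p')
    (hqq' : q.HolderConjugate q') (f : ModulationSpace φ p q lam)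
    (h : ModulationSpace φ p' q' (-lam)) :
    ∫⁻ z, ‖f.stft z * conj (h.stft z)‖ₑ ≤ ENNReal.ofReal (‖f‖ * ‖h‖) := by
  have hconj : Measurable fun z => conj (h.stft z) :=
    Complex.continuous_conj.measurable.comp h.memMixed.1
  refine (lintegral_enorm_mul_le_mixedNorm hpp' hqq' (ω := ω) (lam := lam) f.memMixed.1
    hconj).trans (le_of_eq ?_)
  have h1 : mixedNorm p' q' (expWeight ω (-lam)) (fun z => conj (h.stft z)) =
      mixedNorm p' q' (expWeight ω (-lam)) h.stft := by
    rw [mixedNorm_eq_mixedENorm, mixedNorm_eq_mixedENorm]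
    congr 1
    ext z
    rw [← ofReal_norm, RCLike.norm_conj, ofReal_norm]
  rw [h1, norm_def, norm_def, ENNReal.ofReal_mul ENNReal.toReal_nonneg,
    ENNReal.ofReal_toReal f.memMixed.2.ne, ENNReal.ofReal_toReal h.memMixed.2.ne]

theorem integrable_stft_mul_conj (hpp' : p.HolderConjugate p')
    (hqq' : q.HolderConjugate q') (f : ModulationSpace φ p q lam)
    (h : ModulationSpace φ p' q' (-lam)) :
    Integrable (fun z => f.stft z * conj (h.stft z)) :=
  ⟨(f.memMixed.1.mul (Complex.continuous_conj.measurable.comp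
    h.memMixed.1)).aestronglyMeasurable,
    (lintegral_enorm_stft_mul_conj_le hpp' hqq' f h).trans_lt ENNReal.ofReal_lt_top⟩

theorem norm_integral_stft_mul_conj_le (hpp' : p.HolderConjugate p')
    (hqq' : q.HolderConjugate q') (f : ModulationSpace φ p q lam)
    (h : ModulationSpace φ p' q' (-lam)) :
    ‖∫ z, f.stft z * conj (h.stft z)‖ ≤ ‖f‖ * ‖h‖ := by
  refine (norm_integral_le_integral_norm _).trans ?_
  rw [integral_norm_eq_lintegral_enorm
    (integrable_stft_mul_conj hpp' hqq' f h).aestronglyMeasurable]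
  exact ENNReal.toReal_le_of_le_ofReal (by positivity)
    (lintegral_enorm_stft_mul_conj_le hpp' hqq' f h)

/-- By Moyal c f(u) = ∫ V_φ f conj(V_φ ū), and Hölder pairs f with ū in M^{p',q'}_{1/m}. So norm
convergence implies convergence in S'_ω, and evaluations at elements of S_ω are continuous
functionals. -/
theorem exists_norm_apply_le (hφ : φ ≠ 0) (hpp' : p.HolderConjugate p')
    (hqq' : q.HolderConjugate q') (lam : ℝ) : ∃ C l : ℝ, 0 ≤ C ∧ 0 < l ∧
      ∀ (f : ModulationSpace φ p q lam) (u : SOmega ω d),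
        ‖f.toDistribution u‖ ≤ C * SOmega.seminormSum l u * ‖f‖ := by
  have hc := SOmega.inversionConst_pos hφ
  obtain ⟨C, l, hC0, hl, hC⟩ := exists_norm_ofSOmega_le φ p' q' (-lam)
  refine ⟨(SOmega.inversionConst φ)⁻¹ * C, l, by positivity, hl, fun f u => ?_⟩
  have h := norm_integral_stft_mul_conj_le hpp' hqq' f (ofSOmega φ p' q' (-lam) u.conjugate)
  have h1 := (OmegaDistribution.integrable_and_integral_stft_mul_conj hφ f.toDistribution
    u.conjugate).2
  rw [u.conjugate_conjugate] at h1
  rw [stft_ofSOmega] at h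
  change ‖∫ z, OmegaDistribution.stft φ f.toDistribution z * _‖ ≤ _ at h
  rw [h1, norm_mul, Complex.norm_real, Real.norm_eq_abs, abs_of_pos hc, mul_comm,
    ← le_div_iff₀ hc] at h
  refine h.trans ?_
  rw [div_eq_inv_mul, mul_assoc, mul_assoc, mul_comm ‖f‖, ← mul_assoc C]
  refine mul_le_mul_of_nonneg_left (mul_le_mul_of_nonneg_right ((hC _).trans ?_) (norm_nonneg _))
    (by positivity)
  exact mul_le_mul_of_nonneg_left (SOmega.seminormSum_conjugate_le hl u) hC0

/-- Evaluation of `f ∈ M^{p,q}_{m_λ}` at `u ∈ S_ω` as a continuous linear functional. -/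
def evalCLM (hφ : φ ≠ 0) (hpp' : p.HolderConjugate p') (hqq' : q.HolderConjugate q')
    (u : SOmega ω d) : StrongDual ℂ (ModulationSpace φ p q lam) :=
  LinearMap.mkContinuousOfExistsBound
    { toFun := fun f => f.toDistribution u
      map_add' := fun _ _ => rfl
      map_smul' := fun _ _ => rfl }
    (by
      obtain ⟨C, l, -, -, h⟩ := exists_norm_apply_le hφ hpp' hqq' lam
      exact ⟨_, fun f => h f u⟩)

theorem evalCLM_apply (hφ : φ ≠ 0) (hpp' : p.HolderConjugate p') (hqq' : q.HolderConjugate q')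
    (u : SOmega ω d) (f : ModulationSpace φ p q lam) :
    evalCLM hφ hpp' hqq' u f = f.toDistribution u := rfl

theorem stft_apply (f : ModulationSpace φ p q lam) (z : RSpace d × RSpace d) :
    f.stft z = f.toDistribution (φ.shift z).conjugate := rfl

theorem toDistribution_ext {f g : ModulationSpace φ p q lam}
    (h : ∀ u, f.toDistribution u = g.toDistribution u) : f = g :=
  Subtype.ext (ContinuousLinearMap.ext h)

/-- A Cauchy sequence converges pointwise on S_ω. Its norms are bounded, so the limit is again a
distribution; the transforms converge pointwise, and Fatou upgrades this to norm convergence. -/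
theorem completeSpace (hφ : φ ≠ 0) (hpp' : p.HolderConjugate p')
    (hqq' : q.HolderConjugate q') : CompleteSpace (ModulationSpace φ p q lam) := by
  obtain ⟨C, l, hC0, hl, hC⟩ := exists_norm_apply_le hφ hpp' hqq' lam
  refine Metric.complete_of_cauchySeq_tendsto fun F hF => ?_
  have hcau (u : SOmega ω d) : CauchySeq fun n => (F n).toDistribution u :=
    hF.map (evalCLM hφ hpp' hqq' u).uniformContinuous
  choose L hL using fun u => cauchySeq_tendsto_of_complete (hcau u)
  obtain ⟨R, hR⟩ := hF.norm_bddAbove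
  have hRn n : ‖F n‖ ≤ R := hR (mem_range_self n)
  let L' : SOmega ω d →ₗ[ℂ] ℂ := linearMapOfTendsto L
    (fun n => (F n).toDistribution.toLinearMap) (tendsto_pi_nhds.2 hL)
  have hL' : Continuous L' := by
    refine SOmega.continuous_of_seminormSum_bound L' (C := C * R) hl
      (mul_nonneg hC0 ((norm_nonneg _).trans (hRn 0))) fun u => ?_
    refine le_of_tendsto (hL u).norm (Eventually.of_forall fun n => (hC (F n) u).trans ?_)
    rw [mul_right_comm]
    gcongr
    · exact SOmega.seminormSum_nonneg l u
    · exact hRn n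
  let f₀ : OmegaDistribution ω d := ⟨L', hL'⟩
  have hlim (z : RSpace d × RSpace d) :
      Tendsto (fun n => (F n).stft z) atTop (𝓝 (OmegaDistribution.stft φ f₀ z)) := hL _
  have hmeas : Measurable (OmegaDistribution.stft φ f₀) :=
    measurable_of_tendsto_metrizable (fun n => (F n).memMixed.1) (tendsto_pi_nhds.2 hlim)
  have hp0 : p ≠ 0 := (zero_lt_one.trans_le hp1.out).ne'
  have hq0 : q ≠ 0 := (zero_lt_one.trans_le hq1.out).ne'
  have hclose (ε : ℝ) (hε : 0 < ε) : ∃ N, ∀ n ≥ N, mixedNorm p q (expWeight ω lam)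
      (OmegaDistribution.stft φ f₀ - (F n).stft) ≤ ENNReal.ofReal ε := by
    obtain ⟨N, hN⟩ := Metric.cauchySeq_iff.1 hF ε hε
    refine ⟨N, fun n hn => ?_⟩
    rw [mixedNorm_eq_mixedENorm]
    refine mixedENorm_le_of_le_liminf hp0 hq0
      (g := fun m z => ‖((F m).stft - (F n).stft) z‖ₑ * ‖expWeight ω lam z‖ₑ) (fun m => ?_)
      (fun z => le_of_eq (Tendsto.liminf_eq ?_).symm) ?_
    · exact ((F m).memMixed.1.sub (F n).memMixed.1).enorm.mul (measurable_expWeight ω lam).enorm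
    · refine ENNReal.Tendsto.mul_const ?_ (Or.inr enorm_ne_top)
      exact ((hlim z).sub_const _).enorm
    · filter_upwards [eventually_ge_atTop N] with m hm
      rw [← mixedNorm_eq_mixedENorm, ← stft_sub, ← ENNReal.ofReal_toReal (F m - F n).memMixed.2.ne,
        ← norm_def, ← dist_eq_norm]
      exact ENNReal.ofReal_le_ofReal (hN m hm n hn).le
  have hmem : f₀ ∈ modulationSubmodule φ p q lam := by
    refine ⟨hmeas, ?_⟩
    obtain ⟨N, hN⟩ := hclose 1 one_pos
    have h1 : OmegaDistribution.stft φ f₀ =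
        (OmegaDistribution.stft φ f₀ - (F N).stft) + (F N).stft := by abel
    rw [h1]
    refine (mixedNorm_add_le p q (measurable_expWeight ω lam) (hmeas.sub (F N).memMixed.1)
      (F N).memMixed.1).trans_lt (ENNReal.add_lt_top.2 ⟨?_, (F N).memMixed.2⟩)
    exact (hN N le_rfl).trans_lt ENNReal.ofReal_lt_top
  let f : ModulationSpace φ p q lam := ⟨f₀, hmem⟩
  refine ⟨f, Metric.tendsto_atTop.2 fun ε hε => ?_⟩
  obtain ⟨N, hN⟩ := hclose (ε / 2) (by positivity)
  refine ⟨N, fun n hn => ?_⟩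
  rw [dist_comm, dist_eq_norm, norm_def, stft_sub]
  exact (ENNReal.toReal_le_of_le_ofReal (by positivity) (hN n hn)).trans_lt (half_lt_self hε)

theorem exists_norm_stft_shift_le (φ : SOmega ω d) {mu : ℝ} (hmu : 0 ≤ mu) :
    ∃ C : ℝ, 0 ≤ C ∧ ∀ z w, ‖SOmega.stft φ (φ.shift z) w‖ ≤
      C * Real.exp (mu * ω.phase z) * Real.exp (-(mu * ω.phase w)) := by
  obtain ⟨C, hC0, hC⟩ := SOmega.exists_norm_stft_le_exp φ φ hmu
  refine ⟨C, hC0, fun z w => ?_⟩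
  rw [SOmega.norm_stft_shift, mul_assoc, ← Real.exp_add]
  refine (hC _).trans (mul_le_mul_of_nonneg_left (Real.exp_le_exp.2 ?_) hC0)
  nlinarith [mul_le_mul_of_nonneg_left (ω.phase_le_add_sub z w) hmu]

theorem continuous_stft_shift_uncurry (φ : SOmega ω d) :
    Continuous (fun v : (RSpace d × RSpace d) × (RSpace d × RSpace d) =>
      SOmega.stft φ (φ.shift v.1) v.2) := by
  simp only [SOmega.stft_shift]
  exact (continuous_character_uncurry.comp (by fun_prop :
    Continuous fun v : (RSpace d × RSpace d) × (RSpace d × RSpace d) =>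
      (v.1.2 - v.2.2, v.1.1))).mul ((SOmega.continuous_stft φ φ).comp (by fun_prop))

/-- The orbit `z ↦ Π(z)φ` is continuous in `M^{p,q}_{m_λ}`. -/
theorem continuous_ofSOmega_shift (hp : p ≠ ∞) (hq : q ≠ ∞) :
    Continuous (fun z => ofSOmega φ p q lam (φ.shift z)) := by
  refine continuous_iff_continuousAt.2 fun z₀ => ?_
  rw [ContinuousAt, tendsto_iff_norm_sub_tendsto_zero]
  have hp0 : p ≠ 0 := (zero_lt_one.trans_le hp1.out).ne'
  have hq0 : q ≠ 0 := (zero_lt_one.trans_le hq1.out).ne'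
  obtain ⟨C, hC0, hC⟩ := exists_norm_stft_shift_le φ (mu := |lam| + 2 * (d + 1 : ℕ))
    (by positivity)
  set mu : ℝ := |lam| + 2 * (d + 1 : ℕ) with hmu
  have hmu0 : 0 ≤ mu := by positivity
  -- The dominating constant is uniform over the neighbourhood of z₀ on which ω(z) < ω(z₀) + 1.
  set D : ℝ := C * Real.exp (mu * (ω.phase z₀ + 1)) + C * Real.exp (mu * ω.phase z₀) with hD
  have hslice z : Continuous (SOmega.stft φ (φ.shift z)) := SOmega.continuous_stft _ _
  have h : Tendsto (fun z => mixedENorm p q volume volume fun w =>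
      ‖SOmega.stft φ (φ.shift z) w - SOmega.stft φ (φ.shift z₀) w‖ₑ * ‖expWeight ω lam w‖ₑ)
      (𝓝 z₀) (𝓝 0) := by
    refine tendsto_mixedENorm_zero_of_dominated hp0 hp hq0 hq
      (G := fun w => ENNReal.ofReal D *
        ENNReal.ofReal (Real.exp (-((2 * (d + 1 : ℕ) : ℝ) * ω.phase w)))) (fun z => ?_)
      ((measurable_exp_neg_phase ω d _).const_mul _) ?_ ?_ (fun w => ?_)
    · exact ((hslice z).sub (hslice z₀)).measurable.enorm.mul (measurable_expWeight ω lam).enorm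
    · have h1 : ∀ᶠ z in 𝓝 z₀, ω.phase z < ω.phase z₀ + 1 :=
        (ω.continuous_phase.tendsto z₀).eventually_lt_const (by linarith)
      filter_upwards [h1] with z hz w
      refine enorm_mul_expWeight_le
        (F := fun w => SOmega.stft φ (φ.shift z) w - SOmega.stft φ (φ.shift z₀) w)
        (by positivity) ?_
      refine (norm_sub_le _ _).trans ?_
      rw [hD, add_mul]
      refine add_le_add ((hC z w).trans ?_) (hC z₀ w)
      have : Real.exp (mu * ω.phase z) ≤ Real.exp (mu * (ω.phase z₀ + 1)) :=
        Real.exp_le_exp.2 (mul_le_mul_of_nonneg_left hz.le hmu0)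
      gcongr
    · rw [mixedENorm_const_mul hp1.out hq1.out (measurable_exp_neg_phase ω d _)]
      exact ENNReal.mul_ne_top ENNReal.ofReal_ne_top (decayNorm_ne_top ω d p q)
    · have h2 : Tendsto (fun z => SOmega.stft φ (φ.shift z) w - SOmega.stft φ (φ.shift z₀) w)
          (𝓝 z₀) (𝓝 (SOmega.stft φ (φ.shift z₀) w - SOmega.stft φ (φ.shift z₀) w)) :=
        (((continuous_stft_shift_uncurry φ).comp
          (continuous_id.prodMk continuous_const)).tendsto z₀).sub_const _
      have h3 := ENNReal.Tendsto.mul_const (b := ‖expWeight ω lam w‖ₑ) h2.enorm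
        (Or.inr enorm_ne_top)
      simpa using h3
  have h4 := (ENNReal.tendsto_toReal ENNReal.zero_ne_top).comp h
  rw [ENNReal.toReal_zero] at h4
  refine h4.congr fun z => ?_
  rw [norm_def, stft_sub, stft_ofSOmega, stft_ofSOmega, mixedNorm_eq_mixedENorm]
  rfl

end ModulationSpace

/-! ### Young's inequality and weak vector-valued integrals. -/

theorem mixedENorm_comp_sub_right {p q : ℝ≥0∞} {f : RSpace d × RSpace d → ℝ≥0∞} (hf : Measurable f)
    (a : RSpace d × RSpace d) :
    mixedENorm p q volume volume (fun w => f (w - a)) = mixedENorm p q volume volume f := by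
  unfold mixedENorm
  have h (ξ : RSpace d) : eLpNorm (fun x => f ((x, ξ) - a)) p volume =
      eLpNorm (fun x => f (x, ξ - a.2)) p volume :=
    eLpNorm_comp_measurePreserving (g := fun x => f (x, ξ - a.2))
      (hf.comp measurable_prodMk_right).aestronglyMeasurable (measurePreserving_sub_right volume a.1)
  simp_rw [h]
  exact eLpNorm_comp_measurePreserving (measurable_slice hf).aestronglyMeasurable
    (measurePreserving_sub_right volume a.2)

/-- Young's inequality for the convolution with `|V_φ φ|`. -/
theorem exists_mixedENorm_convolution_le (φ : SOmega ω d) {p q : ℝ≥0∞} (hp1 : 1 ≤ p) (hp : p ≠ ∞)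
    (hq1 : 1 ≤ q) (hq : q ≠ ∞) (lam : ℝ) :
    ∃ C : ℝ≥0∞, C ≠ ∞ ∧ ∀ F : RSpace d × RSpace d → ℂ, Measurable F →
      mixedENorm p q volume volume (fun w => (∫⁻ z, ‖F z‖ₑ * ‖SOmega.stft φ φ (w - z)‖ₑ) *
        ‖expWeight ω lam w‖ₑ) ≤ C * mixedNorm p q (expWeight ω lam) F := by
  -- The constant is the L¹ norm of V_φ φ with weight e^{|λ|ω}: moderateness moves the weight onto
  -- the translate of F, after which Minkowski and translation invariance finish.
  refine ⟨∫⁻ z, ‖Real.exp (|lam| * ω.phase z) * ‖SOmega.stft φ φ z‖‖ₑ,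
    (SOmega.integrable_exp_mul_stft φ φ |lam|).2.ne, fun F hF => ?_⟩
  have hS : Measurable (SOmega.stft φ φ) := (SOmega.continuous_stft φ φ).measurable
  have hΩ := (ω.continuous_phase (d := d)).measurable
  have hm := measurable_expWeight (d := d) ω lam
  have hG : Measurable fun z => ‖F z‖ₑ * ‖expWeight ω lam z‖ₑ := hF.enorm.mul hm.enorm
  have hk : Measurable fun z => ‖Real.exp (|lam| * ω.phase z) * ‖SOmega.stft φ φ z‖‖ₑ := by
    fun_prop
  have hle (w : RSpace d × RSpace d) :
      (∫⁻ z, ‖F z‖ₑ * ‖SOmega.stft φ φ (w - z)‖ₑ) * ‖expWeight ω lam w‖ₑ ≤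
      ∫⁻ z, ‖Real.exp (|lam| * ω.phase z) * ‖SOmega.stft φ φ z‖‖ₑ *
        (‖F (w - z)‖ₑ * ‖expWeight ω lam (w - z)‖ₑ) := by
    have hmp : MeasurePreserving (fun z => w - z) (volume : Measure (RSpace d × RSpace d)) volume :=
      (Measure.measurePreserving_sub_left volume w.1).prod
        (Measure.measurePreserving_sub_left volume w.2)
    rw [← hmp.lintegral_comp (by fun_prop), ← lintegral_mul_const]
    · refine lintegral_mono fun z => ?_
      rw [sub_sub_cancel, enorm_mul, enorm_norm]
      have h : ‖expWeight ω lam w‖ₑ ≤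
          ‖Real.exp (|lam| * ω.phase z)‖ₑ * ‖expWeight ω lam (w - z)‖ₑ := by
        rw [← enorm_mul, ← ofReal_norm, ← ofReal_norm]
        refine ENNReal.ofReal_le_ofReal ?_
        rw [Real.norm_eq_abs, Real.norm_eq_abs, abs_of_pos (by rw [ω.expWeight_eq]; positivity),
          abs_of_pos (by rw [ω.expWeight_eq]; positivity)]
        exact ω.expWeight_le lam z w
      calc _ ≤ ‖F (w - z)‖ₑ * ‖SOmega.stft φ φ z‖ₑ *
            (‖Real.exp (|lam| * ω.phase z)‖ₑ * ‖expWeight ω lam (w - z)‖ₑ) := by gcongr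
        _ = _ := by ring
    · simp only [sub_sub_cancel]
      exact (hF.comp (measurable_const.sub measurable_id)).enorm.mul hS.enorm
  refine (mixedENorm_mono hle).trans ((mixedENorm_lintegral_le hp1 hp hq1 hq
    (f := fun w z => ‖Real.exp (|lam| * ω.phase z) * ‖SOmega.stft φ φ z‖‖ₑ *
        (‖F (w - z)‖ₑ * ‖expWeight ω lam (w - z)‖ₑ)) ?_).trans ?_)
  · exact (hk.comp measurable_snd).mul (hG.comp (measurable_fst.sub measurable_snd))
  · rw [← lintegral_mul_const _ hk]
    refine lintegral_mono fun z => ?_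
    have hGz : Measurable fun w => ‖F (w - z)‖ₑ * ‖expWeight ω lam (w - z)‖ₑ :=
      hG.comp (measurable_id.sub_const z)
    rw [mixedENorm_const_mul hp1 hq1 hGz,
      mixedENorm_comp_sub_right (f := fun z => ‖F z‖ₑ * ‖expWeight ω lam z‖ₑ) hG,
      ← mixedNorm_eq_mixedENorm]

/-- In a complete seminormed space, absolutely convergent integrals exist in the weak sense. -/
theorem exists_weak_integral {P M : Type*} [TopologicalSpace P] [SecondCountableTopology P]
    [MeasurableSpace P] [OpensMeasurableSpace P] {μ : Measure P} [SeminormedAddCommGroup M]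
    [NormedSpace ℂ M] [CompleteSpace M] {F : P → ℂ} (hF : AEStronglyMeasurable F μ) {G : P → M}
    (hG : Continuous G) (hint : Integrable (fun z => ‖F z‖ * ‖G z‖) μ) :
    ∃ g : M, ∀ l : StrongDual ℂ M, l g = ∫ z, F z * l (G z) ∂μ := by
  -- The space is only known to be seminormed, so the Bochner integral is formed in the Hausdorff
  -- quotient; continuous functionals factor through it, and any lift of the integral will do.
  let T : P → SeparationQuotient M := fun z => F z • SeparationQuotient.mk (G z)
  have hT : Integrable T μ := by
    refine hint.mono' (hF.smul
      (SeparationQuotient.continuous_mk.comp hG).aestronglyMeasurable) ?_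
    refine Eventually.of_forall fun z => ?_
    rw [norm_smul, SeparationQuotient.norm_mk]
  obtain ⟨g, hg⟩ := SeparationQuotient.surjective_mk (∫ z, T z ∂μ)
  refine ⟨g, fun l => ?_⟩
  have hl : ∀ x y, Inseparable x y → l x = l y := fun x y h => (h.map l.continuous).eq
  have h1 : l g = SeparationQuotient.liftCLM l hl (SeparationQuotient.mk g) := rfl
  rw [h1, hg, ← ContinuousLinearMap.integral_comp_comm _ hT]
  refine integral_congr_ae (Eventually.of_forall fun z => ?_)
  simp only [T, map_smul, smul_eq_mul]
  rfl

/-! ### The synthesis operator and norm convergence of the inversion formula. -/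

namespace ModulationSpace

variable {φ : SOmega ω d} {p q p' q' : ℝ≥0∞} [hp1 : Fact (1 ≤ p)] [hq1 : Fact (1 ≤ q)]
  [hp1' : Fact (1 ≤ p')] [hq1' : Fact (1 ≤ q')] {lam : ℝ}

theorem mixedNorm_indicator_ne_top (p q : ℝ≥0∞) [Fact (1 ≤ p)] [Fact (1 ≤ q)] (ω : WeightFunction)
    (lam : ℝ) {K : Set (RSpace d × RSpace d)} (hK : IsCompact K) :
    mixedNorm p q (expWeight ω lam) (K.indicator fun _ => 1) ≠ ∞ := by
  obtain ⟨D, hD⟩ := hK.exists_bound_of_continuousOn (f := fun z : RSpace d × RSpace d =>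
    Real.exp ((|lam| + 2 * (d + 1 : ℕ)) * ω.phase z)) (by
      have := ω.continuous_phase (d := d)
      fun_prop)
  refine ne_top_of_le_ne_top ?_ (mixedNorm_le_of_decay p q (le_max_right D 0) fun z => ?_)
  · exact ENNReal.mul_ne_top ENNReal.ofReal_ne_top (decayNorm_ne_top ω d p q)
  · by_cases hz : z ∈ K
    · rw [indicator_of_mem hz, norm_one, Real.exp_neg, ← div_eq_mul_inv,
        one_le_div (Real.exp_pos _)]
      exact (le_abs_self _).trans ((hD z hz).trans (le_max_left _ _))
    · rw [indicator_of_notMem hz, norm_zero]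
      positivity

theorem integrable_of_mixedNorm (hpp' : p.HolderConjugate p') (hqq' : q.HolderConjugate q')
    {K : Set (RSpace d × RSpace d)} (hK : IsCompact K) {F : RSpace d × RSpace d → ℂ}
    (hF : Measurable F) (hF0 : ∀ z ∉ K, F z = 0)
    (hFn : mixedNorm p q (expWeight ω lam) F ≠ ∞) : Integrable F := by
  refine ⟨hF.aestronglyMeasurable, ?_⟩
  have h := lintegral_enorm_mul_le_mixedNorm hpp' hqq' (ω := ω) (lam := lam) hF
    (measurable_const.indicator hK.measurableSet : Measurable (K.indicator fun _ => (1 : ℂ)))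
  refine lt_of_le_of_lt (le_of_eq (lintegral_congr fun z => ?_)) (h.trans_lt (ENNReal.mul_lt_top
    hFn.lt_top (mixedNorm_indicator_ne_top p' q' ω (-lam) hK).lt_top))
  by_cases hz : z ∈ K
  · rw [indicator_of_mem hz, mul_one]
  · rw [hF0 z hz, zero_mul]

theorem integrable_norm_mul_norm (hp : p ≠ ∞) (hq : q ≠ ∞) {K : Set (RSpace d × RSpace d)}
    (hK : IsCompact K) {F : RSpace d × RSpace d → ℂ} (hF : Integrable F)
    (hF0 : ∀ z ∉ K, F z = 0) :
    Integrable (fun z => ‖F z‖ * ‖ofSOmega φ p q lam (φ.shift z)‖) := by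
  have hcont := continuous_ofSOmega_shift (φ := φ) (lam := lam) hp hq
  obtain ⟨B, hB⟩ := hK.exists_bound_of_continuousOn (f := fun z => ofSOmega φ p q lam (φ.shift z))
    hcont.continuousOn
  refine (hF.norm.mul_const B).mono' (hF.norm.aestronglyMeasurable.mul
    hcont.norm.aestronglyMeasurable) (Eventually.of_forall fun z => ?_)
  rw [norm_mul, norm_norm, norm_norm]
  by_cases hz : z ∈ K
  · gcongr
    exact hB z hz
  · simp [hF0 z hz]

/-- By covariance |V_φ(Π(z)φ)(w)| = |V_φ φ(w-z)|, so |V_φ g| is at most |F| * |V_φ φ| and the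
convolution bound applies. No support condition on F enters, which allows its use for tails. -/
theorem norm_le_of_stft_le {C : ℝ≥0∞} (hC : C ≠ ∞)
    (hY : ∀ F : RSpace d × RSpace d → ℂ, Measurable F →
      mixedENorm p q volume volume (fun w => (∫⁻ z, ‖F z‖ₑ * ‖SOmega.stft φ φ (w - z)‖ₑ) *
        ‖expWeight ω lam w‖ₑ) ≤ C * mixedNorm p q (expWeight ω lam) F)
    {F : RSpace d × RSpace d → ℂ} (hF : Measurable F)
    (hFn : mixedNorm p q (expWeight ω lam) F ≠ ∞) {g : ModulationSpace φ p q lam}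
    (hg : ∀ w, g.stft w = ∫ z, F z * SOmega.stft φ (φ.shift z) w) :
    ‖g‖ ≤ C.toReal * (mixedNorm p q (expWeight ω lam) F).toReal := by
  rw [norm_def, ← ENNReal.toReal_mul]
  refine ENNReal.toReal_mono (ENNReal.mul_ne_top hC hFn) (le_trans ?_ (hY F hF))
  rw [mixedNorm_eq_mixedENorm]
  refine mixedENorm_mono fun w => ?_
  gcongr
  rw [hg]
  refine (enorm_integral_le_lintegral_enorm _).trans (le_of_eq (lintegral_congr fun z => ?_))
  rw [enorm_mul]
  congr 1
  rw [← ofReal_norm, SOmega.norm_stft_shift, ofReal_norm]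

/-- The synthesis operator `F ↦ ∫ F(z) Π(z)φ dz`, in the weak sense, on functions with compact
support, and its boundedness. -/
theorem exists_synthesis (hφ : φ ≠ 0) (hp : p ≠ ∞) (hq : q ≠ ∞) (hpp' : p.HolderConjugate p')
    (hqq' : q.HolderConjugate q') {C : ℝ≥0∞} (hC : C ≠ ∞)
    (hY : ∀ F : RSpace d × RSpace d → ℂ, Measurable F →
      mixedENorm p q volume volume (fun w => (∫⁻ z, ‖F z‖ₑ * ‖SOmega.stft φ φ (w - z)‖ₑ) *
        ‖expWeight ω lam w‖ₑ) ≤ C * mixedNorm p q (expWeight ω lam) F)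
    {K : Set (RSpace d × RSpace d)} (hK : IsCompact K) {F : RSpace d × RSpace d → ℂ}
    (hF : Measurable F) (hF0 : ∀ z ∉ K, F z = 0)
    (hFn : mixedNorm p q (expWeight ω lam) F ≠ ∞) :
    ∃ g : ModulationSpace φ p q lam,
      (∀ l : StrongDual ℂ (ModulationSpace φ p q lam),
        l g = ∫ z, F z * l (ofSOmega φ p q lam (φ.shift z))) ∧
      (∀ w, g.stft w = ∫ z, F z * SOmega.stft φ (φ.shift z) w) ∧
      ‖g‖ ≤ C.toReal * (mixedNorm p q (expWeight ω lam) F).toReal := by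
  have := completeSpace (φ := φ) (lam := lam) hφ hpp' hqq'
  obtain ⟨g, hg⟩ := exists_weak_integral hF.aestronglyMeasurable
    (continuous_ofSOmega_shift (φ := φ) (lam := lam) hp hq) (integrable_norm_mul_norm hp hq hK
      (integrable_of_mixedNorm hpp' hqq' hK hF hF0 hFn) hF0)
  have hgs (w : RSpace d × RSpace d) : g.stft w = ∫ z, F z * SOmega.stft φ (φ.shift z) w := by
    -- Evaluation at the conjugate of Π(w)φ is the functional g ↦ V_φ g(w).
    have h := hg (evalCLM hφ hpp' hqq' (φ.shift w).conjugate)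
    rw [evalCLM_apply, ← stft_apply] at h
    rw [h]
    simp_rw [evalCLM_apply, ← stft_apply, stft_ofSOmega]
  exact ⟨g, hg, hgs, norm_le_of_stft_le hC hY hF hFn hgs⟩

theorem mixedNorm_indicator_le (K : Set (RSpace d × RSpace d)) (F : RSpace d × RSpace d → ℂ)
    (m : RSpace d × RSpace d → ℝ) : mixedNorm p q m (K.indicator F) ≤ mixedNorm p q m F := by
  rw [mixedNorm_eq_mixedENorm, mixedNorm_eq_mixedENorm]
  refine mixedENorm_mono fun z => ?_
  gcongr
  rw [← ofReal_norm, ← ofReal_norm]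
  exact ENNReal.ofReal_le_ofReal (norm_indicator_le_norm_self F z)

/-- Functionals on `M^{p,q}_{m_λ}` are determined by their values on the orbit of the window. -/
theorem tendsto_setIntegral_stft_mul (hφ : φ ≠ 0) (hp : p ≠ ∞) (hq : q ≠ ∞)
    (hpp' : p.HolderConjugate p') (hqq' : q.HolderConjugate q') (f : ModulationSpace φ p q lam)
    (l : StrongDual ℂ (ModulationSpace φ p q lam)) :
    Tendsto (fun n : ℕ => ∫ z in Metric.closedBall 0 n,
      f.stft z * l (ofSOmega φ p q lam (φ.shift z))) atTop (𝓝 (SOmega.inversionConst φ * l f)) := by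
  obtain ⟨C, hC, hY⟩ := exists_mixedENorm_convolution_le φ hp1.out hp hq1.out hq lam
  have hp0 : p ≠ 0 := (zero_lt_one.trans_le hp1.out).ne'
  have hq0 : q ≠ 0 := (zero_lt_one.trans_le hq1.out).ne'
  set K : ℕ → Set (RSpace d × RSpace d) := fun n => Metric.closedBall 0 n with hK
  have hKm n : MeasurableSet (K n) := Metric.isClosed_closedBall.measurableSet
  have hfm : Measurable f.stft := f.memMixed.1
  have hfn (S : Set (RSpace d × RSpace d)) :
      mixedNorm p q (expWeight ω lam) (S.indicator f.stft) ≠ ∞ :=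
    ne_top_of_le_ne_top f.memMixed.2.ne (mixedNorm_indicator_le _ _ _)
  have hind {S : Set (RSpace d × RSpace d)} (hS : MeasurableSet S) (G : RSpace d × RSpace d → ℂ) :
      ∫ z, S.indicator f.stft z * G z = ∫ z in S, f.stft z * G z := by
    rw [← integral_indicator hS]
    exact integral_congr_ae (Eventually.of_forall fun z => (indicator_mul_left S f.stft G).symm)
  choose g hgl hgs _ using fun n : ℕ => exists_synthesis hφ hp hq hpp' hqq' hC hY
    (isCompact_closedBall (0 : RSpace d × RSpace d) (n : ℝ)) (hfm.indicator (hKm n))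
    (fun z hz => indicator_of_notMem hz _) (hfn (K n))
  -- Moyal with u = Π(w)φ is the reproducing formula for c V_φ f(w). Removing the ball leaves the
  -- integral of the tail, so c f - g_n behaves as the synthesis of the tail of V_φ f.
  have hdiff (n : ℕ) : ‖(SOmega.inversionConst φ : ℂ) • f - g n‖ ≤ C.toReal *
      (mixedNorm p q (expWeight ω lam) ((K n)ᶜ.indicator f.stft)).toReal := by
    refine norm_le_of_stft_le hC hY (hfm.indicator (hKm n).compl) (hfn _) fun w => ?_
    obtain ⟨h1, h2⟩ := OmegaDistribution.integrable_and_integral_stft_mul_conj hφ f.toDistribution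
      (φ.shift w)
    change Integrable (fun z => f.stft z * _) at h1
    change ∫ z, f.stft z * _ = _ at h2
    simp_rw [SOmega.conj_stft_shift] at h1 h2
    rw [stft_sub, stft_smul, Pi.sub_apply, Pi.smul_apply, hgs, smul_eq_mul, stft_apply, ← h2]
    rw [hind (hKm n), hind (hKm n).compl, ← integral_add_compl (hKm n) h1]
    ring
  -- This is where finite exponents are indispensable: tails need not vanish in an L^∞ norm.
  have hlim : Tendsto (fun n => mixedNorm p q (expWeight ω lam) ((K n)ᶜ.indicator f.stft)) atTop
      (𝓝 0) := by
    simp_rw [mixedNorm_eq_mixedENorm]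
    refine tendsto_mixedENorm_zero_of_dominated hp0 hp hq0 hq
      (G := fun z => ‖f.stft z‖ₑ * ‖expWeight ω lam z‖ₑ) (fun n => ?_)
      (hfm.enorm.mul (measurable_expWeight ω lam).enorm) (Eventually.of_forall fun n z => ?_) ?_
      (fun z => ?_)
    · exact (hfm.indicator (hKm n).compl).enorm.mul (measurable_expWeight ω lam).enorm
    · gcongr
      rw [← ofReal_norm, ← ofReal_norm]
      exact ENNReal.ofReal_le_ofReal (norm_indicator_le_norm_self _ z)
    · rw [← mixedNorm_eq_mixedENorm]
      exact f.memMixed.2.ne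
    · refine tendsto_const_nhds.congr' ?_
      obtain ⟨N, hN⟩ := exists_nat_ge ‖z‖
      filter_upwards [eventually_ge_atTop N] with n hn
      have : z ∉ (K n)ᶜ := by
        rw [notMem_compl_iff, hK, mem_closedBall_zero_iff]
        exact hN.trans (by exact_mod_cast hn)
      rw [indicator_of_notMem this]
      simp
  have hlim' := (ENNReal.tendsto_toReal ENNReal.zero_ne_top).comp hlim
  have h0 : Tendsto (fun n => (SOmega.inversionConst φ : ℂ) • f - g n) atTop (𝓝 0) := by
    refine squeeze_zero_norm hdiff ?_
    simpa using hlim'.const_mul C.toReal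
  have h1 := (l.continuous.tendsto 0).comp h0
  rw [map_zero] at h1
  have h2 := h1.const_sub ((SOmega.inversionConst φ : ℂ) * l f)
  rw [sub_zero] at h2
  refine h2.congr fun n => ?_
  simp only [Function.comp_apply, map_sub, map_smul, smul_eq_mul, sub_sub_cancel]
  rw [hgl, hind (hKm n)]

end ModulationSpace

theorem continuous_expWeight (ω : WeightFunction) (lam : ℝ) :
    Continuous (fun z : RSpace d × RSpace d => expWeight ω lam z) :=
  Real.continuous_exp.comp (continuous_const.mul (ω.continuous_phase (d := d)))

/-! ### Orbit coefficients of functionals, density and duality. -/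

namespace ModulationSpace

variable {φ : SOmega ω d} {p q p' q' : ℝ≥0∞} [hp1 : Fact (1 ≤ p)] [hq1 : Fact (1 ≤ q)]
  [hp1' : Fact (1 ≤ p')] [hq1' : Fact (1 ≤ q')] {lam : ℝ}

/-- The test function k is converted into an element g of the modulation space with ‖g‖ ≤ C whose
value l(g) is exactly the integral to be bounded. -/
theorem lintegral_mul_enorm_orbit_le (hφ : φ ≠ 0) (hp : p ≠ ∞) (hq : q ≠ ∞)
    (hpp' : p.HolderConjugate p') (hqq' : q.HolderConjugate q') {C : ℝ≥0∞} (hC : C ≠ ∞)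
    (hY : ∀ F : RSpace d × RSpace d → ℂ, Measurable F →
      mixedENorm p q volume volume (fun w => (∫⁻ z, ‖F z‖ₑ * ‖SOmega.stft φ φ (w - z)‖ₑ) *
        ‖expWeight ω lam w‖ₑ) ≤ C * mixedNorm p q (expWeight ω lam) F)
    (l : StrongDual ℂ (ModulationSpace φ p q lam)) {K : Set (RSpace d × RSpace d)}
    (hK : IsCompact K) {k : RSpace d × RSpace d → ℝ≥0∞} (hk : Measurable k) (hkt : ∀ z, k z ≠ ∞)
    (hk0 : ∀ z ∉ K, k z = 0) (hk1 : mixedENorm p q volume volume k ≤ 1) :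
    ∫⁻ z, k z * (‖l (ofSOmega φ p q lam (φ.shift z))‖ₑ * ‖expWeight ω (-lam) z‖ₑ) ≤
      ENNReal.ofReal (C.toReal * ‖l‖) := by
  have hcont := continuous_ofSOmega_shift (φ := φ) (lam := lam) hp hq
  set L : RSpace d × RSpace d → ℂ := fun z => l (ofSOmega φ p q lam (φ.shift z)) with hL
  have hLm : Measurable L := (l.continuous.comp hcont).measurable
  have hw := measurable_expWeight (d := d) ω (-lam)
  -- The phase conj(L)/|L| makes F·L = k |L| / m, and 1/m normalises F in L^{p,q}_m. Where L
  -- vanishes the quotient is 0, and F·L = 0 there in any case.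
  set F : RSpace d × RSpace d → ℂ := fun z =>
    (((k z).toReal * expWeight ω (-lam) z : ℝ) : ℂ) * (conj (L z) / (‖L z‖ : ℝ)) with hF
  have hFm : Measurable F := by
    have h1 : Measurable fun z => conj (L z) := Complex.continuous_conj.measurable.comp hLm
    have h2 : Measurable fun z => (((k z).toReal * expWeight ω (-lam) z : ℝ) : ℂ) :=
      Complex.measurable_ofReal.comp (hk.ennreal_toReal.mul hw)
    exact h2.mul (h1.div (Complex.measurable_ofReal.comp hLm.norm))
  have hF0 (z) (hz : z ∉ K) : F z = 0 := by simp [hF, hk0 z hz]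
  have hpos (mu : ℝ) (z : RSpace d × RSpace d) : 0 < expWeight ω mu z := Real.exp_pos _
  have hFle (z) : ‖F z‖ ≤ (k z).toReal * expWeight ω (-lam) z := by
    simp only [hF]
    rw [norm_mul, Complex.norm_of_nonneg (mul_nonneg ENNReal.toReal_nonneg (hpos _ _).le),
      norm_div, RCLike.norm_conj, Complex.norm_of_nonneg (norm_nonneg _)]
    exact mul_le_of_le_one_right (mul_nonneg ENNReal.toReal_nonneg (hpos _ _).le) (div_self_le_one _)
  have hFn : mixedNorm p q (expWeight ω lam) F ≤ 1 := by
    rw [mixedNorm_eq_mixedENorm]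
    refine (mixedENorm_mono fun z => ?_).trans hk1
    rw [← ofReal_norm, ← ofReal_norm, ← ENNReal.ofReal_mul (norm_nonneg _),
      Real.norm_of_nonneg (hpos _ _).le]
    refine ENNReal.ofReal_le_of_le_toReal ((mul_le_mul_of_nonneg_right (hFle z)
      (hpos lam z).le).trans (le_of_eq ?_))
    rw [expWeight_neg, mul_assoc, one_div_mul_cancel (hpos _ _).ne', mul_one]
  have hFt : mixedNorm p q (expWeight ω lam) F ≠ ∞ := ne_top_of_le_ne_top ENNReal.one_ne_top hFn
  obtain ⟨g, hg, -, hgn⟩ := exists_synthesis hφ hp hq hpp' hqq' hC hY hK hFm hF0 hFt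
  have hg1 : ‖g‖ ≤ C.toReal :=
    hgn.trans (mul_le_of_le_one_right ENNReal.toReal_nonneg
      (ENNReal.toReal_le_of_le_ofReal zero_le_one (by simpa using hFn)))
  set r : RSpace d × RSpace d → ℝ := fun z => (k z).toReal * expWeight ω (-lam) z * ‖L z‖ with hr
  have hFL (z) : F z * L z = (r z : ℂ) := by
    rcases eq_or_ne (L z) 0 with h0 | h0
    · simp [hr, h0]
    · have h1 : (‖L z‖ : ℂ) ≠ 0 := by simpa using h0
      have h2 := Complex.conj_mul' (L z)
      simp only [hF, hr]
      push_cast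
      field_simp
      rw [mul_assoc, h2]
  have hr0 (z) : 0 ≤ r z :=
    mul_nonneg (mul_nonneg ENNReal.toReal_nonneg (hpos _ _).le) (norm_nonneg _)
  have hri : Integrable r := by
    refine ((integrable_norm_mul_norm (φ := φ) (lam := lam) hp hq hK
      (integrable_of_mixedNorm hpp' hqq' hK hFm hF0 hFt) hF0).mul_const ‖l‖).mono'
      ((hk.ennreal_toReal.mul hw).mul hLm.norm).aestronglyMeasurable
      (Eventually.of_forall fun z => ?_)
    rw [Real.norm_of_nonneg (hr0 z)]
    have h1 := congrArg norm (hFL z)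
    rw [Complex.norm_of_nonneg (hr0 z), norm_mul] at h1
    rw [← h1, mul_assoc]
    gcongr
    rw [mul_comm]
    exact l.le_opNorm _
  have hlg : l g = ((∫ z, r z : ℝ) : ℂ) := by
    rw [hg, ← integral_complex_ofReal]
    exact integral_congr_ae (Eventually.of_forall hFL)
  calc _ = ∫⁻ z, ENNReal.ofReal (r z) := by
        refine lintegral_congr fun z => ?_
        simp only [hr]
        rw [mul_assoc (k z).toReal, ENNReal.ofReal_mul ENNReal.toReal_nonneg, ENNReal.ofReal_toReal (hkt z),
          ENNReal.ofReal_mul (hpos _ _).le, ← ofReal_norm, ← ofReal_norm,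
          Real.norm_of_nonneg (hpos _ _).le, mul_comm (ENNReal.ofReal ‖_‖)]
    _ = ENNReal.ofReal (∫ z, r z) :=
        (ofReal_integral_eq_lintegral_ofReal hri (Eventually.of_forall hr0)).symm
    _ ≤ _ := by
        refine ENNReal.ofReal_le_ofReal ?_
        have h1 : ∫ z, r z = ‖l g‖ := by
          rw [hlg, Complex.norm_of_nonneg (integral_nonneg hr0)]
        rw [h1, mul_comm]
        exact (l.le_opNorm g).trans (by gcongr)

/-- The matrix coefficients of a continuous functional on `M^{p,q}_{m_λ}` along the orbit of the
window belong to `L^{p',q'}_{1/m_λ}`. -/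
theorem exists_mixedNorm_orbit_le (hφ : φ ≠ 0) (hp : p ≠ ∞) (hq : q ≠ ∞)
    (hpp' : p.HolderConjugate p') (hqq' : q.HolderConjugate q') (lam : ℝ) :
    ∃ C : ℝ, 0 ≤ C ∧ ∀ l : StrongDual ℂ (ModulationSpace φ p q lam),
      mixedNorm p' q' (expWeight ω (-lam)) (fun z => l (ofSOmega φ p q lam (φ.shift z))) ≤
        ENNReal.ofReal (C * ‖l‖) := by
  obtain ⟨C, hC, hY⟩ := exists_mixedENorm_convolution_le φ hp1.out hp hq1.out hq lam
  refine ⟨C.toReal, ENNReal.toReal_nonneg, fun l => ?_⟩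
  have hL : Continuous fun z => l (ofSOmega φ p q lam (φ.shift z)) :=
    l.continuous.comp (continuous_ofSOmega_shift hp hq)
  -- Balls of the product are boxes because its norm is the maximum norm.
  have hprod (n : ℕ) : Metric.closedBall (0 : RSpace d) n ×ˢ Metric.closedBall (0 : RSpace d) n =
      Metric.closedBall (0 : RSpace d × RSpace d) n := closedBall_prod_same _ _ _
  rw [mixedNorm_eq_mixedENorm]
  refine mixedENorm_le_of_forall_lintegral_le hpp' hqq' hp hq
    (S := fun n : ℕ => Metric.closedBall (0 : RSpace d) n)
    (T := fun n : ℕ => Metric.closedBall (0 : RSpace d) n)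
    (fun n => Metric.isClosed_closedBall.measurableSet)
    (fun n => Metric.isClosed_closedBall.measurableSet)
    (fun n => measure_closedBall_lt_top.ne) (fun n => measure_closedBall_lt_top.ne) (fun z => ?_)
    (hL.measurable.enorm.mul (measurable_expWeight ω (-lam)).enorm) (fun n => ?_)
    (fun n k hk hkt hk0 hk1 => ?_)
  · obtain ⟨N, hN⟩ := exists_nat_ge ‖z‖
    filter_upwards [eventually_ge_atTop N] with n hn
    rw [hprod, mem_closedBall_zero_iff]
    exact hN.trans (by exact_mod_cast hn)
  · rw [hprod]
    obtain ⟨B, hB⟩ := (isCompact_closedBall (0 : RSpace d × RSpace d) (n : ℝ)).exists_bound_of_continuousOn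
      (f := fun z => l (ofSOmega φ p q lam (φ.shift z)) * (expWeight ω (-lam) z : ℂ))
      (hL.mul (Complex.continuous_ofReal.comp (continuous_expWeight ω (-lam)))).continuousOn
    refine ⟨ENNReal.ofReal B, ENNReal.ofReal_ne_top, fun z hz => ?_⟩
    rw [Pi.mul_apply, ← ofReal_norm, ← ofReal_norm, ← ENNReal.ofReal_mul (norm_nonneg _)]
    have h := hB z hz
    rw [norm_mul, Complex.norm_real] at h
    exact ENNReal.ofReal_le_ofReal h
  · rw [hprod] at hk0
    exact lintegral_mul_enorm_orbit_le hφ hp hq hpp' hqq' hC hY l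
      (isCompact_closedBall (0 : RSpace d × RSpace d) (n : ℝ)) hk hkt hk0 hk1

theorem functional_ext (hφ : φ ≠ 0) (hp : p ≠ ∞) (hq : q ≠ ∞)
    (hpp' : p.HolderConjugate p') (hqq' : q.HolderConjugate q')
    {l : StrongDual ℂ (ModulationSpace φ p q lam)}
    (hl : ∀ z, l (ofSOmega φ p q lam (φ.shift z)) = 0) : l = 0 := by
  ext f
  have h := tendsto_setIntegral_stft_mul hφ hp hq hpp' hqq' f l
  simp_rw [hl, mul_zero, integral_zero] at h
  have h0 := tendsto_nhds_unique h tendsto_const_nhds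
  exact (mul_eq_zero.1 h0).resolve_left
    (Complex.ofReal_ne_zero.2 (SOmega.inversionConst_pos hφ).ne')

theorem dense_range_ofSOmega (hφ : φ ≠ 0) (hp : p ≠ ∞) (hq : q ≠ ∞)
    (hpp' : p.HolderConjugate p') (hqq' : q.HolderConjugate q') :
    Dense (range (ofSOmega φ p q lam)) := by
  set R : Submodule ℂ (ModulationSpace φ p q lam) :=
    (LinearMap.range (ofSOmega φ p q lam)).topologicalClosure with hR
  have hsub : range (ofSOmega φ p q lam) ⊆ R :=
    (LinearMap.range (ofSOmega φ p q lam)).le_topologicalClosure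
  have hclos : IsClosed (R : Set (ModulationSpace φ p q lam)) :=
    Submodule.isClosed_topologicalClosure _
  intro f
  by_contra hf
  obtain ⟨l, u, hlu, hl⟩ := RCLike.geometric_hahn_banach_point_closed (𝕜 := ℂ) (x := f)
    (R.restrictScalars ℝ).convex hclos hf
  have hl0 : ∀ b ∈ R, l b = 0 := by
    intro b hb
    by_contra h0
    -- A functional bounded below by u on a subspace vanishes there: otherwise a rescaling of b
    -- takes the value u - 1.
    have h1 := hl ((((u - 1 : ℝ) : ℂ) * (l b)⁻¹) • b) (R.smul_mem _ hb)
    rw [map_smul, smul_eq_mul, inv_mul_cancel_right₀ h0] at h1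
    simp at h1
    linarith
  have h0 : l = 0 := functional_ext hφ hp hq hpp' hqq' fun z =>
    hl0 _ (hsub (mem_range_self _))
  have h1 := hl 0 R.zero_mem
  simp [h0] at hlu h1
  linarith

/-- The functional `f ↦ ∫ V_φ f \overline{V_φ h}`. -/
def pairing (hpp' : p.HolderConjugate p') (hqq' : q.HolderConjugate q')
    (h : ModulationSpace φ p' q' (-lam)) : StrongDual ℂ (ModulationSpace φ p q lam) :=
  LinearMap.mkContinuous
    { toFun := fun f => ∫ z, f.stft z * conj (h.stft z)
      map_add' := fun f g => by
        rw [← integral_add (integrable_stft_mul_conj hpp' hqq' f h)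
          (integrable_stft_mul_conj hpp' hqq' g h)]
        simp_rw [stft_add, Pi.add_apply, add_mul]
      map_smul' := fun c f => by
        simp_rw [stft_smul, Pi.smul_apply, smul_eq_mul, mul_assoc, RingHom.id_apply]
        exact integral_const_mul _ _ } ‖h‖
    fun f => (norm_integral_stft_mul_conj_le hpp' hqq' f h).trans (mul_comm _ _).le

theorem pairing_apply (hpp' : p.HolderConjugate p') (hqq' : q.HolderConjugate q')
    (h : ModulationSpace φ p' q' (-lam)) (f : ModulationSpace φ p q lam) :
    pairing hpp' hqq' h f = ∫ z, f.stft z * conj (h.stft z) := rfl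

/-- The map `h ↦ (f ↦ ∫ V_φ f \overline{V_φ h})`. -/
def pairingLinear (hpp' : p.HolderConjugate p') (hqq' : q.HolderConjugate q') :
    ModulationSpace φ p' q' (-lam) →ₛₗ[starRingEnd ℂ] StrongDual ℂ (ModulationSpace φ p q lam) where
  toFun := pairing hpp' hqq'
  map_add' h k := ContinuousLinearMap.ext fun f => by
    rw [add_apply, pairing_apply, pairing_apply, pairing_apply,
      ← integral_add (integrable_stft_mul_conj hpp' hqq' f h)
        (integrable_stft_mul_conj hpp' hqq' f k)]
    simp_rw [stft_add, Pi.add_apply, map_add, mul_add]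
  map_smul' c h := ContinuousLinearMap.ext fun f => by
    rw [smul_apply, pairing_apply, pairing_apply, smul_eq_mul, ← integral_const_mul]
    simp_rw [stft_smul, Pi.smul_apply, smul_eq_mul, map_mul, mul_left_comm]

theorem norm_pairing_le (hpp' : p.HolderConjugate p') (hqq' : q.HolderConjugate q')
    (h : ModulationSpace φ p' q' (-lam)) :
    ‖(pairing hpp' hqq' h : StrongDual ℂ (ModulationSpace φ p q lam))‖ ≤ ‖h‖ :=
  LinearMap.mkContinuous_norm_le _ (norm_nonneg h) _

/-- The complex conjugate of Moyal's identity for h. Thus the functional of h determines h as a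
distribution, and on the orbit it returns c times the conjugate of V_φ h. -/
theorem pairing_ofSOmega (hφ : φ ≠ 0) (hpp' : p.HolderConjugate p')
    (hqq' : q.HolderConjugate q') (h : ModulationSpace φ p' q' (-lam)) (u : SOmega ω d) :
    pairing hpp' hqq' h (ofSOmega φ p q lam u) =
      SOmega.inversionConst φ * conj (h.toDistribution u.conjugate) := by
  have h1 := (OmegaDistribution.integrable_and_integral_stft_mul_conj hφ h.toDistribution u).2
  rw [pairing_apply, stft_ofSOmega, ← Complex.conj_ofReal (SOmega.inversionConst φ), ← map_mul,
    ← h1, ← integral_conj]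
  refine integral_congr_ae (Eventually.of_forall fun z => ?_)
  simp only [map_mul, Complex.conj_conj]
  exact mul_comm _ _

theorem pairing_ofSOmega_shift (hφ : φ ≠ 0) (hpp' : p.HolderConjugate p')
    (hqq' : q.HolderConjugate q') (h : ModulationSpace φ p' q' (-lam)) (z : RSpace d × RSpace d) :
    pairing hpp' hqq' h (ofSOmega φ p q lam (φ.shift z)) =
      SOmega.inversionConst φ * conj (h.stft z) :=
  pairing_ofSOmega hφ hpp' hqq' h (φ.shift z)

theorem pairingLinear_injective (hφ : φ ≠ 0) (hpp' : p.HolderConjugate p')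
    (hqq' : q.HolderConjugate q') :
    Function.Injective (pairingLinear (φ := φ) (lam := lam) hpp' hqq') := by
  refine (injective_iff_map_eq_zero _).2 fun h hh => toDistribution_ext fun u => ?_
  have h1 := pairing_ofSOmega (lam := lam) hφ hpp' hqq' h u.conjugate
  rw [SOmega.conjugate_conjugate] at h1
  have h2 : pairing hpp' hqq' h = (0 : StrongDual ℂ (ModulationSpace φ p q lam)) := hh
  rw [h2, zero_apply] at h1
  have h3 := (mul_eq_zero.1 h1.symm).resolve_left
    (Complex.ofReal_ne_zero.2 (SOmega.inversionConst_pos hφ).ne')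
  exact (map_eq_zero _).1 h3

/-- The orbit coefficients of the functional of h are c conj(V_φ h), so the orbit estimate bounds
c‖h‖ directly. -/
theorem exists_norm_le_norm_pairing (hφ : φ ≠ 0) (hp : p ≠ ∞) (hq : q ≠ ∞)
    (hpp' : p.HolderConjugate p') (hqq' : q.HolderConjugate q') (lam : ℝ) :
    ∃ C : ℝ, ∀ h : ModulationSpace φ p' q' (-lam),
      ‖h‖ ≤ C * ‖(pairing hpp' hqq' h : StrongDual ℂ (ModulationSpace φ p q lam))‖ := by
  obtain ⟨C, hC0, hC⟩ := exists_mixedNorm_orbit_le hφ hp hq hpp' hqq' lam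
  have hc := SOmega.inversionConst_pos hφ
  refine ⟨(SOmega.inversionConst φ)⁻¹ * C, fun h => ?_⟩
  have h1 := hC (pairing hpp' hqq' h)
  have h2 : mixedNorm p' q' (expWeight ω (-lam)) (fun z => pairing hpp' hqq' h
      (ofSOmega φ p q lam (φ.shift z))) = ENNReal.ofReal (SOmega.inversionConst φ) *
        mixedNorm p' q' (expWeight ω (-lam)) h.stft := by
    have hm : Measurable fun z => ‖h.stft z‖ₑ * ‖expWeight ω (-lam) z‖ₑ :=
      h.memMixed.1.enorm.mul (measurable_expWeight ω (-lam)).enorm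
    rw [mixedNorm_eq_mixedENorm, mixedNorm_eq_mixedENorm,
      ← mixedENorm_const_mul hp1'.out hq1'.out hm]
    congr 1
    ext z
    rw [pairing_ofSOmega_shift hφ, enorm_mul, ← ofReal_norm, ← ofReal_norm (conj _),
      RCLike.norm_conj, ofReal_norm (h.stft z), Complex.norm_of_nonneg hc.le, mul_assoc]
  rw [h2] at h1
  have h3 := ENNReal.toReal_le_of_le_ofReal (by positivity) h1
  rw [ENNReal.toReal_mul, ENNReal.toReal_ofReal hc.le, ← norm_def] at h3
  rw [mul_assoc, ← div_eq_inv_mul, le_div_iff₀ hc, mul_comm]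
  exact h3

/-- The distribution `u ↦ c \overline{l(ū)}` obtained from a functional `l`. -/
theorem exists_distribution (φ : SOmega ω d) (l : StrongDual ℂ (ModulationSpace φ p q lam))
    (c : ℂ) : ∃ T : OmegaDistribution ω d,
      ∀ u, T u = c * conj (l (ofSOmega φ p q lam u.conjugate)) := by
  obtain ⟨C, mu, hC0, hmu, hC⟩ := exists_norm_ofSOmega_le φ p q lam
  -- Conjugating both the argument and the value makes T linear.
  let T : SOmega ω d →ₗ[ℂ] ℂ :=
    { toFun := fun u => c * conj (l (ofSOmega φ p q lam u.conjugate))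
      map_add' := fun u v => by rw [SOmega.conjugate_add, map_add, map_add, map_add, mul_add]
      map_smul' := fun a u => by
        rw [SOmega.conjugate_smul, map_smul, map_smul, smul_eq_mul, map_mul, Complex.conj_conj,
          RingHom.id_apply, smul_eq_mul, mul_left_comm] }
  refine ⟨⟨T, SOmega.continuous_of_seminormSum_bound T hmu
    (by positivity : 0 ≤ ‖c‖ * (‖l‖ * C)) fun u => ?_⟩, fun u => rfl⟩
  change ‖c * conj (l (ofSOmega φ p q lam u.conjugate))‖ ≤ _
  rw [norm_mul, RCLike.norm_conj, mul_assoc, mul_assoc]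
  gcongr
  refine (l.le_opNorm _).trans ?_
  gcongr
  refine (hC _).trans ?_
  gcongr
  exact SOmega.seminormSum_conjugate_le hmu u

/-- The distribution c⁻¹ conj(l(ū)) has transform c⁻¹ conj(l(Π(z)φ)), which the orbit estimate
places in L^{p',q'}_{1/m}. Its functional equals l on the orbit, hence everywhere. -/
theorem pairingLinear_surjective (hφ : φ ≠ 0) (hp : p ≠ ∞) (hq : q ≠ ∞)
    (hpp' : p.HolderConjugate p') (hqq' : q.HolderConjugate q') :
    Function.Surjective (pairingLinear (φ := φ) (lam := lam) hpp' hqq') := by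
  intro l
  obtain ⟨C, -, hC⟩ := exists_mixedNorm_orbit_le hφ hp hq hpp' hqq' lam
  have hc : (SOmega.inversionConst φ : ℂ) ≠ 0 :=
    Complex.ofReal_ne_zero.2 (SOmega.inversionConst_pos hφ).ne'
  obtain ⟨T, hT⟩ := exists_distribution φ l (SOmega.inversionConst φ : ℂ)⁻¹
  have hLm : Measurable fun z => l (ofSOmega φ p q lam (φ.shift z)) :=
    (l.continuous.comp (continuous_ofSOmega_shift hp hq)).measurable
  have hst (z) : OmegaDistribution.stft φ T z =
      (SOmega.inversionConst φ : ℂ)⁻¹ * conj (l (ofSOmega φ p q lam (φ.shift z))) := by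
    change T (φ.shift z).conjugate = _
    rw [hT, SOmega.conjugate_conjugate]
  have hmem : T ∈ modulationSubmodule φ p' q' (-lam) := by
    change MemMixed _ _ _ _
    rw [funext hst]
    refine ⟨measurable_const.mul (Complex.continuous_conj.measurable.comp hLm), ?_⟩
    refine (mixedNorm_smul_le p' q' _ (SOmega.inversionConst φ : ℂ)⁻¹
      (fun z => conj (l (ofSOmega φ p q lam (φ.shift z))))).trans_lt
      (ENNReal.mul_lt_top enorm_lt_top ?_)
    refine lt_of_le_of_lt (le_of_eq ?_) ((hC l).trans_lt ENNReal.ofReal_lt_top)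
    rw [mixedNorm_eq_mixedENorm, mixedNorm_eq_mixedENorm]
    congr 1
    ext z
    rw [← ofReal_norm, RCLike.norm_conj, ofReal_norm]
  let h : ModulationSpace φ p' q' (-lam) := ⟨T, hmem⟩
  refine ⟨h, sub_eq_zero.1 (functional_ext hφ hp hq hpp' hqq' fun z => ?_)⟩
  have h1 : h.stft z = _ := hst z
  change pairing hpp' hqq' h _ - l _ = 0
  rw [pairing_ofSOmega_shift hφ, h1, map_mul, Complex.conj_conj, map_inv₀, Complex.conj_ofReal,
    mul_inv_cancel_left₀ hc, sub_self]

end ModulationSpace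

end

theorem mainTheorem11 (d : ℕ) (ω : WeightFunction) (lam : ℝ) (hlam : lam ≠ 0)
    (φ : SOmega ω d) (hφ : φ ≠ 0)
    (p q p' q' : ℝ≥0∞) [Fact (1 ≤ p)] [Fact (1 ≤ q)] [Fact (1 ≤ p')] [Fact (1 ≤ q')]
    (hp : p ≠ ∞) (hq : q ≠ ∞)
    (hpp' : p.HolderConjugate p') (hqq' : q.HolderConjugate q') :
    ((∀ g : SOmega ω d, g.toDistribution ∈ modulationSubmodule φ p q lam) ∧
      Dense {f : ModulationSpace φ p q lam |
        ∃ g : SOmega ω d, f.toDistribution = g.toDistribution}) ∧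
    ∃ Φ : ModulationSpace φ p' q' (-lam) ≃SL[starRingEnd ℂ]
        StrongDual ℂ (ModulationSpace φ p q lam),
      ∀ (h : ModulationSpace φ p' q' (-lam)) (f : ModulationSpace φ p q lam),
        Integrable (fun z : RSpace d × RSpace d => f.stft z * conj (h.stft z)) ∧
        Φ h f = ∫ z : RSpace d × RSpace d, f.stft z * conj (h.stft z) := by
  refine ⟨⟨fun g => SOmega.toDistribution_mem φ g p q lam, ?_⟩, ?_⟩
  · refine (ModulationSpace.dense_range_ofSOmega hφ hp hq hpp' hqq').mono ?_
    rintro _ ⟨g, rfl⟩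
    exact ⟨g, rfl⟩
  · obtain ⟨C, hC⟩ := ModulationSpace.exists_norm_le_norm_pairing hφ hp hq hpp' hqq' lam
    let e := LinearEquiv.ofBijective (ModulationSpace.pairingLinear (φ := φ) (lam := lam) hpp' hqq')
      ⟨ModulationSpace.pairingLinear_injective hφ hpp' hqq',
        ModulationSpace.pairingLinear_surjective hφ hp hq hpp' hqq'⟩
    -- The bound 1 is Hölder's inequality; C, for the inverse, comes from the orbit estimate.
    refine ⟨e.toContinuousLinearEquivOfBounds 1 C (fun h => ?_) (fun l => ?_), fun h f =>
      ⟨ModulationSpace.integrable_stft_mul_conj hpp' hqq' f h, rfl⟩⟩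
    · rw [one_mul]
      exact ModulationSpace.norm_pairing_le hpp' hqq' h
    · have h1 := hC (e.symm l)
      have h2 : ModulationSpace.pairing hpp' hqq' (e.symm l) = l := e.apply_symm_apply l
      rwa [h2] at h1
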